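/- **Conventions.** Let $\mathbb H$ be the quaternions, $\mathbb S=\{J\in\mathbb H: J^2=-1\}$, and give $\mathbb H^n$ the Euclidean norm $|q|^2=\sum|q_h|^2$. "Smooth" means $C^\infty$. Let $D\subseteq\mathbb C^n$ be open and invariant under conjugation of each variable, and let $\Omega_D\subseteq\mathbb H^n$ be the set of points $(x_1+y_1J_1,\dots,x_n+y_nJ_n)$ with $J_h\in\mathbb S$ and $(x_1+iy_1,\dots,x_n+iy_n)\in D$. A *holomorphic stem function* on $D$ is a family of $C^1$ functions $F_K:D\to\mathbb H$, $K\subseteq\{1,\dots,n\}$, such that conjugating $z_h$ changes the sign of $F_K$ if $h\in K$ and leaves $F_K$ unchanged if $h\notin K$, and such that $\partial_{x_h}F_K=\partial_{y_h}F_{K\cup\{h\}}$ and $\partial_{x_h}F_{K\cup\{h\}}=-\partial_{y_h}F_K$ whenever $h\notin K$. A function $f$ on $U\subseteq\mathbb H^n$ is *left* (resp. *right*) *slice regular* if for some such $D$ with $U\subseteq\Omega_D$ and some such $F$ it is the restriction to $U$ of $$\sum_{K}J_{k_1}\cdots J_{k_s}\,F_K(z)\qquad\Big(\text{resp. }\sum_{K}F_K(z)\,J_{k_s}\cdots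 J_{k_1}\Big),\qquad K=\{k_1<\dots<k_s\},\ z_h=x_h+iy_h .$$ A map $U\to\mathbb H^m$ is *slice regular* if it is differentiable and each component is left or right slice regular. A *regular atlas* of a smooth manifold (Hausdorff, second countable) of real dimension $4n$ is a set of smooth charts into $\mathbb H^n$ that cover it and whose transition functions $\varphi_j\circ\varphi_i^{-1}:\varphi_i(U_i\cap U_j)\to\mathbb H^n$ are all slice regular; a manifold is *quaternionic regular* if it admits a regular atlas. A smooth map between manifolds with given regular atlases is *quaternionic regular* if each point $x$ has a chart around $x$ and a chart around its image, in the given atlases, in which the map is slice regular; a *quaternionic diffeomorphism* is a diffeomorphism that is quaternionic regular together with its inverse. $\mathbb{HP}^n$ is the smooth manifold of right lines $[q_0,\dots,q_n]$ of $\mathbb H^{n+1}$. $Bl_0(\mathbb H^n)=\{(q,[a])\in\mathbb H^n\times\mathbb{HP}^{n-1}: q\in[a]\}$ is a smooth manifold with the charts $(q,[a])\mapsto(a_1a_i^{-1},\dots,q_i,\dots,a_na_i^{-1})$ ($q_i$ in place $i$) on $\{a_i\ne0\}$. **Theorem.** Let $n\ge1$, let $M$ be a quaternionic regular manifold of quaternionic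 dimension $n$ with regular atlas $\mathcal A$, let $p\in M$, let $(U,\varphi)\in\mathcal A$ be a chart with $p\in U$, and let $r>0$ be such that the closed ball of radius $r$ around $\varphi(p)$ lies in $\varphi(U)$. Let * $M\#\mathbb{HP}^n$ be the connected sum formed with the disc of radius $r$ around $p$ in the chart $\varphi$ and the disc $\{[1,q]:|q|\le1\}$ of $\mathbb{HP}^n$, that is, the union of $M\setminus\{p\}$ and $\mathbb{HP}^n\setminus\{[1,0,\dots,0]\}$ in which $\varphi^{-1}(\varphi(p)+r\,t\,u)$ is identified with $[1,(1-t)u]$ for all $u\in\mathbb H^n$ with $|u|=1$ and all $0<t<1$; * $Bl_p(M)$ be the blow-up of $M$ at $p$, where $\varphi$ is used to identify $T_pM$ with $\mathbb H^n$, that is, the union of $M\setminus\{p\}$ and $\{(q,[a])\in Bl_0(\mathbb H^n):\varphi(p)+q\in\varphi(U)\}$ in which $x\in U\setminus\{p\}$ is identified with $(q,[q])$, $q=\varphi(x)-\varphi(p)$; and let $\pi:Bl_p(M)\to M$ be the blow-down map, $\pi(x)=x$ and $\pi(q,[a])=\varphi^{-1}(\varphi(p)+q)$. Then $M\#\mathbb{HP}^n$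 and $Bl_p(M)$ are (Hausdorff, second countable) smooth manifolds, and there are a regular atlas $\mathcal A_1$ of $M\#\mathbb{HP}^n$ and a regular atlas $\mathcal A_2$ of $Bl_p(M)$ such that $\pi$ is quaternionic regular with respect to $\mathcal A_2$ and $\mathcal A$, and such that there is a quaternionic diffeomorphism $M\#\mathbb{HP}^n\to Bl_p(M)$ with respect to $\mathcal A_1$ and $\mathcal A_2$. In particular, both manifolds are quaternionic regular. -/

import Mathlib

open Set Topology TopologicalSpace
open scoped Manifold ContDiff Quaternion LinearAlgebra.Projectivization

noncomputable section

/-! ### Slice regular functions of several quaternionic variables -/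

/-- The right quaternionic vector space `ℍⁿ`, with `|q|² = |q₁|² + ⋯ + |qₙ|²`. -/
abbrev QSpace (n : ℕ) : Type := PiLp 2 (fun _ : Fin n => ℍ[ℝ])

/-- Complex conjugation of the `h`-th variable. -/
def conjAt {n : ℕ} (h : Fin n) (z : Fin n → ℂ) : Fin n → ℂ :=
  Function.update z h (star (z h))

/-- Open subsets of `ℂⁿ` that are invariant under conjugation in each variable. -/
structure IsStemDomain {n : ℕ} (D : Set (Fin n → ℂ)) : Prop where
  isOpen : IsOpen D
  conj_mem : ∀ h, ∀ z ∈ D, conjAt h z ∈ D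

/-- `J_h` is an imaginary unit (a point of the sphere `𝕊 = {J | J² = -1}`) for every `h`. -/
def IsImagUnits {n : ℕ} (J : Fin n → ℍ[ℝ]) : Prop := ∀ h, J h ^ 2 = -1

/-- The point `(x₁ + y₁J₁, …, xₙ + yₙJₙ)` of `ℍⁿ`, where `z_h = x_h + y_h i`. -/
def slicePoint {n : ℕ} (z : Fin n → ℂ) (J : Fin n → ℍ[ℝ]) : QSpace n :=
  WithLp.toLp 2 (fun h => ((z h).re : ℍ[ℝ]) + (z h).im • J h)

/-- The circular subset `Ω_D` of `ℍⁿ` associated with `D ⊆ ℂⁿ`. -/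
def circularSet {n : ℕ} (D : Set (Fin n → ℂ)) : Set (QSpace n) :=
  {q | ∃ z ∈ D, ∃ J, IsImagUnits J ∧ q = slicePoint z J}

/-- The ordered product `J_{k₁} ⋯ J_{k_s}`, for `K = {k₁ < ⋯ < k_s}`. -/
def orderedProd {n : ℕ} (J : Fin n → ℍ[ℝ]) (K : Finset (Fin n)) : ℍ[ℝ] :=
  ((K.sort (· ≤ ·)).map J).prod

/-- The product in reverse order `J_{k_s} ⋯ J_{k₁}`, for `K = {k₁ < ⋯ < k_s}`. -/
def reverseProd {n : ℕ} (J : Fin n → ℍ[ℝ]) (K : Finset (Fin n)) : ℍ[ℝ] :=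
  ((K.sort (· ≤ ·)).reverse.map J).prod

/-- The complex structure `𝒥_h` on `ℍ ⊗ ℝₙ`, in components. An element `a = ∑_K e_K a_K` is
represented by the family `K ↦ a_K`; since `𝒥_h e_K = -e_{K \ h}` for `h ∈ K` and
`𝒥_h e_K = e_{K ∪ h}` for `h ∉ K`, the `K`-component of `𝒥_h a` is as follows. -/
def stemJ {n : ℕ} (h : Fin n) (a : Finset (Fin n) → ℍ[ℝ]) (K : Finset (Fin n)) : ℍ[ℝ] :=
  if h ∈ K then a (K.erase h) else - a (insert h K)

/-- Holomorphic stem functions of class `C¹` on `D`, given by their components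
`F_K : D → ℍ`: the Clifford intrinsic condition and the equations
`∂F/∂x_h + 𝒥_h ∂F/∂y_h = 0` for every `h`. -/
structure IsHolomorphicStem {n : ℕ} (D : Set (Fin n → ℂ))
    (F : Finset (Fin n) → (Fin n → ℂ) → ℍ[ℝ]) : Prop where
  domain : IsStemDomain D
  intrinsic : ∀ K h, ∀ z ∈ D, F K (conjAt h z) = if h ∈ K then - F K z else F K z
  contDiffOn : ∀ K, ContDiffOn ℝ 1 (F K) D
  holomorphic : ∀ h, ∀ z ∈ D, ∀ K,
    fderiv ℝ (F K) z (Pi.single h 1) +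
      stemJ h (fun L => fderiv ℝ (F L) z (Pi.single h Complex.I)) K = 0

/-- `f` is, on `U`, (the restriction of) a left slice regular function `∑_K J_K F_K`, where `F`
is a holomorphic stem function on some `D` with `U ⊆ Ω_D`. -/
def IsLeftSliceRegularOn {n : ℕ} (f : QSpace n → ℍ[ℝ]) (U : Set (QSpace n)) : Prop :=
  ∃ (D : Set (Fin n → ℂ)) (F : Finset (Fin n) → (Fin n → ℂ) → ℍ[ℝ]),
    IsHolomorphicStem D F ∧ U ⊆ circularSet D ∧
    ∀ z ∈ D, ∀ J, IsImagUnits J → slicePoint z J ∈ U →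
      f (slicePoint z J) = ∑ K : Finset (Fin n), orderedProd J K * F K z

/-- `f` is, on `U`, (the restriction of) a right slice regular function. A stem function is
represented here by its components in the basis `e_{k_s} ⋯ e_{k₁}` of `ℝₙ` (reverse products);
in that basis the conjugate structure `𝒥ʳ_h x = -(𝒥_h xᶜ)ᶜ` is again given by `stemJ`. -/
def IsRightSliceRegularOn {n : ℕ} (f : QSpace n → ℍ[ℝ]) (U : Set (QSpace n)) : Prop :=
  ∃ (D : Set (Fin n → ℂ)) (F : Finset (Fin n) → (Fin n → ℂ) → ℍ[ℝ]),
    IsHolomorphicStem D F ∧ U ⊆ circularSet D ∧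
    ∀ z ∈ D, ∀ J, IsImagUnits J → slicePoint z J ∈ U →
      f (slicePoint z J) = ∑ K : Finset (Fin n), F K z * reverseProd J K

/-- Slice regular maps: differentiable, and each component is left or right slice regular. -/
def IsSliceRegularOn {n m : ℕ} (f : QSpace n → QSpace m) (U : Set (QSpace n)) : Prop :=
  DifferentiableOn ℝ f U ∧
    ∀ i, IsLeftSliceRegularOn (fun q => f q i) U ∨ IsRightSliceRegularOn (fun q => f q i) U

/-! ### Quaternionic regular manifolds and maps -/

/-- A regular atlas of a differentiable manifold `M` of real dimension `4n`: a set of charts of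
the differentiable structure that covers `M` and has slice regular transition functions. -/
structure IsRegularAtlas {n : ℕ} {M : Type*} [TopologicalSpace M] [ChartedSpace (QSpace n) M]
    (A : Set (OpenPartialHomeomorph M (QSpace n))) : Prop where
  subset_maximalAtlas : A ⊆ IsManifold.maximalAtlas 𝓘(ℝ, QSpace n) ∞ M
  cover : ∀ x : M, ∃ e ∈ A, x ∈ e.source
  transition : ∀ e ∈ A, ∀ e' ∈ A,
    IsSliceRegularOn (fun q => e' (e.symm q)) (e.symm.trans e').source

/-- Quaternionic regular maps with respect to regular atlases `A` of `M` and `B` of `N`. -/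
structure IsQuaternionicRegular {n m : ℕ} {M N : Type*}
    [TopologicalSpace M] [ChartedSpace (QSpace n) M]
    [TopologicalSpace N] [ChartedSpace (QSpace m) N]
    (A : Set (OpenPartialHomeomorph M (QSpace n)))
    (B : Set (OpenPartialHomeomorph N (QSpace m))) (f : M → N) : Prop where
  contMDiff : ContMDiff 𝓘(ℝ, QSpace n) 𝓘(ℝ, QSpace m) ∞ f
  regular : ∀ x : M, ∃ e ∈ A, ∃ e' ∈ B, x ∈ e.source ∧ f x ∈ e'.source ∧
    IsSliceRegularOn (fun q => e' (f (e.symm q)))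
      {q | q ∈ e.target ∧ f (e.symm q) ∈ e'.source}

/-! ### Gluing two spaces along open subsets -/

/-- Open sets `U ⊆ X` and `V ⊆ Y` and a homeomorphism `U ≃ V` along which to glue. -/
structure GluingData (X Y : Type*) [TopologicalSpace X] [TopologicalSpace Y] where
  U : Opens X
  V : Opens Y
  homeo : U ≃ₜ V

namespace GluingData

variable {X Y : Type*} [TopologicalSpace X] [TopologicalSpace Y]

/-- The equivalence relation on `X ⊔ Y` that identifies `x ∈ U` with its image in `V`. -/
def Rel (G : GluingData X Y) : X ⊕ Y → X ⊕ Y → Prop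
  | .inl x, .inl x' => x = x'
  | .inr y, .inr y' => y = y'
  | .inl x, .inr y => ∃ h : x ∈ G.U, (G.homeo ⟨x, h⟩ : Y) = y
  | .inr y, .inl x => ∃ h : x ∈ G.U, (G.homeo ⟨x, h⟩ : Y) = y

theorem rel_equivalence (G : GluingData X Y) : Equivalence G.Rel where
  refl a := by cases a <;> simp [Rel]
  symm {a b} h := by
    cases a <;> cases b <;> simp only [Rel] at h ⊢
    · exact h.symm
    · exact h
    · exact h
    · exact h.symm
  trans {a b c} h h' := by
    rcases a with a | a <;> rcases b with b | b <;> rcases c with c | c <;>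
      simp only [Rel] at h h' ⊢
    · exact h.trans h'
    · subst h; exact h'
    · obtain ⟨u, rfl⟩ := h
      obtain ⟨v, hv⟩ := h'
      have := G.homeo.injective (Subtype.ext hv)
      exact (congrArg Subtype.val this).symm
    · subst h'; exact h
    · subst h'; exact h
    · obtain ⟨u, rfl⟩ := h
      obtain ⟨v, hv⟩ := h'
      exact hv
    · subst h; exact h'
    · exact h.trans h'

def setoid (G : GluingData X Y) : Setoid (X ⊕ Y) := ⟨G.Rel, G.rel_equivalence⟩

/-- The space `X ∪ Y` obtained from `X ⊔ Y` by the identification, with the quotient topology. -/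
def Glued (G : GluingData X Y) : Type _ := Quotient G.setoid

instance (G : GluingData X Y) : TopologicalSpace G.Glued :=
  inferInstanceAs (TopologicalSpace (Quotient G.setoid))

def inl (G : GluingData X Y) (x : X) : G.Glued := Quotient.mk G.setoid (.inl x)

def inr (G : GluingData X Y) (y : Y) : G.Glued := Quotient.mk G.setoid (.inr y)

theorem inl_eq_inl (G : GluingData X Y) {x x' : X} : G.inl x = G.inl x' ↔ x = x' :=
  Quotient.eq (r := G.setoid)

theorem inr_eq_inr (G : GluingData X Y) {y y' : Y} : G.inr y = G.inr y' ↔ y = y' :=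
  Quotient.eq (r := G.setoid)

theorem inl_eq_inr (G : GluingData X Y) {x : X} {y : Y} :
    G.inl x = G.inr y ↔ ∃ h : x ∈ G.U, (G.homeo ⟨x, h⟩ : Y) = y :=
  Quotient.eq (r := G.setoid)

theorem continuous_inl (G : GluingData X Y) : Continuous G.inl :=
  continuous_quotient_mk'.comp _root_.continuous_inl

theorem continuous_inr (G : GluingData X Y) : Continuous G.inr :=
  continuous_quotient_mk'.comp _root_.continuous_inr

theorem isOpen_iff (G : GluingData X Y) {s : Set G.Glued} :
    IsOpen s ↔ IsOpen (G.inl ⁻¹' s) ∧ IsOpen (G.inr ⁻¹' s) := by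
  have h : IsQuotientMap (Quotient.mk G.setoid : X ⊕ Y → G.Glued) :=
    isQuotientMap_quotient_mk' (s := G.setoid)
  exact h.isOpen_preimage.symm.trans isOpen_sum_iff

theorem isOpenEmbedding_inl (G : GluingData X Y) : IsOpenEmbedding G.inl := by
  refine .of_continuous_injective_isOpenMap G.continuous_inl (fun a b h => G.inl_eq_inl.1 h) ?_
  intro s hs
  refine G.isOpen_iff.2 ⟨?_, ?_⟩
  · rwa [preimage_image_eq _ (fun a b h => G.inl_eq_inl.1 h)]
  · have : G.inr ⁻¹' (G.inl '' s) =
        (fun v : G.V => (v : Y)) '' (G.homeo.symm ⁻¹' ((fun u : G.U => (u : X)) ⁻¹' s)) := by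
      ext y
      simp only [mem_preimage, mem_image, G.inl_eq_inr]
      constructor
      · rintro ⟨x, hx, hu, rfl⟩
        exact ⟨_, by simpa using hx, rfl⟩
      · rintro ⟨v, hv, rfl⟩
        exact ⟨_, hv, (G.homeo.symm v).2, by simp⟩
    rw [this]
    exact G.V.isOpen.isOpenMap_subtype_val _
      ((hs.preimage continuous_subtype_val).preimage G.homeo.symm.continuous)

theorem isOpenEmbedding_inr (G : GluingData X Y) : IsOpenEmbedding G.inr := by
  refine .of_continuous_injective_isOpenMap G.continuous_inr (fun a b h => G.inr_eq_inr.1 h) ?_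
  intro s hs
  refine G.isOpen_iff.2 ⟨?_, ?_⟩
  · have : G.inl ⁻¹' (G.inr '' s) =
        (fun u : G.U => (u : X)) '' (G.homeo ⁻¹' ((fun v : G.V => (v : Y)) ⁻¹' s)) := by
      ext x
      simp only [mem_preimage, mem_image]
      constructor
      · rintro ⟨y, hy, h⟩
        obtain ⟨hu, rfl⟩ := G.inl_eq_inr.1 h.symm
        exact ⟨⟨x, hu⟩, hy, rfl⟩
      · rintro ⟨u, hu, rfl⟩
        exact ⟨_, hu, (G.inl_eq_inr.2 ⟨u.2, rfl⟩).symm⟩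
    rw [this]
    exact G.U.isOpen.isOpenMap_subtype_val _
      ((hs.preimage continuous_subtype_val).preimage G.homeo.continuous)
  · rwa [preimage_image_eq _ (fun a b h => G.inr_eq_inr.1 h)]

/-- The charts of a glued space are the charts of the two pieces. -/
instance {H : Type*} [TopologicalSpace H] [Nonempty H] [ChartedSpace H X] [ChartedSpace H Y]
    (G : GluingData X Y) : ChartedSpace H G.Glued where
  atlas := (fun e => e.lift_openEmbedding G.isOpenEmbedding_inl) '' atlas H X ∪
    (fun e => e.lift_openEmbedding G.isOpenEmbedding_inr) '' atlas H Y
  chartAt z := Sum.elim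
    (fun x => (chartAt H x).lift_openEmbedding G.isOpenEmbedding_inl)
    (fun y => (chartAt H y).lift_openEmbedding G.isOpenEmbedding_inr) (Quotient.out z)
  mem_chart_source z := by
    have hz : Quotient.mk G.setoid (Quotient.out z) = z := Quotient.out_eq z
    rcases h : (Quotient.out z : X ⊕ Y) with x | y
    · rw [h] at hz
      exact ⟨x, mem_chart_source H x, hz⟩
    · rw [h] at hz
      exact ⟨y, mem_chart_source H y, hz⟩
  chart_mem_atlas z := by
    rcases (Quotient.out z : X ⊕ Y) with x | y
    · exact Or.inl ⟨_, chart_mem_atlas H x, rfl⟩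
    · exact Or.inr ⟨_, chart_mem_atlas H y, rfl⟩

end GluingData

/-! ### Connected sums -/

/-- A coordinate disc in `M`: a chart around a point (the centre) whose image contains the closed
ball of a given radius around the image of the centre. -/
structure CoordDisc (E M : Type*) [NormedAddCommGroup E] [TopologicalSpace M] where
  chart : OpenPartialHomeomorph M E
  center : M
  radius : ℝ
  center_mem : center ∈ chart.source
  radius_pos : 0 < radius
  closedBall_subset : Metric.closedBall (chart center) radius ⊆ chart.target

/-- `M` without the point `p`. -/
abbrev puncture (M : Type*) [TopologicalSpace M] [T1Space M] (p : M) : Opens M :=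
  ⟨{p}ᶜ, isOpen_compl_singleton⟩

/-- The map `t u ↦ (1 - t) u`, for `u` a unit vector and `0 < t < 1`. -/
def radialFlip {E : Type*} [NormedAddCommGroup E] [NormedSpace ℝ E] (w : E) : E :=
  ((1 - ‖w‖) / ‖w‖) • w

theorem norm_radialFlip {E : Type*} [NormedAddCommGroup E] [NormedSpace ℝ E] {w : E}
    (h0 : w ≠ 0) (h1 : ‖w‖ < 1) : ‖radialFlip w‖ = 1 - ‖w‖ := by
  have hw : 0 < ‖w‖ := norm_pos_iff.2 h0
  have : 0 < 1 - ‖w‖ := by linarith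
  rw [radialFlip, norm_smul, Real.norm_eq_abs, abs_of_pos (by positivity)]
  field_simp

theorem radialFlip_radialFlip {E : Type*} [NormedAddCommGroup E] [NormedSpace ℝ E] {w : E}
    (h0 : w ≠ 0) (h1 : ‖w‖ < 1) : radialFlip (radialFlip w) = w := by
  have hw : 0 < ‖w‖ := norm_pos_iff.2 h0
  have : 0 < 1 - ‖w‖ := by linarith
  rw [radialFlip, norm_radialFlip h0 h1, radialFlip, smul_smul]
  have : (1 - (1 - ‖w‖)) / (1 - ‖w‖) * ((1 - ‖w‖) / ‖w‖) = 1 := by field_simp; ring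
  rw [this, one_smul]

theorem continuousOn_radialFlip {E : Type*} [NormedAddCommGroup E] [NormedSpace ℝ E] :
    ContinuousOn (radialFlip : E → E) {0}ᶜ := by
  unfold radialFlip
  refine ContinuousOn.smul (ContinuousOn.div (by fun_prop) (by fun_prop) ?_) continuousOn_id
  intro w hw
  exact norm_ne_zero_iff.2 hw

namespace CoordDisc

variable {E : Type*} [NormedAddCommGroup E] [NormedSpace ℝ E]
  {M : Type*} [TopologicalSpace M]

/-- The normalized coordinate: it maps the open disc onto the open unit ball, and the centre
to the origin. -/
def coord (d : CoordDisc E M) (x : M) : E := d.radius⁻¹ • (d.chart x - d.chart d.center)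

/-- The inverse of the normalized coordinate. -/
def param (d : CoordDisc E M) (w : E) : M := d.chart.symm (d.chart d.center + d.radius • w)

/-- The open coordinate disc. -/
def openDisc (d : CoordDisc E M) : Set M := {x | x ∈ d.chart.source ∧ ‖d.coord x‖ < 1}

theorem add_mem_target (d : CoordDisc E M) {w : E} (hw : ‖w‖ < 1) :
    d.chart d.center + d.radius • w ∈ d.chart.target := by
  apply d.closedBall_subset
  rw [mem_closedBall_iff_norm, add_sub_cancel_left, norm_smul, Real.norm_eq_abs,
    abs_of_pos d.radius_pos]
  nlinarith [d.radius_pos]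

theorem coord_param (d : CoordDisc E M) {w : E} (hw : ‖w‖ < 1) : d.coord (d.param w) = w := by
  rw [coord, param, d.chart.right_inv (d.add_mem_target hw), add_sub_cancel_left,
    inv_smul_smul₀ d.radius_pos.ne']

theorem param_coord (d : CoordDisc E M) {x : M} (hx : x ∈ d.chart.source) :
    d.param (d.coord x) = x := by
  rw [coord, param, smul_inv_smul₀ d.radius_pos.ne', add_sub_cancel, d.chart.left_inv hx]

theorem param_mem_source (d : CoordDisc E M) {w : E} (hw : ‖w‖ < 1) :
    d.param w ∈ d.chart.source :=
  d.chart.map_target (d.add_mem_target hw)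

theorem coord_center (d : CoordDisc E M) : d.coord d.center = 0 := by simp [coord]

theorem coord_ne_zero (d : CoordDisc E M) {x : M} (hx : x ∈ d.chart.source)
    (h : x ≠ d.center) : d.coord x ≠ 0 := by
  intro h0
  apply h
  rw [← d.param_coord hx, h0, ← d.coord_center, d.param_coord d.center_mem]

theorem param_ne_center (d : CoordDisc E M) {w : E} (hw : ‖w‖ < 1) (h0 : w ≠ 0) :
    d.param w ≠ d.center := by
  intro h
  apply h0
  rw [← d.coord_param hw, h, d.coord_center]

theorem continuousOn_coord (d : CoordDisc E M) : ContinuousOn d.coord d.chart.source :=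
  (d.chart.continuousOn.sub continuousOn_const).const_smul _

theorem continuousOn_param (d : CoordDisc E M) : ContinuousOn d.param (Metric.ball 0 1) := by
  refine d.chart.continuousOn_symm.comp (by fun_prop) ?_
  intro w hw
  exact d.add_mem_target (by simpa using hw)

theorem isOpen_openDisc (d : CoordDisc E M) : IsOpen d.openDisc := by
  have := d.continuousOn_coord.isOpen_inter_preimage d.chart.open_source
    (Metric.isOpen_ball (x := (0 : E)) (ε := 1))
  convert this using 1
  ext x
  simp [openDisc]

/-- One direction of the identification of two punctured open discs. -/
theorem flip_mem {M' : Type*} [TopologicalSpace M'] (d : CoordDisc E M) (d' : CoordDisc E M')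
    {x : M} (hx : x ∈ d.openDisc) (hc : x ≠ d.center) :
    d'.param (radialFlip (d.coord x)) ∈ d'.openDisc ∧
      d'.param (radialFlip (d.coord x)) ≠ d'.center ∧
      d.param (radialFlip (d'.coord (d'.param (radialFlip (d.coord x))))) = x := by
  have h0 := d.coord_ne_zero hx.1 hc
  have h1 := norm_radialFlip h0 hx.2
  have h2 : ‖radialFlip (d.coord x)‖ < 1 := by
    rw [h1]; linarith [norm_pos_iff.2 h0]
  have h3 : radialFlip (d.coord x) ≠ 0 := by
    rw [← norm_pos_iff, h1]; linarith [hx.2]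
  refine ⟨⟨d'.param_mem_source h2, ?_⟩, d'.param_ne_center h2 h3, ?_⟩
  · rwa [d'.coord_param h2]
  · rw [d'.coord_param h2, radialFlip_radialFlip h0 hx.2, d.param_coord hx.1]

theorem continuous_flip {M' : Type*} [TopologicalSpace M']
    (d : CoordDisc E M) (d' : CoordDisc E M') :
    ContinuousOn (fun x => d'.param (radialFlip (d.coord x))) (d.openDisc ∩ {d.center}ᶜ) := by
  refine d'.continuousOn_param.comp (continuousOn_radialFlip.comp
    (d.continuousOn_coord.mono fun x hx => hx.1.1) ?_) ?_
  · intro x hx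
    exact d.coord_ne_zero hx.1.1 hx.2
  · intro x hx
    have h0 := d.coord_ne_zero hx.1.1 hx.2
    rw [mem_ball_zero_iff, norm_radialFlip h0 hx.1.2]
    linarith [norm_pos_iff.2 h0]

/-- The gluing of `M ∖ {centre}` and `M' ∖ {centre}` which, in the normalized coordinates of the
two discs, identifies `t u` with `(1 - t) u` for all unit vectors `u` and `0 < t < 1`. -/
def connectedSumData [T1Space M] {M' : Type*} [TopologicalSpace M'] [T1Space M']
    (d : CoordDisc E M) (d' : CoordDisc E M') :
    GluingData (puncture M d.center) (puncture M' d'.center) where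
  U := ⟨{x | (x : M) ∈ d.openDisc}, d.isOpen_openDisc.preimage continuous_subtype_val⟩
  V := ⟨{y | (y : M') ∈ d'.openDisc}, d'.isOpen_openDisc.preimage continuous_subtype_val⟩
  homeo :=
    { toFun := fun x => ⟨⟨d'.param (radialFlip (d.coord x.1.1)),
        (d.flip_mem d' x.2 x.1.2).2.1⟩, (d.flip_mem d' x.2 x.1.2).1⟩
      invFun := fun y => ⟨⟨d.param (radialFlip (d'.coord y.1.1)),
        (d'.flip_mem d y.2 y.1.2).2.1⟩, (d'.flip_mem d y.2 y.1.2).1⟩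
      left_inv := fun x => Subtype.ext (Subtype.ext (d.flip_mem d' x.2 x.1.2).2.2)
      right_inv := fun y => Subtype.ext (Subtype.ext (d'.flip_mem d y.2 y.1.2).2.2)
      continuous_toFun := by
        refine Continuous.subtype_mk (Continuous.subtype_mk ?_ _) _
        exact (d.continuous_flip d').comp_continuous
          (continuous_subtype_val.comp continuous_subtype_val) fun x => ⟨x.2, x.1.2⟩
      continuous_invFun := by
        refine Continuous.subtype_mk (Continuous.subtype_mk ?_ _) _
        exact (d'.continuous_flip d).comp_continuous
          (continuous_subtype_val.comp continuous_subtype_val) fun x => ⟨x.2, x.1.2⟩ }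

end CoordDisc

/-- The connected sum of two manifolds along coordinate discs: the centres are removed, and the
punctured discs are identified by `t u ↦ (1 - t) u`. -/
abbrev ConnectedSum {E : Type*} [NormedAddCommGroup E] [NormedSpace ℝ E]
    {M : Type*} [TopologicalSpace M] [T1Space M] {M' : Type*} [TopologicalSpace M'] [T1Space M']
    (d : CoordDisc E M) (d' : CoordDisc E M') : Type _ :=
  (d.connectedSumData d').Glued

/-! ### Quaternionic projective spaces -/

/-- The space of right vector lines `{(q₁λ, …, q_mλ) | λ ∈ ℍ}` of `ℍᵐ`. Right scalars are left
scalars of the opposite ring. -/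
abbrev QLines (m : ℕ) : Type := ℙ ℍ[ℝ]ᵐᵒᵖ (QSpace m)

instance (m : ℕ) : TopologicalSpace (QLines m) :=
  inferInstanceAs (TopologicalSpace (Quotient (projectivizationSetoid ℍ[ℝ]ᵐᵒᵖ (QSpace m))))

namespace QLines

theorem isQuotientMap_mk' (m : ℕ) :
    IsQuotientMap (Projectivization.mk' ℍ[ℝ]ᵐᵒᵖ : {v : QSpace m // v ≠ 0} → QLines m) :=
  isQuotientMap_quotient_mk'

/-- The function `[a] ↦ a_k a_i⁻¹` (of interest where `a_i ≠ 0`). -/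
def ratio {m : ℕ} (i k : Fin m) : QLines m → ℍ[ℝ] :=
  Projectivization.lift (fun a => a.1 k * (a.1 i)⁻¹) (by
    rintro ⟨a, ha⟩ ⟨b, hb⟩ t h
    have ht : t.unop ≠ 0 := by
      rintro h0
      apply ha
      simp only at h
      rw [h, MulOpposite.unop_eq_zero_iff t |>.1 h0, zero_smul]
    have hk : ∀ k, a k = b k * t.unop := fun k => by
      simp only at h
      rw [h]; rfl
    simp only [hk, mul_inv_rev]
    rw [mul_assoc, mul_inv_cancel_left₀ ht])

/-- The set `{[a] | a_i ≠ 0}`. -/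
def affine {m : ℕ} (i : Fin m) : Set (QLines m) := {a | ratio i i a ≠ 0}

theorem ratio_mk {m : ℕ} (i k : Fin m) (a : QSpace m) (ha : a ≠ 0) :
    ratio i k (Projectivization.mk _ a ha) = a k * (a i)⁻¹ := rfl

theorem mk_mem_affine {m : ℕ} (i : Fin m) (a : QSpace m) (ha : a ≠ 0) :
    Projectivization.mk _ a ha ∈ affine i ↔ a i ≠ 0 := by
  rw [affine, mem_ofPred_eq, ratio_mk]
  by_cases h : a i = 0 <;> simp [h]

theorem ratio_self {m : ℕ} {i : Fin m} {a : QLines m} (h : a ∈ affine i) : ratio i i a = 1 := by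
  induction a using Projectivization.ind with
  | h a ha =>
    rw [ratio_mk]
    exact mul_inv_cancel₀ ((mk_mem_affine i a ha).1 h)

theorem isOpen_affine {m : ℕ} (i : Fin m) : IsOpen (affine i) := by
  rw [← (isQuotientMap_mk' m).isOpen_preimage]
  have : Projectivization.mk' ℍ[ℝ]ᵐᵒᵖ ⁻¹' (affine i) =
      {v : {v : QSpace m // v ≠ 0} | v.1 i ≠ 0} := by
    ext v
    exact mk_mem_affine i v.1 v.2
  rw [this]
  exact isOpen_ne_fun (by fun_prop) continuous_const

theorem continuousOn_ratio {m : ℕ} (i k : Fin m) : ContinuousOn (ratio i k) (affine i) := by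
  rw [(isQuotientMap_mk' m).continuousOn_isOpen_iff (isOpen_affine i)]
  have : ContinuousOn (fun v : {v : QSpace m // v ≠ 0} => v.1 k * (v.1 i)⁻¹)
      {v | v.1 i ≠ 0} :=
    ContinuousOn.mul (by fun_prop) (ContinuousOn.inv₀ (by fun_prop) fun v hv => hv)
  exact this.mono fun v hv => (mk_mem_affine i v.1 v.2).1 hv

theorem mk_ratio {m : ℕ} {i : Fin m} {a : QLines m} (h : a ∈ affine i)
    (h0 : WithLp.toLp 2 (fun k => ratio i k a) ≠ (0 : QSpace m)) :
    Projectivization.mk ℍ[ℝ]ᵐᵒᵖ (WithLp.toLp 2 (fun k => ratio i k a)) h0 = a := by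
  induction a using Projectivization.ind with
  | h a ha =>
    rw [Projectivization.mk_eq_mk_iff']
    exact ⟨MulOpposite.op (a i)⁻¹, rfl⟩

instance (m : ℕ) : T1Space (QLines m) := by
  refine ⟨fun a => ?_⟩
  rw [← (isQuotientMap_mk' m).isClosed_preimage]
  induction a using Projectivization.ind with
  | h a ha =>
    obtain ⟨i, hi⟩ : ∃ i, a i ≠ 0 := by
      by_contra! h
      exact ha (PiLp.ext h)
    have : Projectivization.mk' ℍ[ℝ]ᵐᵒᵖ ⁻¹' {Projectivization.mk ℍ[ℝ]ᵐᵒᵖ a ha} =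
        ⋂ k, {v : {v : QSpace m // v ≠ 0} | v.1 k = a k * ((a i)⁻¹ * v.1 i)} := by
      ext v
      simp only [mem_preimage, mem_singleton_iff, mem_iInter, mem_ofPred_eq,
        Projectivization.mk'_eq_mk]
      rw [Projectivization.mk_eq_mk_iff']
      constructor
      · rintro ⟨t, ht⟩ k
        have hk : ∀ k, v.1 k = a k * t.unop := fun k => by rw [← ht]; rfl
        rw [hk k, hk i, inv_mul_cancel_left₀ hi]
      · intro h
        exact ⟨MulOpposite.op ((a i)⁻¹ * v.1 i), PiLp.ext fun k => (h k).symm⟩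
    rw [this]
    exact isClosed_iInter fun k => isClosed_eq (by fun_prop) (by fun_prop)

end QLines

/-- The quaternionic projective space `ℍℙⁿ`. -/
abbrev HP (n : ℕ) : Type := QLines (n + 1)

namespace HP

/-- The vector with `1` in place `i` and the coordinates of `q` in the other places. -/
def homog {n : ℕ} (i : Fin (n + 1)) (q : QSpace n) : QSpace (n + 1) :=
  WithLp.toLp 2 (i.insertNth 1 (fun k => q k))

theorem homog_self {n : ℕ} (i : Fin (n + 1)) (q : QSpace n) : homog i q i = 1 := by
  simp [homog]

theorem homog_succAbove {n : ℕ} (i : Fin (n + 1)) (q : QSpace n) (k : Fin n) :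
    homog i q (i.succAbove k) = q k := by
  simp [homog]

theorem homog_ne_zero {n : ℕ} (i : Fin (n + 1)) (q : QSpace n) : homog i q ≠ 0 := by
  intro h
  have := homog_self i q
  rw [h] at this
  simp at this

/-- The natural coordinates `[a] ↦ (a_k a_i⁻¹)_{k ≠ i}` on `{[a] | a_i ≠ 0}`. -/
def affineChart {n : ℕ} (i : Fin (n + 1)) : OpenPartialHomeomorph (HP n) (QSpace n) where
  toFun a := WithLp.toLp 2 (fun k => QLines.ratio i (i.succAbove k) a)
  invFun q := Projectivization.mk _ (homog i q) (homog_ne_zero i q)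
  source := QLines.affine i
  target := univ
  map_source' _ _ := mem_univ _
  map_target' q _ := (QLines.mk_mem_affine i _ _).2 (by rw [homog_self]; exact one_ne_zero)
  left_inv' a ha := by
    have key : homog i (WithLp.toLp 2 (fun k => QLines.ratio i (i.succAbove k) a)) =
        WithLp.toLp 2 (fun k => QLines.ratio i k a) := by
      refine PiLp.ext fun k => ?_
      refine Fin.succAboveCases i ?_ (fun k => ?_) k
      · rw [homog_self]; exact (QLines.ratio_self ha).symm
      · rw [homog_succAbove]
    simp only [key]
    exact QLines.mk_ratio ha _
  right_inv' q _ := by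
    refine PiLp.ext fun k => ?_
    simp [QLines.ratio_mk, homog_self, homog_succAbove]
  open_source := QLines.isOpen_affine i
  open_target := isOpen_univ
  continuousOn_toFun := by
    refine (PiLp.continuous_toLp 2 _).comp_continuousOn (continuousOn_pi.2 fun k => ?_)
    exact QLines.continuousOn_ratio _ _
  continuousOn_invFun := by
    refine Continuous.continuousOn ?_
    have hc : Continuous (homog i : QSpace n → QSpace (n + 1)) := ?_
    · exact (QLines.isQuotientMap_mk' (n + 1)).continuous.comp
        (hc.subtype_mk (p := fun v => v ≠ 0) (homog_ne_zero i))
    refine (PiLp.continuous_toLp 2 _).comp (continuous_pi fun k => ?_)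
    refine Fin.succAboveCases i ?_ (fun k => ?_) k
    · simp only [Fin.insertNth_apply_same]; exact continuous_const
    · simp only [Fin.insertNth_apply_succAbove]; fun_prop

theorem exists_mem_affine {m : ℕ} (a : QLines m) : ∃ i, a ∈ QLines.affine i := by
  induction a using Projectivization.ind with
  | h a ha =>
    by_contra! h
    exact ha (PiLp.ext fun i => not_not.1 ((QLines.mk_mem_affine i a ha).not.1 (h i)))

instance (n : ℕ) : ChartedSpace (QSpace n) (HP n) where
  atlas := range affineChart
  chartAt a := affineChart (exists_mem_affine a).choose
  mem_chart_source a := (exists_mem_affine a).choose_spec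
  chart_mem_atlas _ := mem_range_self _

/-- The unit disc `{[1, q₁, …, qₙ] | |q| ≤ 1}` around the point `[1, 0, …, 0]` of `ℍℙⁿ`. -/
def standardDisc (n : ℕ) : CoordDisc (QSpace n) (HP n) where
  chart := affineChart 0
  center := Projectivization.mk _ (homog 0 0) (homog_ne_zero 0 0)
  radius := 1
  center_mem := (affineChart 0).map_target (mem_univ (0 : QSpace n))
  radius_pos := one_pos
  closedBall_subset := subset_univ _

end HP

/-! ### Blow-ups -/

/-- The blow-up `Bl₀(ℍⁿ)`: the pairs `(q, [a]) ∈ ℍⁿ × ℍℙⁿ⁻¹` such that `q` lies in the line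
`[a]`, with the topology induced by the product. -/
abbrev Bl₀ (n : ℕ) : Type := {z : QSpace n × QLines n // z.1 ∈ z.2.submodule}

namespace Bl₀

theorem mem_submodule_iff {m : ℕ} {i : Fin m} {a : QLines m} (h : a ∈ QLines.affine i)
    (q : QSpace m) : q ∈ a.submodule ↔ ∀ k, q k = QLines.ratio i k a * q i := by
  induction a using Projectivization.ind with
  | h a ha =>
    have hi := (QLines.mk_mem_affine i a ha).1 h
    rw [Projectivization.submodule_mk, Submodule.mem_span_singleton]
    constructor
    · rintro ⟨t, rfl⟩ k
      change a k * t.unop = a k * (a i)⁻¹ * (a i * t.unop)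
      rw [mul_assoc, inv_mul_cancel_left₀ hi]
    · intro hq
      refine ⟨MulOpposite.op ((a i)⁻¹ * q i), PiLp.ext fun k => ?_⟩
      change a k * ((a i)⁻¹ * q i) = q k
      rw [hq k, QLines.ratio_mk, mul_assoc]

/-- The vector `(b₁, …, b_{i-1}, 1, b_{i+1}, …, bₙ)`. -/
def slopes {n : ℕ} (i : Fin n) (b : QSpace n) : QSpace n :=
  WithLp.toLp 2 (Function.update (fun k => b k) i 1)

theorem slopes_self {n : ℕ} (i : Fin n) (b : QSpace n) : slopes i b i = 1 := by
  simp [slopes]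

theorem slopes_ne_zero {n : ℕ} (i : Fin n) (b : QSpace n) : slopes i b ≠ 0 := by
  intro h
  have := slopes_self i b
  rw [h] at this
  simp at this

theorem continuous_slopes {n : ℕ} (i : Fin n) : Continuous (slopes i : QSpace n → QSpace n) :=
  (PiLp.continuous_toLp 2 _).comp
    (Continuous.update (by fun_prop) i continuous_const)

/-- The natural coordinates `(q, [a]) ↦ (a₁a_i⁻¹, …, q_i, …, aₙa_i⁻¹)` (with `q_i` in place `i`)
on `{(q, [a]) | a_i ≠ 0}`, with the inverse
`b ↦ ((b₁b_i, …, b_i, …, bₙb_i), [b₁, …, 1, …, bₙ])`. -/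
def chart {n : ℕ} (i : Fin n) : OpenPartialHomeomorph (Bl₀ n) (QSpace n) where
  toFun z := WithLp.toLp 2 (Function.update (fun k => QLines.ratio i k z.1.2) i (z.1.1 i))
  invFun b := ⟨(WithLp.toLp 2 (fun k => slopes i b k * b i),
      Projectivization.mk _ (slopes i b) (slopes_ne_zero i b)), by
    rw [Projectivization.submodule_mk, Submodule.mem_span_singleton]
    exact ⟨MulOpposite.op (b i), rfl⟩⟩
  source := {z | z.1.2 ∈ QLines.affine i}
  target := univ
  map_source' _ _ := mem_univ _
  map_target' b _ := (QLines.mk_mem_affine i _ _).2 (by rw [slopes_self]; exact one_ne_zero)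
  left_inv' := by
    rintro ⟨⟨q, a⟩, hq⟩ (ha : a ∈ QLines.affine i)
    have key : slopes i (WithLp.toLp 2 (Function.update (fun k => QLines.ratio i k a) i (q i))) =
        WithLp.toLp 2 (fun k => QLines.ratio i k a) := by
      refine PiLp.ext fun k => ?_
      by_cases hk : k = i
      · subst hk
        rw [slopes_self]; exact (QLines.ratio_self ha).symm
      · simp [slopes, hk]
    refine Subtype.ext (Prod.ext (PiLp.ext fun k => ?_) ?_)
    · simp only [key, Function.update_self]
      exact ((mem_submodule_iff ha q).1 hq k).symm
    · simp only [key]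
      exact QLines.mk_ratio ha _
  right_inv' b _ := by
    refine PiLp.ext fun k => ?_
    by_cases hk : k = i
    · subst hk
      simp [slopes_self]
    · simp [QLines.ratio_mk, slopes_self, hk]
      simp [slopes, hk]
  open_source := (QLines.isOpen_affine i).preimage (continuous_snd.comp continuous_subtype_val)
  open_target := isOpen_univ
  continuousOn_toFun := by
    refine (PiLp.continuous_toLp 2 _).comp_continuousOn (continuousOn_pi.2 fun k => ?_)
    by_cases hk : k = i
    · subst hk
      simp only [Function.update_self]
      fun_prop
    · simp only [Function.update_of_ne hk]
      exact (QLines.continuousOn_ratio i k).comp (by fun_prop) fun z hz => hz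
  continuousOn_invFun := by
    refine Continuous.continuousOn (Continuous.subtype_mk (Continuous.prodMk ?_ ?_) _)
    · have := continuous_slopes i
      refine (PiLp.continuous_toLp 2 _).comp (continuous_pi fun k => ?_)
      fun_prop
    · exact (QLines.isQuotientMap_mk' n).continuous.comp
        (Continuous.subtype_mk (continuous_slopes i) (slopes_ne_zero i))

instance (n : ℕ) : ChartedSpace (QSpace n) (Bl₀ n) where
  atlas := range chart
  chartAt z := chart (HP.exists_mem_affine z.1.2).choose
  mem_chart_source z := (HP.exists_mem_affine z.1.2).choose_spec
  chart_mem_atlas _ := mem_range_self _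

/-- A nonzero vector `q`, as the point `(q, [q])` of the blow-up. -/
def ofNeZero {n : ℕ} (q : QSpace n) (hq : q ≠ 0) : Bl₀ n :=
  ⟨(q, Projectivization.mk _ q hq), by
    rw [Projectivization.submodule_mk]
    exact Submodule.mem_span_singleton_self q⟩

theorem eq_ofNeZero {n : ℕ} (z : Bl₀ n) (hq : z.1.1 ≠ 0) : z = ofNeZero z.1.1 hq := by
  obtain ⟨⟨q, a⟩, h⟩ := z
  induction a using Projectivization.ind with
  | h a ha =>
    refine Subtype.ext (Prod.ext rfl ?_)
    rw [Projectivization.submodule_mk, Submodule.mem_span_singleton] at h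
    obtain ⟨t, ht⟩ := h
    exact ((Projectivization.mk_eq_mk_iff' _ _ _ hq ha).2 ⟨t, ht⟩).symm

end Bl₀

section BlowUp

variable {n : ℕ} {M : Type*} [TopologicalSpace M]

/-- The part of `Bl₀(ℍⁿ)` over the translate `e(U) - e(p)` of the image of a chart `(U, e)`. -/
abbrev blowUpChartDomain (e : OpenPartialHomeomorph M (QSpace n)) (p : M) : Opens (Bl₀ n) :=
  ⟨{z | e p + z.1.1 ∈ e.target}, e.open_target.preimage (by fun_prop)⟩

theorem chart_sub_ne_zero (e : OpenPartialHomeomorph M (QSpace n)) {p x : M}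
    (hp : p ∈ e.source) (hx : x ∈ e.source) (h : x ≠ p) : e x - e p ≠ 0 :=
  fun h0 => h (e.injOn hx hp (sub_eq_zero.1 h0))

/-- The gluing of `M ∖ {p}` and the part of `Bl₀(ℍⁿ)` over `e(U) - e(p)`, which identifies
`x ∈ U ∖ {p}` with the pair `(q, [q])`, where `q = e(x) - e(p)`. -/
def blowUpData [T1Space M] (e : OpenPartialHomeomorph M (QSpace n)) (p : M)
    (hp : p ∈ e.source) : GluingData (puncture M p) (blowUpChartDomain e p) where
  U := ⟨{x | (x : M) ∈ e.source}, e.open_source.preimage continuous_subtype_val⟩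
  V := ⟨{z | z.1.1.1 ≠ 0}, isOpen_ne_fun (by fun_prop) continuous_const⟩
  homeo :=
    { toFun := fun x => ⟨⟨Bl₀.ofNeZero (e x.1.1 - e p) (chart_sub_ne_zero e hp x.2 x.1.2), by
          change e p + (e x.1.1 - e p) ∈ e.target
          rw [add_sub_cancel]
          exact e.map_source x.2⟩, chart_sub_ne_zero e hp x.2 x.1.2⟩
      invFun := fun z => ⟨⟨e.symm (e p + z.1.1.1.1), by
          intro h
          have h1 : e (e.symm (e p + z.1.1.1.1)) = e p := congrArg e h
          rw [e.right_inv z.1.2] at h1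
          exact z.2 (add_eq_left.1 h1)⟩, e.map_target z.1.2⟩
      left_inv := fun x => Subtype.ext (Subtype.ext (by
        change e.symm (e p + (e x.1.1 - e p)) = x.1.1
        rw [add_sub_cancel, e.left_inv x.2]))
      right_inv := fun z => Subtype.ext (Subtype.ext (by
        have h1 : e (e.symm (e p + z.1.1.1.1)) - e p = z.1.1.1.1 := by
          rw [e.right_inv z.1.2, add_sub_cancel_left]
        rw [Bl₀.eq_ofNeZero z.1.1 z.2]
        simp only [Bl₀.ofNeZero]
        exact Subtype.ext (Prod.ext h1 (by simp only [h1]))))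
      continuous_toFun := by
        have hc : Continuous fun x : {x : puncture M p | (x : M) ∈ e.source} =>
            e x.1.1 - e p :=
          (e.continuousOn.comp_continuous
            (continuous_subtype_val.comp continuous_subtype_val) fun x => x.2).sub
            continuous_const
        refine Continuous.subtype_mk (Continuous.subtype_mk (Continuous.subtype_mk
          (Continuous.prodMk hc ?_) _) _) _
        exact (QLines.isQuotientMap_mk' n).continuous.comp
          (Continuous.subtype_mk hc fun x => chart_sub_ne_zero e hp x.2 x.1.2)
      continuous_invFun := by
        refine Continuous.subtype_mk (Continuous.subtype_mk ?_ _) _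
        exact e.continuousOn_symm.comp_continuous (by fun_prop) fun z => z.1.2 }

/-- The blow-up `Bl_p(M)` of `M` at `p`, where the chart `e` around `p` identifies the tangent
space at `p` with `ℍⁿ`: the point `p` is replaced by the space `ℍℙⁿ⁻¹` of right lines of `ℍⁿ`. -/
abbrev BlowUp [T1Space M] (e : OpenPartialHomeomorph M (QSpace n)) (p : M)
    (hp : p ∈ e.source) : Type _ :=
  (blowUpData e p hp).Glued

/-- The blow-down map `Bl_p(M) → M`. -/
def blowDown [T1Space M] (e : OpenPartialHomeomorph M (QSpace n)) (p : M)
    (hp : p ∈ e.source) : BlowUp e p hp → M :=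
  Quotient.lift (Sum.elim (fun x => (x : M)) (fun z => e.symm (e p + z.1.1.1))) (by
    have key : ∀ (x : puncture M p) (z : blowUpChartDomain e p),
        (∃ h : x ∈ (blowUpData e p hp).U, ((blowUpData e p hp).homeo ⟨x, h⟩ : _) = z) →
        (x : M) = e.symm (e p + z.1.1.1) := by
      rintro x z ⟨h, rfl⟩
      change (x : M) = e.symm (e p + (e x - e p))
      rw [add_sub_cancel, e.left_inv h]
    rintro (a | a) (b | b) h
    · exact congrArg Subtype.val h
    · exact key a b h
    · exact (key b a h).symm
    · have h' : a = b := h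
      rw [h'])

end BlowUp

end

/-! The diffeomorphism exists because `ℍℙⁿ` without a point and the blow-up of a ball at its centre
are both bundles of discs over `ℍℙⁿ⁻¹`. A point of `ℍℙⁿ` other than `[1, 0, …, 0]` is `[q, a]` with
`a ≠ 0`; it is sent to `(at, [a])`, where `t` is a positive multiple of `q̄ / |a|²`. Replacing `(q,
a)` by `(qλ, aλ)` replaces `t` by `λ⁻¹t`, thanks to the conjugation, so `at` depends only on the
point. With `σ = |q|² / |a|²` the multiple is `r · factor σ`, and `|at|² / r² = σ · factor σ² =
profile σ`.

The profile obeys two constraints. Near `σ = 0` it must be smooth with positive derivative, so that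
the hyperplane `q = 0` goes diffeomorphically to the exceptional set. For large `σ` it must be `(1 -
1/√σ)²`, the value forced by the identification of `tu` with `[1, (1 - t)u]`. The latter function
vanishes at `σ = 1`, so it is joined by a cutoff on `[4, 16]` to `σ / 64`; the derivative stays
positive (`deriv_profile_pos`). The resulting map is a diffeomorphism onto the part of the blow-up
over the open ball of radius `r`, and it agrees with the gluing where `σ ≥ 16`, that is, for `t ≥
3/4`. Hence `M` minus the closed disc of radius `3r/4` and the punctured projective space cover both
manifolds with the same identifications (`CoordDisc.inl_eq_inr_collapse_iff`), and
`exists_diffeomorph_of_isLocalDiffeomorph` concludes.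

For regularity, the basic fact is `isSliceRegular_mul`: if `f` and `g` are induced by holomorphic
functions that commute with conjugation, then `f(q_j) g(q_k) + c` is left slice regular for `j < k`
and right slice regular for `k < j`. This covers the components of the natural transition functions
of `Bl₀(ℍⁿ)` and of the blow-down map, which are monomials such as `q_k q_i` and `q_k q_i⁻¹`. Slice
regularity is not stable under composition, so the atlas of the blow-up is built to avoid
compositions. The charts of `Bl₀(ℍⁿ)` are shrunk to the half ball, where they meet only each other
and the centred chart `φ - φ(p)`; the centred chart meets otherwise only `φ`, through a translation;
the remaining charts of `M` are kept off the disc. The atlas of the connected sum is the pull-back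
by the diffeomorphism.

Both glued spaces are Hausdorff because the graphs of the identifications are closed, and smooth
because the identifications are smooth in both directions. -/

noncomputable section

/-! ### Monomial slice regular functions -/

/-- Holomorphic functions that commute with complex conjugation. -/
structure IsRealHolomorphicOn (u : ℂ → ℂ) (V : Set ℂ) : Prop where
  isOpen : IsOpen V
  star_mem : ∀ w ∈ V, star w ∈ V
  differentiableOn : DifferentiableOn ℂ u V
  map_star : ∀ w ∈ V, u (star w) = star (u w)

/-- The real or the imaginary part. -/
def cpart (b : Bool) : ℂ →L[ℝ] ℝ := if b then Complex.imCLM else Complex.reCLM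

/-- The components of the stem function `∏ₕ uₕ(zₕ) + c`. -/
def stemProd {n : ℕ} (u : Fin n → ℂ → ℂ) (c : ℍ[ℝ]) (K : Finset (Fin n)) (z : Fin n → ℂ) : ℍ[ℝ] :=
  (∏ h, cpart (h ∈ K) (u h (z h))) • (1 : ℍ[ℝ]) + if K = ∅ then c else 0

theorem stemProd_eq {n : ℕ} (u : Fin n → ℂ → ℂ) (c : ℍ[ℝ]) (K : Finset (Fin n))
    (z : Fin n → ℂ) (h : Fin n) :
    stemProd u c K z = (cpart (h ∈ K) (u h (z h)) *
      ∏ k ∈ Finset.univ.erase h, cpart (k ∈ K) (u k (z k))) • (1 : ℍ[ℝ]) +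
        if K = ∅ then c else 0 := by
  rw [stemProd, ← Finset.mul_prod_erase Finset.univ _ (Finset.mem_univ h)]

theorem prod_erase_update {n : ℕ} (u : Fin n → ℂ → ℂ) (K : Finset (Fin n))
    (z : Fin n → ℂ) (h : Fin n) (w : ℂ) :
    ∏ k ∈ Finset.univ.erase h, cpart (k ∈ K) (u k (Function.update z h w k)) =
      ∏ k ∈ Finset.univ.erase h, cpart (k ∈ K) (u k (z k)) := by
  refine Finset.prod_congr rfl fun k hk => ?_
  rw [Function.update_of_ne (Finset.ne_of_mem_erase hk)]

variable {n : ℕ} {u : Fin n → ℂ → ℂ} {V : Fin n → Set ℂ}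

theorem contDiffOn_stemProd (hu : ∀ h, IsRealHolomorphicOn (u h) (V h)) (c : ℍ[ℝ])
    (K : Finset (Fin n)) : ContDiffOn ℝ 1 (stemProd u c K) {z | ∀ h, z h ∈ V h} := by
  unfold stemProd
  have hp : ContDiffOn ℝ 1 (fun z : Fin n → ℂ => ∏ h, cpart (h ∈ K) (u h (z h)))
      {z | ∀ h, z h ∈ V h} := ?_
  · exact (hp.smul contDiffOn_const).add contDiffOn_const
  refine contDiffOn_prod fun h _ => ?_
  refine (cpart _).contDiff.comp_contDiffOn ?_
  have h1 : ContDiffOn ℝ 1 (u h) (V h) :=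
    ((hu h).differentiableOn.contDiffOn (hu h).isOpen).restrict_scalars ℝ
  exact h1.comp (contDiff_apply ℝ ℂ h).contDiffOn fun z hz => hz h

theorem isStemDomain_pi (hu : ∀ h, IsRealHolomorphicOn (u h) (V h)) :
    IsStemDomain {z : Fin n → ℂ | ∀ h, z h ∈ V h} where
  isOpen := by
    have : {z : Fin n → ℂ | ∀ h, z h ∈ V h} = Set.pi univ V := by ext; simp
    rw [this]
    exact isOpen_set_pi finite_univ fun h _ => (hu h).isOpen
  conj_mem h z hz k := by
    by_cases hk : k = h
    · subst hk
      simpa [conjAt] using (hu k).star_mem _ (hz k)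
    · simpa [conjAt, hk] using hz k

/-- Along the `h`-th complex line only the factor of index `h` varies, and taking its real or
imaginary part commutes with differentiation. -/
theorem fderiv_stemProd (hu : ∀ h, IsRealHolomorphicOn (u h) (V h)) (c : ℍ[ℝ])
    (K : Finset (Fin n)) {z : Fin n → ℂ} (hz : ∀ h, z h ∈ V h) (h : Fin n) (w : ℂ) :
    fderiv ℝ (stemProd u c K) z (Pi.single h w) = (cpart (h ∈ K) (deriv (u h) (z h) * w) *
      ∏ k ∈ Finset.univ.erase h, cpart (k ∈ K) (u k (z k))) • (1 : ℍ[ℝ]) := by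
  have hd : DifferentiableAt ℝ (stemProd u c K) z :=
    ((contDiffOn_stemProd hu c K).differentiableOn one_ne_zero).differentiableAt
      ((isStemDomain_pi hu).isOpen.mem_nhds hz)
  rw [← hd.lineDeriv_eq_fderiv, lineDeriv]
  have hf : ∀ t : ℝ, z + t • (Pi.single h w : Fin n → ℂ) = Function.update z h (z h + t • w) :=
      fun t => by
    ext k
    by_cases hk : k = h
    · subst hk; simp
    · simp [hk]
  simp only [hf, stemProd_eq u c K _ h, prod_erase_update, Function.update_self]
  refine HasDerivAt.deriv ?_
  refine HasDerivAt.add_const _ (HasDerivAt.smul_const (HasDerivAt.mul_const ?_ _) _)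
  have h1 : HasDerivAt (u h) (deriv (u h) (z h)) (z h + (0 : ℝ) • w) := by
    rw [zero_smul, add_zero]
    exact ((hu h).differentiableOn.differentiableAt ((hu h).isOpen.mem_nhds (hz h))).hasDerivAt
  have h2 : HasDerivAt (fun t : ℝ => z h + t • w) w 0 := by
    simpa using ((hasDerivAt_id (0 : ℝ)).smul_const w).const_add (z h)
  have h3 : HasDerivAt (fun t : ℝ => u h (z h + t • w)) (deriv (u h) (z h) * w) 0 := by
    have := h1.scomp (0 : ℝ) h2
    rwa [smul_eq_mul, mul_comm] at this
  exact (cpart _).hasFDerivAt.comp_hasDerivAt _ h3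

/-- The stem equations reduce to the Cauchy–Riemann equations of `u h`: with `d = u_h'(z_h)`, the
derivatives in the directions `1` and `i` are `d` and `di`, and `Im d + Re (di) = 0`, `Re d - Im
(di) = 0`. The constant sits in the component of `∅`, which no conjugation changes. -/
theorem isHolomorphicStem_stemProd (hu : ∀ h, IsRealHolomorphicOn (u h) (V h)) (c : ℍ[ℝ]) :
    IsHolomorphicStem {z | ∀ h, z h ∈ V h} (stemProd u c) where
  domain := isStemDomain_pi hu
  contDiffOn := contDiffOn_stemProd hu c
  intrinsic K h z hz := by
    rw [stemProd_eq u c K _ h, stemProd_eq u c K z h, conjAt, prod_erase_update,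
      Function.update_self, (hu h).map_star _ (hz h)]
    by_cases hK : h ∈ K
    · have : K ≠ ∅ := Finset.ne_empty_of_mem hK
      simp [hK, this, cpart]
    · simp [hK, cpart]
  holomorphic h z hz K := by
    have key : ∀ L : Finset (Fin n), (∀ k, k ≠ h → (k ∈ L ↔ k ∈ K)) →
        ∏ k ∈ Finset.univ.erase h, cpart (k ∈ L) (u k (z k)) =
          ∏ k ∈ Finset.univ.erase h, cpart (k ∈ K) (u k (z k)) := fun L hL => by
      refine Finset.prod_congr rfl fun k hk => ?_
      simp only [hL k (Finset.ne_of_mem_erase hk)]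
    simp only [fderiv_stemProd hu c _ hz, stemJ]
    by_cases hK : h ∈ K
    · rw [if_pos hK, key (K.erase h) (fun k hk => by simp [hk]), ← add_smul, ← add_mul]
      simp [hK, cpart]
    · rw [if_neg hK, key (insert h K) (fun k hk => by simp [hk]), ← sub_eq_add_neg, ← sub_smul,
        ← sub_mul]
      simp [hK, cpart]

theorem stemProd_eq_zero {s : Finset (Fin n)} (hs : ∀ h ∉ s, u h = 1) (c : ℍ[ℝ])
    {K : Finset (Fin n)} (hK : ¬ K ⊆ s) (z : Fin n → ℂ) : stemProd u c K z = 0 := by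
  obtain ⟨h, hh, hs'⟩ := Finset.not_subset.1 hK
  rw [stemProd_eq u c K z h, hs h hs', if_neg (Finset.ne_empty_of_mem hh)]
  simp [hh, cpart]

/-- A factor equal to `1` has zero imaginary part, so only the subsets `K` of `s` contribute. Taking
`P` abstract lets the same computation serve ordered and reverse products. -/
theorem sum_stemProd {s : Finset (Fin n)} (hs : ∀ h ∉ s, u h = 1) (c : ℍ[ℝ]) (z : Fin n → ℂ)
    (P : Finset (Fin n) → ℍ[ℝ]) (hP : P ∅ = 1) :
    ∑ K : Finset (Fin n), P K * stemProd u c K z =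
      ∑ K ∈ s.powerset, (∏ h ∈ s, cpart (h ∈ K) (u h (z h))) • P K + c := by
  rw [← Finset.sum_subset (Finset.subset_univ s.powerset) fun K _ hK => by
    rw [stemProd_eq_zero hs c (by simpa using hK), mul_zero]]
  have : ∀ K ∈ s.powerset, P K * stemProd u c K z =
      (∏ h ∈ s, cpart (h ∈ K) (u h (z h))) • P K + if K = ∅ then c else 0 := fun K hK => by
    rw [stemProd, ← Finset.prod_subset (Finset.subset_univ s) fun h _ hh => by
      rw [hs h hh]
      have : h ∉ K := fun h' => hh (Finset.mem_powerset.1 hK h')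
      simp [this, cpart]]
    by_cases hK : K = ∅ <;> simp [hK, mul_add, hP]
  rw [Finset.sum_congr rfl this, Finset.sum_add_distrib]
  simp

/-- `f` is the slice function on `ℍ` induced by the real holomorphic function `u` on `V`. -/
structure IsInduced (f : ℍ[ℝ] → ℍ[ℝ]) (u : ℂ → ℂ) (V : Set ℂ) : Prop
    extends IsRealHolomorphicOn u V where
  map_eq : ∀ w ∈ V, ∀ J : ℍ[ℝ], J ^ 2 = -1 →
    f ((w.re : ℍ[ℝ]) + w.im • J) = ((u w).re : ℍ[ℝ]) + (u w).im • J

theorem isRealHolomorphicOn_one : IsRealHolomorphicOn 1 univ where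
  isOpen := isOpen_univ
  star_mem _ _ := mem_univ _
  differentiableOn := differentiableOn_const _
  map_star _ _ := by simp

theorem isInduced_id : IsInduced id id univ where
  isOpen := isOpen_univ
  star_mem _ _ := mem_univ _
  differentiableOn := differentiableOn_id
  map_star _ _ := rfl
  map_eq _ _ _ _ := rfl

/-- On the slice spanned by `1` and `J` the multiplication is that of `ℂ`, so the real and imaginary
parts of `w w⁻¹ = 1` give the identity. -/
theorem isInduced_inv : IsInduced (·⁻¹) (·⁻¹) {0}ᶜ where
  isOpen := isOpen_compl_singleton
  star_mem w hw := by simpa using hw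
  differentiableOn := differentiableOn_inv
  map_star w _ := by simp
  map_eq w hw J hJ := by
    refine inv_eq_of_mul_eq_one_right ?_
    have h0 : Complex.normSq w ≠ 0 := by simpa using hw
    have e : ∀ r : ℝ, (r : ℍ[ℝ]) = r • 1 := fun r => by
      rw [← Quaternion.coe_mul_eq_smul, mul_one]
    have h1 : (1 : ℝ) = w.re * (w⁻¹).re - w.im * (w⁻¹).im := by
      rw [← Complex.mul_re, mul_inv_cancel₀ (by simpa using hw), Complex.one_re]
    have h2 : (0 : ℝ) = w.re * (w⁻¹).im + w.im * (w⁻¹).re := by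
      rw [← Complex.mul_im, mul_inv_cancel₀ (by simpa using hw), Complex.one_im]
    have hJ' : J * J = -1 := by rw [← sq, hJ]
    simp only [e, mul_add, add_mul, smul_mul_smul_comm, mul_one, one_mul, hJ']
    calc _ = (w.re * (w⁻¹).re - w.im * (w⁻¹).im) • (1 : ℍ[ℝ]) +
          (w.re * (w⁻¹).im + w.im * (w⁻¹).re) • J := by module
      _ = 1 := by rw [← h1, ← h2]; simp

theorem exists_eq_slicePoint (q : QSpace n) :
    ∃ (z : Fin n → ℂ) (J : Fin n → ℍ[ℝ]), IsImagUnits J ∧ q = slicePoint z J := by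
  have key : ∀ a : ℍ[ℝ], ∃ (w : ℂ) (J : ℍ[ℝ]), J ^ 2 = -1 ∧ a = (w.re : ℍ[ℝ]) + w.im • J := by
    intro a
    by_cases h : a.im = 0
    -- A real quaternion lies in every slice; the unit `i` is an arbitrary choice.
    · refine ⟨⟨a.re, 0⟩, ((Complex.I : ℂ) : ℍ[ℝ]), ?_, ?_⟩
      · rw [sq, ← Quaternion.coeComplex_mul, Complex.I_mul_I]
        ext <;> simp
      · conv_lhs => rw [← Quaternion.re_add_im a, h]
        simp
    · have h0 : ‖a.im‖ ≠ 0 := norm_ne_zero_iff.2 h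
      refine ⟨⟨a.re, ‖a.im‖⟩, ‖a.im‖⁻¹ • a.im, ?_, ?_⟩
      · rw [smul_pow, Quaternion.im_sq, Quaternion.normSq_eq_norm_mul_self, smul_neg, inv_pow,
          ← Quaternion.coe_mul_eq_smul, ← Quaternion.coe_mul, ← sq, inv_mul_cancel₀ (by positivity),
          Quaternion.coe_one]
      · simp only
        rw [smul_inv_smul₀ h0, Quaternion.re_add_im]
  choose w J hJ hw using key
  exact ⟨fun h => w (q h), fun h => J (q h), fun h => hJ _, PiLp.ext fun h => hw (q h)⟩

theorem slicePoint_apply (z : Fin n → ℂ) (J : Fin n → ℍ[ℝ]) (h : Fin n) :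
    slicePoint z J h = ((z h).re : ℍ[ℝ]) + (z h).im • J h := rfl

/-- A set of points on which an induced function is given by its stem function. -/
theorem mem_circularSet_pi {q : QSpace n}
    (h : ∀ (z : Fin n → ℂ) (J : Fin n → ℍ[ℝ]), IsImagUnits J → q = slicePoint z J →
      ∀ h, z h ∈ V h) : q ∈ circularSet {z | ∀ h, z h ∈ V h} := by
  obtain ⟨z, J, hJ, hq⟩ := exists_eq_slicePoint q
  exact ⟨z, h z J hJ hq, J, hJ, hq⟩

/-! ### Ordered and reverse products of at most two imaginary units -/

theorem orderedProd_empty (J : Fin n → ℍ[ℝ]) : orderedProd J ∅ = 1 := by simp [orderedProd]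

theorem reverseProd_empty (J : Fin n → ℍ[ℝ]) : reverseProd J ∅ = 1 := by simp [reverseProd]

theorem orderedProd_singleton (J : Fin n → ℍ[ℝ]) (k : Fin n) : orderedProd J {k} = J k := by
  simp [orderedProd]

theorem reverseProd_singleton (J : Fin n → ℍ[ℝ]) (k : Fin n) : reverseProd J {k} = J k := by
  simp [reverseProd]

theorem sort_pair {j k : Fin n} (h : j < k) : ({j, k} : Finset (Fin n)).sort (· ≤ ·) = [j, k] := by
  rw [Finset.sort_insert (r := (· ≤ ·)) (fun b hb => by
    rw [Finset.mem_singleton.1 hb]; exact h.le) (by simpa using h.ne), Finset.sort_singleton]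

theorem orderedProd_pair (J : Fin n → ℍ[ℝ]) {j k : Fin n} (h : j < k) :
    orderedProd J {j, k} = J j * J k := by
  simp [orderedProd, sort_pair h]

theorem reverseProd_pair (J : Fin n → ℍ[ℝ]) {j k : Fin n} (h : j < k) :
    reverseProd J {j, k} = J k * J j := by
  simp [reverseProd, sort_pair h]

theorem coe_eq_smul_one (r : ℝ) : (r : ℍ[ℝ]) = r • (1 : ℍ[ℝ]) := by
  rw [← Quaternion.coe_mul_eq_smul, mul_one]

theorem stemProd_comm (u : Fin n → ℂ → ℂ) (c : ℍ[ℝ]) (z : Fin n → ℂ) {P : Finset (Fin n) → ℍ[ℝ]}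
    (hP : P ∅ = 1) (K : Finset (Fin n)) :
    stemProd u c K z * P K = P K * stemProd u c K z := by
  rw [stemProd]
  by_cases h : K = ∅
  · simp [h, hP]
  · simp [h]

/-- The stem function is the product in which `v` is the factor of index `k` and all other factors
are `1`. A single imaginary unit raises no question of order. -/
theorem isLeftSliceRegularOn_induced {f : ℍ[ℝ] → ℍ[ℝ]} {v : ℂ → ℂ} {W : Set ℂ}
    (hf : IsInduced f v W) (k : Fin n) (c : ℍ[ℝ]) {U : Set (QSpace n)}
    (hU : ∀ z J, IsImagUnits J → slicePoint z J ∈ U → z k ∈ W) :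
    IsLeftSliceRegularOn (fun q => f (q k) + c) U := by
  have hu : ∀ h, IsRealHolomorphicOn ((Function.update 1 k v : Fin n → ℂ → ℂ) h)
      (Function.update (fun _ => univ) k W h) := fun h => by
    by_cases hk : h = k
    · subst hk; simpa using hf.toIsRealHolomorphicOn
    · simpa [hk] using isRealHolomorphicOn_one
  refine ⟨_, _, isHolomorphicStem_stemProd hu c, fun q hq => mem_circularSet_pi
    fun z J hJ hz h => ?_, ?_⟩
  · by_cases hk : h = k
    · subst hk; simpa using hU z J hJ (hz ▸ hq)
    · simp [hk]
  intro z _ J hJ hz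
  rw [sum_stemProd (s := {k}) (fun h hh => by
    rw [Function.update_of_ne (by simpa using hh)]; rfl) c z _ (orderedProd_empty J)]
  have : (({k} : Finset (Fin n)).powerset) = {∅, {k}} := by
    ext; simp [Finset.subset_singleton_iff]
  rw [this, Finset.sum_pair (Finset.singleton_ne_empty k).symm, orderedProd_empty,
    orderedProd_singleton]
  simp only [slicePoint_apply, hf.map_eq _ (hU z J hJ hz) _ (hJ k)]
  simp [cpart, coe_eq_smul_one]

theorem powerset_pair {j k : Fin n} (P : Finset (Fin n) → ℍ[ℝ]) (h : j ≠ k) :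
    ∑ K ∈ ({j, k} : Finset (Fin n)).powerset, P K = P ∅ + P {k} + (P {j} + P {j, k}) := by
  rw [Finset.sum_powerset_insert (by simpa using h)]
  have : (({k} : Finset (Fin n)).powerset) = {∅, {k}} := by
    ext; simp [Finset.subset_singleton_iff]
  rw [this, Finset.sum_pair (Finset.singleton_ne_empty k).symm,
    Finset.sum_pair (Finset.singleton_ne_empty k).symm]
  rfl

/-- Products of two induced functions of different variables are left or right slice regular,
depending on the order of the variables. -/
theorem isSliceRegular_mul {f g : ℍ[ℝ] → ℍ[ℝ]} {v w : ℂ → ℂ} {V W : Set ℂ}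
    (hf : IsInduced f v V) (hg : IsInduced g w W) {j k : Fin n} (hjk : j ≠ k) (c : ℍ[ℝ])
    {U : Set (QSpace n)}
    (hU : ∀ z J, IsImagUnits J → slicePoint z J ∈ U → z j ∈ V ∧ z k ∈ W) :
    IsLeftSliceRegularOn (fun q => f (q j) * g (q k) + c) U ∨
      IsRightSliceRegularOn (fun q => f (q j) * g (q k) + c) U := by
  set u : Fin n → ℂ → ℂ := Function.update (Function.update 1 k w) j v
  set X : Fin n → Set ℂ := Function.update (Function.update (fun _ => univ) k W) j V
  have hu : ∀ h, IsRealHolomorphicOn (u h) (X h) := fun h => by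
    by_cases hj : h = j
    · subst hj; simpa [u, X] using hf.toIsRealHolomorphicOn
    · by_cases hk : h = k
      · subst hk; simpa [u, X, hj] using hg.toIsRealHolomorphicOn
      · simpa [u, X, hj, hk] using isRealHolomorphicOn_one
  have hXm : ∀ z J, IsImagUnits J → slicePoint z J ∈ U → ∀ h, z h ∈ X h := fun z J hJ hz h => by
    by_cases hj : h = j
    · subst hj; simpa [X] using (hU z J hJ hz).1
    · by_cases hk : h = k
      · subst hk; simpa [X, hj] using (hU z J hJ hz).2
      · simp [X, hj, hk]
  have hc : U ⊆ circularSet {z | ∀ h, z h ∈ X h} := fun q hq =>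
    mem_circularSet_pi fun z J hJ h => hXm z J hJ (h ▸ hq)
  have hs : ∀ h ∉ ({j, k} : Finset (Fin n)), u h = 1 := fun h hh => by
    simp only [Finset.mem_insert, Finset.mem_singleton, not_or] at hh
    simp only [u, Function.update_of_ne hh.1, Function.update_of_ne hh.2]; rfl
  have huj : u j = v := by simp [u]
  have huk : u k = w := by simp [u, hjk.symm]
  have hval : ∀ z J, IsImagUnits J → slicePoint z J ∈ U →
      f (slicePoint z J j) * g (slicePoint z J k) =
        (((v (z j)).re : ℍ[ℝ]) + (v (z j)).im • J j) *
          (((w (z k)).re : ℍ[ℝ]) + (w (z k)).im • J k) := fun z J hJ hz => by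
    rw [slicePoint_apply, slicePoint_apply, hf.map_eq _ (hU z J hJ hz).1 _ (hJ j),
      hg.map_eq _ (hU z J hJ hz).2 _ (hJ k)]
  have hsum : ∀ (z : Fin n → ℂ) (J : Fin n → ℍ[ℝ]) (P : Finset (Fin n) → ℍ[ℝ]), P ∅ = 1 →
      P {j} = J j → P {k} = J k → P {j, k} = J j * J k →
      ∑ K : Finset (Fin n), P K * stemProd u c K z =
        (((v (z j)).re : ℍ[ℝ]) + (v (z j)).im • J j) *
          (((w (z k)).re : ℍ[ℝ]) + (w (z k)).im • J k) + c := fun z J P h0 h1 h2 h3 => by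
    rw [sum_stemProd hs c z P h0, powerset_pair _ hjk, h0, h1, h2, h3]
    simp only [Finset.prod_pair hjk, huj, huk]
    simp only [coe_eq_smul_one, mul_add, add_mul, smul_mul_smul_comm, mul_one, one_mul]
    simp [cpart, hjk, hjk.symm]
    abel
  -- The value involves `J_j J_k` in this order. It is the ordered product for `j < k` and the
  -- reverse product for `k < j`. In the second case the components have to move to the left of the
  -- units: they are real except at `∅`, where the product of units is `1`.
  rcases hjk.lt_or_gt with h | h
  · refine Or.inl ⟨_, _, isHolomorphicStem_stemProd hu c, hc, fun z _ J hJ hz => ?_⟩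
    beta_reduce
    rw [hval z J hJ hz, hsum z J _ (orderedProd_empty J) (orderedProd_singleton J j)
      (orderedProd_singleton J k) (orderedProd_pair J h)]
  · refine Or.inr ⟨_, _, isHolomorphicStem_stemProd hu c, hc, fun z _ J hJ hz => ?_⟩
    beta_reduce
    rw [hval z J hJ hz, ← hsum z J (reverseProd J) (reverseProd_empty J)
      (reverseProd_singleton J j) (reverseProd_singleton J k)
      (by rw [Finset.pair_comm, reverseProd_pair J h])]
    exact Finset.sum_congr rfl fun K _ => (stemProd_comm u c z (reverseProd_empty J) K).symm

/-! ### Local diffeomorphisms -/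

section LocalDiffeo

variable {E : Type*} [NormedAddCommGroup E] [NormedSpace ℝ E]
  {X : Type*} [TopologicalSpace X] [ChartedSpace E X]
  {Y : Type*} [TopologicalSpace Y] [ChartedSpace E Y]
  {Z : Type*} [TopologicalSpace Z] [ChartedSpace E Z]

/-- A chart of the maximal atlas is a partial diffeomorphism. -/
def chartPartialDiffeomorph [IsManifold 𝓘(ℝ, E) ∞ X] (e : OpenPartialHomeomorph X E)
    (he : e ∈ IsManifold.maximalAtlas 𝓘(ℝ, E) ∞ X) :
    PartialDiffeomorph 𝓘(ℝ, E) 𝓘(ℝ, E) X E ∞ where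
  toPartialEquiv := e.toPartialEquiv
  open_source := e.open_source
  open_target := e.open_target
  contMDiffOn_toFun := contMDiffOn_of_mem_maximalAtlas he
  contMDiffOn_invFun := contMDiffOn_symm_of_mem_maximalAtlas he

/-- Precompose with the local inverse of `j`. This is how smoothness of maps out of a glued space is
checked on the pieces. -/
theorem IsLocalDiffeomorphAt.contMDiffAt_comp_iff {j : X → Y} {x : X}
    (hj : IsLocalDiffeomorphAt 𝓘(ℝ, E) 𝓘(ℝ, E) ∞ j x) {f : Y → Z} :
    ContMDiffAt 𝓘(ℝ, E) 𝓘(ℝ, E) ∞ (fun x => f (j x)) x ↔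
      ContMDiffAt 𝓘(ℝ, E) 𝓘(ℝ, E) ∞ f (j x) := by
  refine ⟨fun h => ?_, fun h => h.comp x hj.contMDiffAt⟩
  obtain ⟨P, hx, hP⟩ := hj
  have hjx : j x = P x := hP hx
  have h1 : ContMDiffAt 𝓘(ℝ, E) 𝓘(ℝ, E) ∞ P.symm (P x) :=
    P.contMDiffOn_invFun.contMDiffAt (P.open_target.mem_nhds (P.map_source hx))
  have h2 : P.symm (P x) = x := P.left_inv hx
  rw [hjx]
  have h3 : ContMDiffAt 𝓘(ℝ, E) 𝓘(ℝ, E) ∞ ((fun x => f (j x)) ∘ P.symm) (P x) :=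
    ContMDiffAt.comp (P x) (by rw [h2]; exact h) h1
  refine h3.congr_of_eventuallyEq ?_
  filter_upwards [P.open_target.mem_nhds (P.map_source hx)] with y hy
  have h4 : P.symm y ∈ P.source := P.map_target hy
  have h5 : P (P.symm y) = y := P.right_inv hy
  change f y = f (j (P.symm y))
  rw [hP h4, h5]

/-- An open embedding that carries charts to charts is a local diffeomorphism. -/
theorem isLocalDiffeomorph_of_charts [IsManifold 𝓘(ℝ, E) ∞ X] [IsManifold 𝓘(ℝ, E) ∞ Y]
    {j : X → Y} (h : ∀ x, ∃ e ∈ IsManifold.maximalAtlas 𝓘(ℝ, E) ∞ X,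
      ∃ e' ∈ IsManifold.maximalAtlas 𝓘(ℝ, E) ∞ Y, x ∈ e.source ∧
        ∀ y ∈ e.source, j y ∈ e'.source ∧ e' (j y) = e y) :
    IsLocalDiffeomorph 𝓘(ℝ, E) 𝓘(ℝ, E) ∞ j := by
  intro x
  obtain ⟨e, he, e', he', hx, hj⟩ := h x
  refine ⟨(chartPartialDiffeomorph e he).trans (chartPartialDiffeomorph e' he').symm,
    ⟨hx, ?_⟩, fun y hy => ?_⟩
  · change e x ∈ e'.target
    rw [← (hj x hx).2]
    exact e'.map_source (hj x hx).1
  · have hy' : y ∈ e.source := hy.1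
    change j y = e'.symm (e y)
    rw [← (hj y hy').2, e'.left_inv (hj y hy').1]

theorem isLocalDiffeomorph_val [IsManifold 𝓘(ℝ, E) ∞ X] (U : Opens X) :
    IsLocalDiffeomorph 𝓘(ℝ, E) 𝓘(ℝ, E) ∞ (Subtype.val : U → X) := by
  refine isLocalDiffeomorph_of_charts fun x => ⟨chartAt E x,
    IsManifold.chart_mem_maximalAtlas x, chartAt E x.1, IsManifold.chart_mem_maximalAtlas x.1,
    mem_chart_source E x, fun y hy => ?_⟩
  rw [Opens.chartAt_eq] at hy ⊢
  rw [OpenPartialHomeomorph.subtypeRestr_source] at hy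
  exact ⟨hy, rfl⟩

/-- Two pairs of local diffeomorphisms that cover two manifolds and make the same identifications
define a diffeomorphism. -/
theorem exists_diffeomorph_of_isLocalDiffeomorph {W₁ W₂ : Type*}
    [TopologicalSpace W₁] [ChartedSpace E W₁] [TopologicalSpace W₂] [ChartedSpace E W₂]
    {a₁ : W₁ → X} {a₂ : W₂ → X} {b₁ : W₁ → Y} {b₂ : W₂ → Y}
    (ha₁ : IsLocalDiffeomorph 𝓘(ℝ, E) 𝓘(ℝ, E) ∞ a₁)
    (ha₂ : IsLocalDiffeomorph 𝓘(ℝ, E) 𝓘(ℝ, E) ∞ a₂)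
    (hb₁ : IsLocalDiffeomorph 𝓘(ℝ, E) 𝓘(ℝ, E) ∞ b₁)
    (hb₂ : IsLocalDiffeomorph 𝓘(ℝ, E) 𝓘(ℝ, E) ∞ b₂)
    (hsa : ∀ x, ∃ w, Sum.elim a₁ a₂ w = x) (hsb : ∀ y, ∃ w, Sum.elim b₁ b₂ w = y)
    (hab : ∀ w w', Sum.elim a₁ a₂ w = Sum.elim a₁ a₂ w' ↔
      Sum.elim b₁ b₂ w = Sum.elim b₁ b₂ w') :
    Nonempty (X ≃ₘ^∞⟮𝓘(ℝ, E), 𝓘(ℝ, E)⟯ Y) := by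
  -- The preimages are chosen without any continuity. By `hab` the resulting maps do not depend on
  -- the choice, so near each point they are computed with the piece at hand.
  choose w hw using hsa
  choose w' hw' using hsb
  have h1 : ∀ v, Sum.elim b₁ b₂ (w (Sum.elim a₁ a₂ v)) = Sum.elim b₁ b₂ v :=
    fun v => (hab _ _).1 (hw _)
  have h2 : ∀ v, Sum.elim a₁ a₂ (w' (Sum.elim b₁ b₂ v)) = Sum.elim a₁ a₂ v :=
    fun v => (hab _ _).2 (hw' _)
  refine ⟨⟨⟨fun x => Sum.elim b₁ b₂ (w x), fun y => Sum.elim a₁ a₂ (w' y), fun x => ?_,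
    fun y => ?_⟩, fun x => ?_, fun y => ?_⟩⟩
  · exact (h2 _).trans (hw x)
  · exact (h1 _).trans (hw' y)
  · rw [← hw x]
    rcases w x with v | v
    · refine ((ha₁ v).contMDiffAt_comp_iff (f := fun x => Sum.elim b₁ b₂ (w x))).1 ?_
      exact (hb₁ v).contMDiffAt.congr_of_eventuallyEq (.of_forall fun v => h1 (.inl v))
    · refine ((ha₂ v).contMDiffAt_comp_iff (f := fun x => Sum.elim b₁ b₂ (w x))).1 ?_
      exact (hb₂ v).contMDiffAt.congr_of_eventuallyEq (.of_forall fun v => h1 (.inr v))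
  · rw [← hw' y]
    rcases w' y with v | v
    · refine ((hb₁ v).contMDiffAt_comp_iff (f := fun y => Sum.elim a₁ a₂ (w' y))).1 ?_
      exact (ha₁ v).contMDiffAt.congr_of_eventuallyEq (.of_forall fun v => h2 (.inl v))
    · refine ((hb₂ v).contMDiffAt_comp_iff (f := fun y => Sum.elim a₁ a₂ (w' y))).1 ?_
      exact (ha₂ v).contMDiffAt.congr_of_eventuallyEq (.of_forall fun v => h2 (.inr v))

end LocalDiffeo

/-- The partial homeomorphism defined by two open embeddings of the same space. -/
def Topology.IsOpenEmbedding.span {W X Y : Type*} [TopologicalSpace W] [TopologicalSpace X]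
    [TopologicalSpace Y] [Nonempty W] {a : W → X} {b : W → Y} (ha : IsOpenEmbedding a)
    (hb : IsOpenEmbedding b) : OpenPartialHomeomorph X Y :=
  ha.toOpenPartialHomeomorph.symm.trans hb.toOpenPartialHomeomorph

section Span

variable {W X Y : Type*} [TopologicalSpace W] [TopologicalSpace X]
    [TopologicalSpace Y] [Nonempty W] {a : W → X} {b : W → Y} (ha : IsOpenEmbedding a)
    (hb : IsOpenEmbedding b)

theorem span_source : (ha.span hb).source = range a := by simp [IsOpenEmbedding.span]

theorem span_target : (ha.span hb).target = range b := by simp [IsOpenEmbedding.span]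

theorem span_apply (w : W) : ha.span hb (a w) = b w := by
  simp [IsOpenEmbedding.span, ha.toOpenPartialHomeomorph_left_inv]

theorem span_symm_apply (w : W) : (ha.span hb).symm (b w) = a w := by
  simp [IsOpenEmbedding.span, hb.toOpenPartialHomeomorph_left_inv]

theorem span_trans_apply {H : Type*} [TopologicalSpace H] (e : OpenPartialHomeomorph Y H) (w : W) :
    (ha.span hb).trans e (a w) = e (b w) :=
  congrArg e (span_apply ha hb w)

theorem mem_span_trans_source {H : Type*} [TopologicalSpace H] {e : OpenPartialHomeomorph Y H}
    {x : X} : x ∈ ((ha.span hb).trans e).source ↔ ∃ w, a w = x ∧ b w ∈ e.source := by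
  rw [OpenPartialHomeomorph.trans_source, span_source]
  constructor
  · rintro ⟨⟨w, rfl⟩, h⟩
    rw [mem_preimage, span_apply] at h
    exact ⟨w, rfl, h⟩
  · rintro ⟨w, rfl, h⟩
    refine ⟨mem_range_self w, ?_⟩
    rwa [mem_preimage, span_apply]

/-- Pulled back to `W`, the chart becomes `e ∘ b` and its inverse becomes `a` after the inverse of
`b`, so both are smooth. It turns charts of `M` or of `Bl₀(ℍⁿ)` into charts of the glued space. -/
theorem span_trans_mem_maximalAtlas {E : Type*} [NormedAddCommGroup E] [NormedSpace ℝ E]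
    [ChartedSpace E W] [ChartedSpace E X] [ChartedSpace E Y]
    [IsManifold 𝓘(ℝ, E) ∞ X] [IsManifold 𝓘(ℝ, E) ∞ Y]
    (da : IsLocalDiffeomorph 𝓘(ℝ, E) 𝓘(ℝ, E) ∞ a) (db : IsLocalDiffeomorph 𝓘(ℝ, E) 𝓘(ℝ, E) ∞ b)
    {e : OpenPartialHomeomorph Y E} (he : e ∈ IsManifold.maximalAtlas 𝓘(ℝ, E) ∞ Y) :
    (ha.span hb).trans e ∈ IsManifold.maximalAtlas 𝓘(ℝ, E) ∞ X := by
  refine OpenPartialHomeomorph.mem_maximalAtlas_of_contMDiffOn _ ?_ ?_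
  · intro x hx
    obtain ⟨w, rfl, hw⟩ := (mem_span_trans_source ha hb).1 hx
    refine ContMDiffAt.contMDiffWithinAt ?_
    refine ((da w).contMDiffAt_comp_iff (f := (ha.span hb).trans e)).1 ?_
    simp only [OpenPartialHomeomorph.coe_trans, Function.comp_apply, span_apply]
    exact (contMDiffAt_of_mem_maximalAtlas he hw).comp w (db w).contMDiffAt
  · intro v hv
    rw [OpenPartialHomeomorph.trans_target, span_target] at hv
    obtain ⟨hv, w, hw⟩ := hv
    refine ContMDiffAt.contMDiffWithinAt ?_
    have h1 : ContMDiffAt 𝓘(ℝ, E) 𝓘(ℝ, E) ∞ (ha.span hb).symm (b w) := by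
      refine ((db w).contMDiffAt_comp_iff (f := (ha.span hb).symm)).1 ?_
      simp only [span_symm_apply]
      exact (da w).contMDiffAt
    rw [hw] at h1
    exact h1.comp v (contMDiffAt_symm_of_mem_maximalAtlas he hv)

end Span

/-! ### Glued manifolds -/

namespace GluingData

section Topology

variable {X Y : Type*} [TopologicalSpace X] [TopologicalSpace Y] (G : GluingData X Y)

theorem exists_inl_or_inr (z : G.Glued) : (∃ x, G.inl x = z) ∨ ∃ y, G.inr y = z := by
  induction z using Quotient.inductionOn with
  | h a =>
    rcases a with x | y
    · exact Or.inl ⟨x, rfl⟩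
    · exact Or.inr ⟨y, rfl⟩

theorem secondCountableTopology [SecondCountableTopology X] [SecondCountableTopology Y] :
    SecondCountableTopology G.Glued := by
  have hl : SecondCountableTopology (range G.inl) :=
    G.isOpenEmbedding_inl.isEmbedding.toHomeomorph.symm.secondCountableTopology
  have hr : SecondCountableTopology (range G.inr) :=
    G.isOpenEmbedding_inr.isEmbedding.toHomeomorph.symm.secondCountableTopology
  have : ∀ b : Bool, SecondCountableTopology ((bif b then range G.inl else range G.inr : Set _)) :=
    fun b => by cases b <;> assumption
  refine secondCountableTopology_of_countable_cover
    (U := fun b : Bool => (bif b then range G.inl else range G.inr)) ?_ ?_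
  · rintro (_ | _)
    · exact G.isOpenEmbedding_inr.isOpen_range
    · exact G.isOpenEmbedding_inl.isOpen_range
  · refine eq_univ_of_forall fun z => mem_iUnion.2 ?_
    rcases G.exists_inl_or_inr z with h | h
    · exact ⟨true, h⟩
    · exact ⟨false, h⟩

/-- The glued space is Hausdorff if the graph of the identification is closed. -/
theorem t2Space [T2Space X] [T2Space Y]
    (hG : IsClosed {w : X × Y | G.inl w.1 = G.inr w.2}) : T2Space G.Glued := by
  have hlr : ∀ x y, G.inl x ≠ G.inr y → ∃ u v : Set G.Glued, IsOpen u ∧ IsOpen v ∧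
      G.inl x ∈ u ∧ G.inr y ∈ v ∧ Disjoint u v := fun x y h => by
    obtain ⟨u, v, hu, hv, hx, hy, huv⟩ := isOpen_prod_iff.1 hG.isOpen_compl x y h
    refine ⟨_, _, G.isOpenEmbedding_inl.isOpenMap u hu, G.isOpenEmbedding_inr.isOpenMap v hv,
      mem_image_of_mem _ hx, mem_image_of_mem _ hy, Set.disjoint_left.2 ?_⟩
    rintro _ ⟨x', hx', rfl⟩ ⟨y', hy', h'⟩
    exact huv (mk_mem_prod hx' hy') h'.symm
  refine ⟨fun z z' h => ?_⟩
  rcases G.exists_inl_or_inr z with ⟨x, rfl⟩ | ⟨x, rfl⟩ <;>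
    rcases G.exists_inl_or_inr z' with ⟨y, rfl⟩ | ⟨y, rfl⟩
  · obtain ⟨u, v, hu, hv, hx, hy, huv⟩ := t2_separation (fun h' => h (congrArg _ h'))
    exact ⟨_, _, G.isOpenEmbedding_inl.isOpenMap u hu, G.isOpenEmbedding_inl.isOpenMap v hv,
      mem_image_of_mem _ hx, mem_image_of_mem _ hy,
      (disjoint_image_iff G.isOpenEmbedding_inl.injective).2 huv⟩
  · exact hlr x y h
  · obtain ⟨u, v, hu, hv, hx, hy, huv⟩ := hlr y x h.symm
    exact ⟨v, u, hv, hu, hy, hx, huv.symm⟩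
  · obtain ⟨u, v, hu, hv, hx, hy, huv⟩ := t2_separation (fun h' => h (congrArg _ h'))
    exact ⟨_, _, G.isOpenEmbedding_inr.isOpenMap u hu, G.isOpenEmbedding_inr.isOpenMap v hv,
      mem_image_of_mem _ hx, mem_image_of_mem _ hy,
      (disjoint_image_iff G.isOpenEmbedding_inr.injective).2 huv⟩

end Topology

variable {E : Type*} [NormedAddCommGroup E] [NormedSpace ℝ E]
  {X : Type*} [TopologicalSpace X] [ChartedSpace E X]
  {Y : Type*} [TopologicalSpace Y] [ChartedSpace E Y] (G : GluingData X Y)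

/-- A transition function between charts of two pieces is smooth if the identification is. -/
theorem contDiffAt_transition [IsManifold 𝓘(ℝ, E) ∞ X] [IsManifold 𝓘(ℝ, E) ∞ Y]
    {Z : Type*} {j : X → Z} {j' : Y → Z}
    {U : Opens X} {f : U → Y} (hf : ContMDiff 𝓘(ℝ, E) 𝓘(ℝ, E) ∞ f)
    (hj : ∀ x y, j x = j' y → ∃ h : x ∈ U, f ⟨x, h⟩ = y) {F : Z → E}
    {e : OpenPartialHomeomorph X E} (he : e ∈ atlas E X)
    {e' : OpenPartialHomeomorph Y E} (he' : e' ∈ atlas E Y) (hF : ∀ y, F (j' y) = e' y)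
    (hjf : ∀ x, j x.1 = j' (f x))
    {b : E} (hb : b ∈ e.target) (hb' : j (e.symm b) ∈ j' '' e'.source) :
    ContDiffAt ℝ ∞ (fun b => F (j (e.symm b))) b := by
  obtain ⟨y, hy, hyb⟩ := hb'
  obtain ⟨hU, hfy⟩ := hj _ _ hyb.symm
  classical
  -- The value outside `U` is irrelevant: only the germ of `g` at a point of the open set `U` is
  -- used.
  let g : X → Y := fun x => if h : x ∈ U then f ⟨x, h⟩ else y
  have hg : ContMDiffAt 𝓘(ℝ, E) 𝓘(ℝ, E) ∞ g (e.symm b) := by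
    refine (contMDiffAt_subtype_iff (x := ⟨_, hU⟩)).1 ?_
    refine hf.contMDiffAt.congr_of_eventuallyEq (Filter.Eventually.of_forall fun x => ?_)
    simp [g]
  have hgb : g (e.symm b) = y := by simp only [g, dif_pos hU]; exact hfy
  have h1 : ContMDiffAt 𝓘(ℝ, E) 𝓘(ℝ, E) ∞ (fun b => e' (g (e.symm b))) b := by
    refine ContMDiffAt.comp b (g := fun x => e' (g x)) (ContMDiffAt.comp _ (g := e') ?_ hg) ?_
    · rw [hgb]
      exact contMDiffAt_of_mem_maximalAtlas
        (StructureGroupoid.subset_maximalAtlas _ he') hy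
    · exact contMDiffAt_symm_of_mem_maximalAtlas
        (StructureGroupoid.subset_maximalAtlas _ he) hb
  refine (contMDiffAt_iff_contDiffAt.1 h1).congr_of_eventuallyEq ?_
  filter_upwards [(e.continuousAt_symm hb).preimage_mem_nhds (U.isOpen.mem_nhds hU)] with c hc
  have hc' : e.symm c ∈ U := hc
  rw [hjf ⟨_, hc'⟩, hF]
  simp [g, hc']

/-- Charts from different pieces are compared through the identification or its inverse. Charts from
the same piece fall under the same lemma, with `U = ⊤` and the identity as identification. -/
theorem isManifold [IsManifold 𝓘(ℝ, E) ∞ X] [IsManifold 𝓘(ℝ, E) ∞ Y]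
    (hf : ContMDiff 𝓘(ℝ, E) 𝓘(ℝ, E) ∞ fun u : G.U => (G.homeo u : Y))
    (hg : ContMDiff 𝓘(ℝ, E) 𝓘(ℝ, E) ∞ fun v : G.V => (G.homeo.symm v : X)) :
    IsManifold 𝓘(ℝ, E) ∞ G.Glued := by
  refine isManifold_of_contDiffOn _ _ _ fun e e' he he' b hb => ContDiffAt.contDiffWithinAt ?_
  obtain ⟨⟨hb1, hb2⟩, -⟩ := hb
  rcases he with ⟨e, he, rfl⟩ | ⟨e, he, rfl⟩ <;> rcases he' with ⟨e', he', rfl⟩ | ⟨e', he', rfl⟩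
  · refine contDiffAt_transition (j := G.inl) (j' := G.inl)
      (F := e'.lift_openEmbedding G.isOpenEmbedding_inl) (U := ⊤) (f := Subtype.val)
      contMDiff_subtype_val (fun x y h => ⟨trivial, G.inl_eq_inl.1 h⟩) he he'
      (fun y => OpenPartialHomeomorph.lift_openEmbedding_apply _ _) (fun _ => rfl) hb1 hb2
  · refine contDiffAt_transition (j := G.inl) (j' := G.inr)
      (F := e'.lift_openEmbedding G.isOpenEmbedding_inr) hf (fun x y h => G.inl_eq_inr.1 h)
      he he' (fun y => OpenPartialHomeomorph.lift_openEmbedding_apply _ _)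
      (fun x => G.inl_eq_inr.2 ⟨x.2, rfl⟩) hb1 hb2
  · refine contDiffAt_transition (j := G.inr) (j' := G.inl)
      (F := e'.lift_openEmbedding G.isOpenEmbedding_inl) hg (fun x y h => ?_)
      he he' (fun y => OpenPartialHomeomorph.lift_openEmbedding_apply _ _)
      (fun x => (G.inl_eq_inr.2 ⟨(G.homeo.symm x).2, by simp⟩).symm) hb1 hb2
    obtain ⟨h1, rfl⟩ := G.inl_eq_inr.1 h.symm
    exact ⟨(G.homeo ⟨y, h1⟩).2, by simp⟩
  · refine contDiffAt_transition (j := G.inr) (j' := G.inr)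
      (F := e'.lift_openEmbedding G.isOpenEmbedding_inr) (U := ⊤) (f := Subtype.val)
      contMDiff_subtype_val (fun x y h => ⟨trivial, G.inr_eq_inr.1 h⟩) he he'
      (fun y => OpenPartialHomeomorph.lift_openEmbedding_apply _ _) (fun _ => rfl) hb1 hb2

theorem isLocalDiffeomorph_inl [IsManifold 𝓘(ℝ, E) ∞ X] [IsManifold 𝓘(ℝ, E) ∞ G.Glued] :
    IsLocalDiffeomorph 𝓘(ℝ, E) 𝓘(ℝ, E) ∞ G.inl :=
  isLocalDiffeomorph_of_charts fun x => ⟨chartAt E x, IsManifold.chart_mem_maximalAtlas x,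
    (chartAt E x).lift_openEmbedding G.isOpenEmbedding_inl,
    StructureGroupoid.subset_maximalAtlas _ (Or.inl ⟨_, chart_mem_atlas E x, rfl⟩),
    mem_chart_source E x, fun _ hy => ⟨mem_image_of_mem _ hy,
      OpenPartialHomeomorph.lift_openEmbedding_apply _ _⟩⟩

theorem isLocalDiffeomorph_inr [IsManifold 𝓘(ℝ, E) ∞ Y] [IsManifold 𝓘(ℝ, E) ∞ G.Glued] :
    IsLocalDiffeomorph 𝓘(ℝ, E) 𝓘(ℝ, E) ∞ G.inr :=
  isLocalDiffeomorph_of_charts fun x => ⟨chartAt E x, IsManifold.chart_mem_maximalAtlas x,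
    (chartAt E x).lift_openEmbedding G.isOpenEmbedding_inr,
    StructureGroupoid.subset_maximalAtlas _ (Or.inr ⟨_, chart_mem_atlas E x, rfl⟩),
    mem_chart_source E x, fun _ hy => ⟨mem_image_of_mem _ hy,
      OpenPartialHomeomorph.lift_openEmbedding_apply _ _⟩⟩

end GluingData

/-! ### Smooth structures of projective spaces and of the blow-up of the origin -/

theorem secondCountableTopology_of_charts {ι X H : Type*} [Countable ι] [TopologicalSpace X]
    [TopologicalSpace H] [SecondCountableTopology H] (e : ι → OpenPartialHomeomorph X H)
    (h : ∀ x, ∃ i, x ∈ (e i).source) : SecondCountableTopology X :=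
  have : ∀ i, SecondCountableTopology (e i).source :=
    fun i => (e i).secondCountableTopology_source
  secondCountableTopology_of_countable_cover (fun i => (e i).open_source)
    (eq_univ_of_forall fun x => mem_iUnion.2 (h x))

theorem contMDiffAt_of_charts {E X Y : Type*} [NormedAddCommGroup E] [NormedSpace ℝ E]
    [TopologicalSpace X] [ChartedSpace E X] [IsManifold 𝓘(ℝ, E) ∞ X]
    [TopologicalSpace Y] [ChartedSpace E Y] [IsManifold 𝓘(ℝ, E) ∞ Y] {f : X → Y}
    {e : OpenPartialHomeomorph X E} (he : e ∈ IsManifold.maximalAtlas 𝓘(ℝ, E) ∞ X)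
    {e' : OpenPartialHomeomorph Y E} (he' : e' ∈ IsManifold.maximalAtlas 𝓘(ℝ, E) ∞ Y)
    {g : E → E} {x : X} (hx : x ∈ e.source) (hf : ∀ y ∈ e.source, f y = e'.symm (g (e y)))
    (hg : ContDiffAt ℝ ∞ g (e x)) (hgx : g (e x) ∈ e'.target) :
    ContMDiffAt 𝓘(ℝ, E) 𝓘(ℝ, E) ∞ f x := by
  have h1 : ContMDiffAt 𝓘(ℝ, E) 𝓘(ℝ, E) ∞ (fun y => g (e y)) x :=
    (contMDiffAt_iff_contDiffAt.2 hg).comp x (contMDiffAt_of_mem_maximalAtlas he hx)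
  have h2 : ContMDiffAt 𝓘(ℝ, E) 𝓘(ℝ, E) ∞ (fun y => e'.symm (g (e y))) x :=
    (contMDiffAt_symm_of_mem_maximalAtlas he' hgx).comp x h1
  refine h2.congr_of_eventuallyEq ?_
  filter_upwards [e.open_source.mem_nhds hx] with y hy using hf y hy

theorem contDiff_qapply {n : ℕ} (k : Fin n) : ContDiff ℝ ∞ fun q : QSpace n => q k :=
  contDiff_piLp_apply 2

theorem ContDiffAt.qinv {F : Type*} [NormedAddCommGroup F] [NormedSpace ℝ F] {f : F → ℍ[ℝ]} {x : F}
    (hf : ContDiffAt ℝ ∞ f x) (h : f x ≠ 0) : ContDiffAt ℝ ∞ (fun y => (f y)⁻¹) x := by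
  have h1 : ContDiffAt ℝ ∞ (fun a : ℍ[ℝ] => a⁻¹) (f x) := by
    simpa only [Ring.inverse_eq_inv'] using! contDiffAt_ringInverse ℝ (Units.mk0 (f x) h)
  exact h1.comp x hf

theorem contDiff_qstar : ContDiff ℝ ∞ (star : ℍ[ℝ] → ℍ[ℝ]) :=
  (LinearMap.toContinuousLinearMap (⟨⟨star, star_add⟩, Quaternion.star_smul⟩ :
    ℍ[ℝ] →ₗ[ℝ] ℍ[ℝ])).contDiff

namespace HP

theorem contDiff_homog {n : ℕ} (i : Fin (n + 1)) :
    ContDiff ℝ ∞ (homog i : QSpace n → QSpace (n + 1)) := by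
  refine (contDiff_piLp 2).2 fun k => ?_
  refine Fin.succAboveCases i ?_ (fun k => ?_) k
  · simp only [homog_self]; exact contDiff_const
  · simp only [homog_succAbove]; exact contDiff_qapply k

instance (n : ℕ) : IsManifold 𝓘(ℝ, QSpace n) ∞ (HP n) := by
  refine isManifold_of_contDiffOn _ _ _ ?_
  rintro _ _ ⟨i, rfl⟩ ⟨j, rfl⟩ b ⟨⟨-, hb⟩, -⟩
  have hb' : homog i b j ≠ 0 := (QLines.mk_mem_affine j _ (homog_ne_zero i b)).1 hb
  refine ContDiffAt.contDiffWithinAt ((contDiffAt_piLp 2).2 fun k => ?_)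
  change ContDiffAt ℝ ∞ (fun b => homog i b (j.succAbove k) * (homog i b j)⁻¹) b
  have h := fun k => ((contDiff_piLp 2).1 (contDiff_homog i) k).contDiffAt (x := b)
  exact (h _).mul ((h j).qinv hb')

instance (n : ℕ) : SecondCountableTopology (HP n) :=
  secondCountableTopology_of_charts affineChart exists_mem_affine

end HP

/-- Multiplication of vectors by quaternions on the right. -/
def rsmul {n : ℕ} (a : QSpace n) (t : ℍ[ℝ]) : QSpace n := MulOpposite.op t • a

theorem rsmul_apply {n : ℕ} (a : QSpace n) (t : ℍ[ℝ]) (k : Fin n) : rsmul a t k = a k * t := rfl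

theorem norm_sq_rsmul {n : ℕ} (a : QSpace n) (t : ℍ[ℝ]) :
    ‖rsmul a t‖ ^ 2 = ‖a‖ ^ 2 * ‖t‖ ^ 2 := by
  simp [PiLp.norm_sq_eq_of_L2, rsmul_apply, mul_pow, Finset.sum_mul]

theorem rsmul_rsmul {n : ℕ} (a : QSpace n) (s t : ℍ[ℝ]) : rsmul (rsmul a s) t = rsmul a (s * t) :=
  PiLp.ext fun k => by simp [rsmul_apply, mul_assoc]

theorem rsmul_ne_zero {n : ℕ} {a : QSpace n} {t : ℍ[ℝ]} (ha : a ≠ 0) (ht : t ≠ 0) :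
    rsmul a t ≠ 0 := by
  intro h
  have h1 := norm_sq_rsmul a t
  rw [h, norm_zero] at h1
  have := norm_pos_iff.2 ha
  have := norm_pos_iff.2 ht
  have : 0 < ‖a‖ ^ 2 * ‖t‖ ^ 2 := by positivity
  linarith

/-! ### Right lines are separated by their orthogonal projections -/

namespace QLines

theorem mk_eq_mk_iff {m : ℕ} {a b : QSpace m} (ha : a ≠ 0) (hb : b ≠ 0) :
    Projectivization.mk ℍ[ℝ]ᵐᵒᵖ a ha = Projectivization.mk ℍ[ℝ]ᵐᵒᵖ b hb ↔
      ∃ t : ℍ[ℝ], t ≠ 0 ∧ a = rsmul b t := by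
  rw [Projectivization.mk_eq_mk_iff']
  constructor
  · rintro ⟨t, rfl⟩
    refine ⟨t.unop, ?_, rfl⟩
    rintro h
    apply ha
    rw [(MulOpposite.unop_eq_zero_iff t).1 h, zero_smul]
  · rintro ⟨t, -, rfl⟩
    exact ⟨MulOpposite.op t, rfl⟩

/-- The entries `a_j ā_k / |a|²` of the orthogonal projection onto the line `[a]`. -/
def proj {m : ℕ} (j k : Fin m) : QLines m → ℍ[ℝ] :=
  Projectivization.lift (fun a => (‖a.1‖ ^ 2)⁻¹ • (a.1 j * star (a.1 k))) (by
    rintro ⟨a, ha⟩ ⟨b, hb⟩ t h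
    have h' : a = rsmul b t.unop := h
    have ht : t.unop ≠ 0 := by
      rintro h0
      apply ha
      rw [h', h0]
      exact PiLp.ext fun k => mul_zero _
    have ht' : ‖t.unop‖ ^ 2 ≠ 0 := by positivity
    have hm : ∀ x y s : ℍ[ℝ], x * s * star (y * s) = (‖s‖ ^ 2) • (x * star y) := fun x y s => by
      rw [star_mul, mul_assoc, ← mul_assoc s, Quaternion.self_mul_star,
        Quaternion.normSq_eq_norm_mul_self, ← mul_assoc, ← sq, ← Quaternion.coe_commutes, mul_assoc,
        Quaternion.coe_mul_eq_smul]
    simp only [h', norm_sq_rsmul, rsmul_apply, hm, smul_smul]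
    congr 1
    field_simp)

theorem continuous_proj {m : ℕ} (j k : Fin m) : Continuous (proj j k) := by
  rw [(isQuotientMap_mk' m).continuous_iff]
  change Continuous fun a : {v : QSpace m // v ≠ 0} => (‖a.1‖ ^ 2)⁻¹ • (a.1 j * star (a.1 k))
  have h1 : Continuous fun a : {v : QSpace m // v ≠ 0} => ‖a.1‖ ^ 2 := by fun_prop
  have h2 : Continuous fun a : {v : QSpace m // v ≠ 0} => a.1 j * star (a.1 k) := by fun_prop
  refine (h1.inv₀ fun a => ?_).smul h2
  have := norm_ne_zero_iff.2 a.2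
  positivity

/-- A column of the projection matrix with index `k` such that `a_k ≠ 0` is a nonzero right multiple
of `a`, hence recovers the line. Continuity of the entries then makes the space of lines Hausdorff.
-/
theorem proj_injective (m : ℕ) :
    Function.Injective fun (a : QLines m) (j k : Fin m) => proj j k a := by
  intro a b h
  induction a using Projectivization.ind with
  | h a ha =>
  induction b using Projectivization.ind with
  | h b hb =>
    obtain ⟨k, hk⟩ : ∃ k, a k ≠ 0 := by
      by_contra! h
      exact ha (PiLp.ext h)
    have h' : ∀ j, (‖a‖ ^ 2)⁻¹ • (a j * star (a k)) = (‖b‖ ^ 2)⁻¹ • (b j * star (b k)) :=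
      fun j => congrFun (congrFun h j) k
    have ha' : (‖a‖ ^ 2 : ℝ) ≠ 0 := by have := norm_ne_zero_iff.2 ha; positivity
    have hk' : star (a k) ≠ 0 := star_ne_zero.2 hk
    refine (Projectivization.mk_eq_mk_iff' _ _ _ _ _).2
      ⟨MulOpposite.op ((‖a‖ ^ 2 * (‖b‖ ^ 2)⁻¹) • (star (b k) * (star (a k))⁻¹)),
        PiLp.ext fun j => ?_⟩
    change b j * ((‖a‖ ^ 2 * (‖b‖ ^ 2)⁻¹) • (star (b k) * (star (a k))⁻¹)) = a j
    rw [mul_smul_comm, ← mul_assoc, mul_smul, ← smul_mul_assoc, ← h' j, smul_mul_assoc,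
      smul_inv_smul₀ ha', mul_inv_cancel_right₀ hk']

instance (m : ℕ) : T2Space (QLines m) :=
  .of_injective_continuous (proj_injective m)
    (continuous_pi fun j => continuous_pi fun k => continuous_proj j k)

end QLines

namespace Bl₀

theorem contDiff_slopes {n : ℕ} (i : Fin n) :
    ContDiff ℝ ∞ (slopes i : QSpace n → QSpace n) := by
  refine (contDiff_piLp 2).2 fun k => ?_
  by_cases hk : k = i
  · subst hk; simp only [slopes_self]; exact contDiff_const
  · simp only [slopes, Function.update_of_ne hk]; exact contDiff_qapply k

theorem exists_mem_chart {n : ℕ} (z : Bl₀ n) : ∃ i, z ∈ (chart i).source :=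
  HP.exists_mem_affine z.1.2

theorem chart_apply_self {n : ℕ} (i : Fin n) (z : Bl₀ n) : chart i z i = z.1.1 i := by
  change Function.update (fun k => QLines.ratio i k z.1.2) i (z.1.1 i) i = z.1.1 i
  rw [Function.update_self]

theorem chart_apply_of_ne {n : ℕ} {i k : Fin n} (h : k ≠ i) (z : Bl₀ n) :
    chart i z k = QLines.ratio i k z.1.2 := by
  change Function.update (fun k => QLines.ratio i k z.1.2) i (z.1.1 i) k = QLines.ratio i k z.1.2
  rw [Function.update_of_ne h]

instance (n : ℕ) : IsManifold 𝓘(ℝ, QSpace n) ∞ (Bl₀ n) := by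
  refine isManifold_of_contDiffOn _ _ _ ?_
  rintro _ _ ⟨i, rfl⟩ ⟨j, rfl⟩ b ⟨⟨-, hb⟩, -⟩
  have hb' : slopes i b j ≠ 0 := (QLines.mk_mem_affine j _ (slopes_ne_zero i b)).1 hb
  refine ContDiffAt.contDiffWithinAt ((contDiffAt_piLp 2).2 fun k => ?_)
  have h := fun k => ((contDiff_piLp 2).1 (contDiff_slopes i) k).contDiffAt (x := b)
  change ContDiffAt ℝ ∞ (fun b => chart j ((chart i).symm b) k) b
  by_cases hk : k = j
  · subst hk
    simp only [chart_apply_self]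
    exact (h k).mul (contDiff_qapply i).contDiffAt
  · simp only [chart_apply_of_ne hk]
    exact (h k).mul ((h j).qinv hb')

instance (n : ℕ) : SecondCountableTopology (Bl₀ n) :=
  secondCountableTopology_of_charts chart exists_mem_chart

theorem contMDiff_fst (n : ℕ) :
    ContMDiff 𝓘(ℝ, QSpace n) 𝓘(ℝ, QSpace n) ∞ fun z : Bl₀ n => z.1.1 := by
  intro z
  obtain ⟨i, hi⟩ := exists_mem_chart z
  refine contMDiffAt_of_charts (e := chart i)
    (StructureGroupoid.subset_maximalAtlas _ (mem_range_self i))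
    (e' := OpenPartialHomeomorph.refl _) (StructureGroupoid.id_mem_maximalAtlas _)
    (g := fun b => WithLp.toLp 2 fun k => slopes i b k * b i) hi (fun y hy => ?_) ?_ (mem_univ _)
  · conv_lhs => rw [← (chart i).left_inv hy]
    rfl
  · refine ((contDiff_piLp 2).2 fun k => ?_).contDiffAt
    exact ((contDiff_piLp 2).1 (contDiff_slopes i) k).mul (contDiff_qapply i)

end Bl₀

/-! ### Connected sums are manifolds -/

theorem contDiffAt_radialFlip {E : Type*} [NormedAddCommGroup E] [InnerProductSpace ℝ E] {w : E}
    (hw : w ≠ 0) : ContDiffAt ℝ ∞ (radialFlip : E → E) w := by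
  have h : ContDiffAt ℝ ∞ (fun w : E => ‖w‖) w := contDiffAt_norm ℝ hw
  exact ((contDiffAt_const.sub h).div h (norm_ne_zero_iff.2 hw)).smul contDiffAt_id

namespace CoordDisc

section Closed

variable {E : Type*} [NormedAddCommGroup E] [NormedSpace ℝ E] {M : Type*} [TopologicalSpace M]

/-- The closed disc of radius `s` in the normalized coordinate. -/
def closedDisc (d : CoordDisc E M) (s : ℝ) : Set M := {x | x ∈ d.chart.source ∧ ‖d.coord x‖ ≤ s}

/-- It is the image of a compact ball under the inverse chart; `s ≤ 1` keeps the ball inside the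
target, and compact sets are closed in a Hausdorff space. -/
theorem isClosed_closedDisc [ProperSpace E] [T2Space M] (d : CoordDisc E M) {s : ℝ} (hs : s ≤ 1) :
    IsClosed (d.closedDisc s) := by
  have hsub : Metric.closedBall (d.chart d.center) (d.radius * s) ⊆ d.chart.target :=
    (Metric.closedBall_subset_closedBall (by nlinarith [d.radius_pos])).trans d.closedBall_subset
  have : d.closedDisc s = d.chart.symm '' Metric.closedBall (d.chart d.center) (d.radius * s) := by
    have key : ∀ x, ‖d.coord x‖ ≤ s ↔
        d.chart x ∈ Metric.closedBall (d.chart d.center) (d.radius * s) := fun x => by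
      rw [coord, norm_smul, norm_inv, Real.norm_eq_abs, abs_of_pos d.radius_pos,
        inv_mul_le_iff₀ d.radius_pos, mem_closedBall_iff_norm]
    ext x
    constructor
    · rintro ⟨hx, h⟩
      exact ⟨d.chart x, (key x).1 h, d.chart.left_inv hx⟩
    · rintro ⟨v, hv, rfl⟩
      refine ⟨d.chart.map_target (hsub hv), (key _).2 ?_⟩
      rwa [d.chart.right_inv (hsub hv)]
  rw [this]
  exact ((isCompact_closedBall _ _).image_of_continuousOn
    (d.chart.continuousOn_symm.mono hsub)).isClosed

theorem connectedSum_inl_eq_inr [T1Space M] {M' : Type*} [TopologicalSpace M'] [T1Space M']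
    (d : CoordDisc E M) (d' : CoordDisc E M') {x : puncture M d.center}
    {y : puncture M' d'.center} :
    (d.connectedSumData d').inl x = (d.connectedSumData d').inr y ↔
      (x : M) ∈ d.openDisc ∧ d'.param (radialFlip (d.coord x)) = y := by
  rw [GluingData.inl_eq_inr]
  constructor
  · rintro ⟨h, rfl⟩
    exact ⟨h, rfl⟩
  · rintro ⟨h, h'⟩
    exact ⟨h, Subtype.ext h'⟩

/-- Over the product of the closed unit discs, which is closed, the graph is cut out by the equation
`d'.coord y = radialFlip (d.coord x)` between continuous functions. -/
theorem isClosed_connectedSum_graph [ProperSpace E] [T2Space M] {M' : Type*} [TopologicalSpace M']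
    [T2Space M'] (d : CoordDisc E M) (d' : CoordDisc E M') :
    IsClosed {w : puncture M d.center × puncture M' d'.center |
      (d.connectedSumData d').inl w.1 = (d.connectedSumData d').inr w.2} := by
  set S : Set (puncture M d.center × puncture M' d'.center) :=
    {w | (w.1 : M) ∈ d.closedDisc 1 ∧ (w.2 : M') ∈ d'.closedDisc 1} with hS
  have hSc : IsClosed S :=
    ((d.isClosed_closedDisc le_rfl).preimage (continuous_subtype_val.comp continuous_fst)).inter
      ((d'.isClosed_closedDisc le_rfl).preimage (continuous_subtype_val.comp continuous_snd))
  have hc : ContinuousOn (fun w : puncture M d.center × puncture M' d'.center =>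
      (d'.coord w.2, radialFlip (d.coord w.1))) S := by
    refine ContinuousOn.prodMk ?_ ?_
    · exact d'.continuousOn_coord.comp (by fun_prop) fun w hw => hw.2.1
    · refine continuousOn_radialFlip.comp (d.continuousOn_coord.comp (by fun_prop)
        fun w hw => hw.1.1) fun w hw => d.coord_ne_zero hw.1.1 w.1.2
  convert hc.preimage_isClosed_of_isClosed hSc isClosed_diagonal using 1
  ext ⟨x, y⟩
  simp only [mem_ofPred_eq, connectedSum_inl_eq_inr, mem_inter_iff, mem_preimage,
    mem_diagonal_iff, hS]
  constructor
  · rintro ⟨hx, hy⟩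
    have h0 := d.coord_ne_zero hx.1 x.2
    have h1 := norm_radialFlip h0 hx.2
    have h2 : ‖radialFlip (d.coord x)‖ < 1 := by
      rw [h1]; linarith [norm_pos_iff.2 h0]
    rw [← hy, d'.coord_param h2]
    refine ⟨⟨⟨hx.1, hx.2.le⟩, d'.param_mem_source h2, ?_⟩, rfl⟩
    rw [d'.coord_param h2]
    exact h2.le
  · rintro ⟨⟨hx, hy⟩, h⟩
    refine ⟨⟨hx.1, lt_of_le_of_ne hx.2 fun h1 => ?_⟩, ?_⟩
    -- On the boundary sphere the flip takes the value `0`, which is the coordinate of the removed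
    -- centre. So passing to closed discs adds no points.
    · refine d'.coord_ne_zero hy.1 y.2 (h.trans ?_)
      simp [radialFlip, h1]
    · rw [← h, d'.param_coord hy.1]

end Closed

variable {E : Type*} [NormedAddCommGroup E] [InnerProductSpace ℝ E]
  {M : Type*} [TopologicalSpace M] [ChartedSpace E M] [IsManifold 𝓘(ℝ, E) ∞ M]
  {M' : Type*} [TopologicalSpace M'] [ChartedSpace E M'] [IsManifold 𝓘(ℝ, E) ∞ M']

theorem contMDiffAt_flip (d : CoordDisc E M)
    (hd : d.chart ∈ IsManifold.maximalAtlas 𝓘(ℝ, E) ∞ M) (d' : CoordDisc E M')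
    (hd' : d'.chart ∈ IsManifold.maximalAtlas 𝓘(ℝ, E) ∞ M') {x : M} (hx : x ∈ d.openDisc)
    (hc : x ≠ d.center) :
    ContMDiffAt 𝓘(ℝ, E) 𝓘(ℝ, E) ∞ (fun x => d'.param (radialFlip (d.coord x))) x := by
  have h0 := d.coord_ne_zero hx.1 hc
  have h2 : ‖radialFlip (d.coord x)‖ < 1 := by
    rw [norm_radialFlip h0 hx.2]; linarith [norm_pos_iff.2 h0]
  refine contMDiffAt_of_charts hd hd' (x := x) (g := fun v => d'.chart d'.center + d'.radius •
    radialFlip (d.radius⁻¹ • (v - d.chart d.center))) hx.1 (fun y _ => rfl) ?_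
    (d'.add_mem_target h2)
  have h3 : ContDiffAt ℝ ∞ (fun v => d.radius⁻¹ • (v - d.chart d.center)) (d.chart x) := by
    fun_prop
  exact contDiffAt_const.add (contDiffAt_const.smul
    (ContDiffAt.comp (d.chart x) (contDiffAt_radialFlip h0) h3))

variable [T2Space M] [T2Space M']

theorem isManifold_connectedSum (d : CoordDisc E M)
    (hd : d.chart ∈ IsManifold.maximalAtlas 𝓘(ℝ, E) ∞ M) (d' : CoordDisc E M')
    (hd' : d'.chart ∈ IsManifold.maximalAtlas 𝓘(ℝ, E) ∞ M') :
    IsManifold 𝓘(ℝ, E) ∞ (ConnectedSum d d') := by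
  refine GluingData.isManifold _ ?_ ?_
  · refine (ContMDiff.subtypeVal_comp_iff _ _).1 fun u => ?_
    exact ContMDiffAt.comp (f := fun u : (d.connectedSumData d').U => u.1.1) u
      (d.contMDiffAt_flip hd d' hd' u.2 u.1.2)
      (contMDiff_subtype_val.comp contMDiff_subtype_val).contMDiffAt
  · refine (ContMDiff.subtypeVal_comp_iff _ _).1 fun u => ?_
    exact ContMDiffAt.comp (f := fun v : (d.connectedSumData d').V => v.1.1) u
      (d'.contMDiffAt_flip hd' d hd u.2 u.1.2)
      (contMDiff_subtype_val.comp contMDiff_subtype_val).contMDiffAt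

end CoordDisc

/-! ### Blow-ups are manifolds -/

section BlowUp

variable {n : ℕ}

/-- Where `q_i ≠ 0`, the pair `(q, [q])` has the coordinates `q_k q_i⁻¹` and `q_i` in the `i`-th
chart. -/
theorem contMDiff_ofNeZero {W : Type*} [TopologicalSpace W] [ChartedSpace (QSpace n) W]
    {g : W → QSpace n} (hg : ContMDiff 𝓘(ℝ, QSpace n) 𝓘(ℝ, QSpace n) ∞ g) (h0 : ∀ w, g w ≠ 0) :
    ContMDiff 𝓘(ℝ, QSpace n) 𝓘(ℝ, QSpace n) ∞ fun w => Bl₀.ofNeZero (g w) (h0 w) := by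
  intro w
  obtain ⟨i, hi⟩ : ∃ i, g w i ≠ 0 := by
    by_contra! h
    exact h0 w (PiLp.ext h)
  have hmem : ∀ v, g v i ≠ 0 → Bl₀.ofNeZero (g v) (h0 v) ∈ (Bl₀.chart i).source :=
    fun v hv => (QLines.mk_mem_affine i _ _).2 hv
  have h1 : ContDiffAt ℝ ∞ (fun q : QSpace n => (WithLp.toLp 2
      (Function.update (fun k => q k * (q i)⁻¹) i (q i)) : QSpace n)) (g w) := by
    refine (contDiffAt_piLp 2).2 fun k => ?_
    by_cases hk : k = i
    · subst hk
      simp only [Function.update_self]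
      exact (contDiff_qapply k).contDiffAt
    · simp only [Function.update_of_ne hk]
      exact (contDiff_qapply k).contDiffAt.mul ((contDiff_qapply i).contDiffAt.qinv hi)
  have h2 : ContMDiffAt 𝓘(ℝ, QSpace n) 𝓘(ℝ, QSpace n) ∞ (fun v => (Bl₀.chart i).symm
      (WithLp.toLp 2 (Function.update (fun k => g v k * (g v i)⁻¹) i (g v i)))) w :=
    (contMDiffAt_symm_of_mem_maximalAtlas (StructureGroupoid.subset_maximalAtlas _
      (mem_range_self i)) (mem_univ _)).comp w
        ((contMDiffAt_iff_contDiffAt.2 h1).comp w hg.contMDiffAt)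
  refine h2.congr_of_eventuallyEq ?_
  have h3 : IsOpen {q : QSpace n | q i ≠ 0} := isOpen_ne_fun (by fun_prop) continuous_const
  filter_upwards [hg.continuous.continuousAt.preimage_mem_nhds (h3.mem_nhds hi)] with v hv
  exact ((Bl₀.chart i).left_inv (hmem v hv)).symm

theorem contMDiff_blowDown_inr {M : Type*} [TopologicalSpace M] [ChartedSpace (QSpace n) M]
    (e : OpenPartialHomeomorph M (QSpace n)) (p : M)
    (he : e ∈ IsManifold.maximalAtlas 𝓘(ℝ, QSpace n) ∞ M) :
    ContMDiff 𝓘(ℝ, QSpace n) 𝓘(ℝ, QSpace n) ∞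
      fun z : blowUpChartDomain e p => e.symm (e p + z.1.1.1) := by
  intro z
  have h1 : ContMDiffAt 𝓘(ℝ, QSpace n) 𝓘(ℝ, QSpace n) ∞ (fun q => e.symm (e p + q)) z.1.1.1 :=
    (contMDiffAt_symm_of_mem_maximalAtlas he z.2).comp z.1.1.1
      (contMDiffAt_iff_contDiffAt.2 (contDiffAt_const.add contDiffAt_id))
  exact ContMDiffAt.comp (f := fun z : blowUpChartDomain e p => z.1.1.1) z h1
    ((Bl₀.contMDiff_fst n).comp contMDiff_subtype_val).contMDiffAt

variable {M : Type*} [TopologicalSpace M] [T2Space M]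
  (e : OpenPartialHomeomorph M (QSpace n)) (p : M) (hp : p ∈ e.source)

/-- Off the exceptional set the blow-down map is injective, and `x ≠ p` forces `z` off that set. In
this form the identification is an equality of continuous maps into `M`, so its graph is closed. -/
theorem blowUp_inl_eq_inr {x : puncture M p} {z : blowUpChartDomain e p} :
    (blowUpData e p hp).inl x = (blowUpData e p hp).inr z ↔ (x : M) = e.symm (e p + z.1.1.1) := by
  refine ⟨fun h => congrArg (blowDown e p hp) h, fun h => ?_⟩
  have hx : (x : M) ∈ e.source := h ▸ e.map_target z.2
  have hq : e x - e p = z.1.1.1 := by rw [h, e.right_inv z.2, add_sub_cancel_left]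
  have h0 := chart_sub_ne_zero e hp hx x.2
  refine (blowUpData e p hp).inl_eq_inr.2 ⟨hx, Subtype.ext ?_⟩
  rw [Bl₀.eq_ofNeZero z.1 (hq ▸ h0)]
  change Bl₀.ofNeZero (e x - e p) _ = _
  simp only [hq]

theorem isClosed_blowUp_graph :
    IsClosed {w : puncture M p × blowUpChartDomain e p |
      (blowUpData e p hp).inl w.1 = (blowUpData e p hp).inr w.2} := by
  simp only [blowUp_inl_eq_inr]
  exact isClosed_eq (by fun_prop) (e.continuousOn_symm.comp_continuous (by fun_prop)
    fun w => w.2.2)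

variable [ChartedSpace (QSpace n) M] [IsManifold 𝓘(ℝ, QSpace n) ∞ M]

theorem isManifold_blowUp (he : e ∈ IsManifold.maximalAtlas 𝓘(ℝ, QSpace n) ∞ M) :
    IsManifold 𝓘(ℝ, QSpace n) ∞ (BlowUp e p hp) := by
  refine GluingData.isManifold _ ?_ ?_
  · refine (ContMDiff.subtypeVal_comp_iff _ _).1 ?_
    refine contMDiff_ofNeZero (g := fun u : (blowUpData e p hp).U => e u.1.1 - e p) (fun u => ?_) _
    have h1 : ContMDiffAt 𝓘(ℝ, QSpace n) 𝓘(ℝ, QSpace n) ∞ (fun x => e x - e p) u.1.1 :=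
      (contMDiffAt_of_mem_maximalAtlas he u.2).sub contMDiffAt_const
    exact ContMDiffAt.comp (f := fun u : (blowUpData e p hp).U => u.1.1) u h1
      (contMDiff_subtype_val.comp contMDiff_subtype_val).contMDiffAt
  · refine (ContMDiff.subtypeVal_comp_iff _ _).1 ?_
    exact (contMDiff_blowDown_inr e p he).comp contMDiff_subtype_val

theorem contMDiff_blowDown (he : e ∈ IsManifold.maximalAtlas 𝓘(ℝ, QSpace n) ∞ M) :
    ContMDiff 𝓘(ℝ, QSpace n) 𝓘(ℝ, QSpace n) ∞ (blowDown e p hp) := by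
  have := isManifold_blowUp e p hp he
  intro t
  rcases (blowUpData e p hp).exists_inl_or_inr t with ⟨x, rfl⟩ | ⟨z, rfl⟩
  · exact ((GluingData.isLocalDiffeomorph_inl _ x).contMDiffAt_comp_iff
      (f := blowDown e p hp)).1 contMDiff_subtype_val.contMDiffAt
  · exact ((GluingData.isLocalDiffeomorph_inr _ z).contMDiffAt_comp_iff
      (f := blowDown e p hp)).1 (contMDiff_blowDown_inr e p he).contMDiffAt

end BlowUp

/-! ### Slice regular maps between coordinates -/

section SliceRegularMaps

variable {n m : ℕ}

theorem IsLeftSliceRegularOn.congr_mono {f g : QSpace n → ℍ[ℝ]} {U V : Set (QSpace n)}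
    (hf : IsLeftSliceRegularOn f U) (hV : V ⊆ U) (h : ∀ q ∈ V, g q = f q) :
    IsLeftSliceRegularOn g V := by
  obtain ⟨D, F, hF, hU, hs⟩ := hf
  exact ⟨D, F, hF, hV.trans hU, fun z hz J hJ hq => (h _ hq).trans (hs z hz J hJ (hV hq))⟩

theorem IsRightSliceRegularOn.congr_mono {f g : QSpace n → ℍ[ℝ]} {U V : Set (QSpace n)}
    (hf : IsRightSliceRegularOn f U) (hV : V ⊆ U) (h : ∀ q ∈ V, g q = f q) :
    IsRightSliceRegularOn g V := by
  obtain ⟨D, F, hF, hU, hs⟩ := hf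
  exact ⟨D, F, hF, hV.trans hU, fun z hz J hJ hq => (h _ hq).trans (hs z hz J hJ (hV hq))⟩

theorem IsSliceRegularOn.congr_mono {f g : QSpace n → QSpace m} {U V : Set (QSpace n)}
    (hf : IsSliceRegularOn f U) (hV : V ⊆ U) (h : ∀ q ∈ V, g q = f q) :
    IsSliceRegularOn g V :=
  ⟨(hf.1.mono hV).congr h, fun i => (hf.2 i).imp
    (fun h' => h'.congr_mono hV fun q hq => by rw [h q hq])
    fun h' => h'.congr_mono hV fun q hq => by rw [h q hq]⟩

theorem isSliceRegularOn_of_components {f : QSpace n → QSpace m} {U : Set (QSpace n)}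
    (hd : ∀ q ∈ U, ∀ i, ContDiffAt ℝ ∞ (fun q => f q i) q)
    (h : ∀ i, ∃ g : QSpace n → ℍ[ℝ], (∀ q ∈ U, f q i = g q) ∧
      (IsLeftSliceRegularOn g U ∨ IsRightSliceRegularOn g U)) : IsSliceRegularOn f U := by
  refine ⟨fun q hq => ((contDiffAt_piLp 2).2 fun i => hd q hq i).differentiableAt
    (by simp) |>.differentiableWithinAt, fun i => ?_⟩
  obtain ⟨g, hg, h'⟩ := h i
  exact h'.imp (fun h => h.congr_mono Subset.rfl hg) fun h => h.congr_mono Subset.rfl hg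

theorem isSliceRegularOn_add_const (c : QSpace n) (U : Set (QSpace n)) :
    IsSliceRegularOn (fun q => q + c) U :=
  isSliceRegularOn_of_components
    (fun _ _ i => ((contDiff_qapply i).add contDiff_const).contDiffAt)
    fun i => ⟨fun q => id (q i) + c i, fun _ _ => rfl,
      Or.inl (isLeftSliceRegularOn_induced isInduced_id i _ fun _ _ _ _ => mem_univ _)⟩

theorem isSliceRegularOn_id (U : Set (QSpace n)) : IsSliceRegularOn (fun q => q) U := by
  simpa using isSliceRegularOn_add_const 0 U

/-- The blow-down map `b ↦ (b₁b_i, …, b_i, …, bₙb_i)` in coordinates, followed by a translation. -/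
theorem isSliceRegularOn_slopes_mul_add (i : Fin n) (c : QSpace n) (U : Set (QSpace n)) :
    IsSliceRegularOn (fun b => WithLp.toLp 2 (fun k => Bl₀.slopes i b k * b i) + c) U := by
  refine isSliceRegularOn_of_components (fun q _ k => ContDiff.contDiffAt ?_) fun k => ?_
  · exact (((contDiff_piLp 2).1 (Bl₀.contDiff_slopes i) k).mul (contDiff_qapply i)).add
      contDiff_const
  · by_cases hk : k = i
    · subst hk
      refine ⟨fun q => id (q k) + c k, fun q _ => ?_,
        Or.inl (isLeftSliceRegularOn_induced isInduced_id k _ fun _ _ _ _ => mem_univ _)⟩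
      simp [Bl₀.slopes_self]
    · refine ⟨fun q => id (q k) * id (q i) + c k, fun q _ => ?_,
        isSliceRegular_mul isInduced_id isInduced_id hk _ fun _ _ _ _ => ⟨mem_univ _, mem_univ _⟩⟩
      simp [Bl₀.slopes, hk]

theorem ne_zero_of_slicePoint_apply_ne_zero {z : Fin n → ℂ} {J : Fin n → ℍ[ℝ]} {i : Fin n}
    (h : slicePoint z J i ≠ 0) : z i ∈ ({0}ᶜ : Set ℂ) := by
  intro h0
  apply h
  rw [slicePoint_apply, mem_singleton_iff.1 h0]
  simp

/-- The inverse of the blow-down map in coordinates. -/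
theorem isSliceRegularOn_slopes (i : Fin n) :
    IsSliceRegularOn (fun q : QSpace n => (WithLp.toLp 2
      (Function.update (fun k => q k * (q i)⁻¹) i (q i)) : QSpace n)) {q | q i ≠ 0} := by
  refine isSliceRegularOn_of_components (fun q hq k => ?_) fun k => ?_
  · by_cases hk : k = i
    · subst hk
      simp only [Function.update_self]
      exact (contDiff_qapply k).contDiffAt
    · simp only [Function.update_of_ne hk]
      exact (contDiff_qapply k).contDiffAt.mul ((contDiff_qapply i).contDiffAt.qinv hq)
  · by_cases hk : k = i
    · subst hk
      refine ⟨fun q => id (q k) + 0, fun q _ => ?_,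
        Or.inl (isLeftSliceRegularOn_induced isInduced_id k _ fun _ _ _ _ => mem_univ _)⟩
      simp
    · refine ⟨fun q => id (q k) * (q i)⁻¹ + 0, fun q _ => ?_,
        isSliceRegular_mul isInduced_id isInduced_inv hk _
          fun _ _ _ h => ⟨mem_univ _, ne_zero_of_slicePoint_apply_ne_zero h⟩⟩
      simp [hk]

/-- The transition functions of the natural atlas of the blow-up of the origin. -/
theorem isSliceRegularOn_slopes_transition {i j : Fin n} (hij : i ≠ j) :
    IsSliceRegularOn (fun b : QSpace n => (WithLp.toLp 2
      (Function.update (fun k => Bl₀.slopes i b k * (b j)⁻¹) j (b j * b i)) : QSpace n))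
      {b | b j ≠ 0} := by
  refine isSliceRegularOn_of_components (fun q hq k => ?_) fun k => ?_
  · by_cases hk : k = j
    · subst hk
      simp only [Function.update_self]
      exact ((contDiff_qapply k).mul (contDiff_qapply i)).contDiffAt
    · simp only [Function.update_of_ne hk]
      exact ((contDiff_piLp 2).1 (Bl₀.contDiff_slopes i) k).contDiffAt.mul
        ((contDiff_qapply j).contDiffAt.qinv hq)
  · by_cases hk : k = j
    · subst hk
      refine ⟨fun q => id (q k) * id (q i) + 0, fun q _ => ?_,
        isSliceRegular_mul isInduced_id isInduced_id hij.symm _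
          fun _ _ _ _ => ⟨mem_univ _, mem_univ _⟩⟩
      simp
    · by_cases hki : k = i
      · subst hki
        refine ⟨fun q => (q j)⁻¹ + 0, fun q _ => ?_,
          Or.inl (isLeftSliceRegularOn_induced isInduced_inv j _
            fun _ _ _ h => ne_zero_of_slicePoint_apply_ne_zero h)⟩
        simp [hk, Bl₀.slopes_self]
      · refine ⟨fun q => id (q k) * (q j)⁻¹ + 0, fun q _ => ?_,
          isSliceRegular_mul isInduced_id isInduced_inv hk _
            fun _ _ _ h => ⟨mem_univ _, ne_zero_of_slicePoint_apply_ne_zero h⟩⟩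
        simp [hk, Bl₀.slopes, hki]

end SliceRegularMaps

/-! ### The regular atlas of the blow-up -/

/-- The transition function from `e` to `e'` is slice regular if it is given by a slice regular
map. -/
theorem isSliceRegularOn_transition {n : ℕ} {X : Type*} [TopologicalSpace X]
    {e e' : OpenPartialHomeomorph X (QSpace n)} {f : QSpace n → QSpace n} {S : Set (QSpace n)}
    (hf : IsSliceRegularOn f S)
    (h : ∀ t ∈ e.source, t ∈ e'.source → e t ∈ S ∧ e' t = f (e t)) :
    IsSliceRegularOn (fun q => e' (e.symm q)) (e.symm.trans e').source := by
  have key : ∀ q ∈ (e.symm.trans e').source, q ∈ S ∧ e' (e.symm q) = f q := fun q hq => by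
    have := h (e.symm q) (e.map_target hq.1) hq.2
    rwa [e.right_inv hq.1] at this
  exact hf.congr_mono (fun q hq => (key q hq).1) fun q hq => (key q hq).2

theorem trans_translation_mem_maximalAtlas {n : ℕ} {M : Type*} [TopologicalSpace M]
    [ChartedSpace (QSpace n) M] [IsManifold 𝓘(ℝ, QSpace n) ∞ M]
    {E : OpenPartialHomeomorph M (QSpace n)}
    (hE : E ∈ IsManifold.maximalAtlas 𝓘(ℝ, QSpace n) ∞ M) (c : QSpace n) :
    E.trans (Homeomorph.addRight c).toOpenPartialHomeomorph ∈
      IsManifold.maximalAtlas 𝓘(ℝ, QSpace n) ∞ M := by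
  refine OpenPartialHomeomorph.mem_maximalAtlas_of_contMDiffOn _ (fun x hx => ?_) fun v hv => ?_
  · have h1 : ContMDiffAt 𝓘(ℝ, QSpace n) 𝓘(ℝ, QSpace n) ∞ (fun q : QSpace n => q + c) (E x) :=
      contMDiffAt_iff_contDiffAt.2 (by fun_prop)
    exact (h1.comp x (contMDiffAt_of_mem_maximalAtlas hE hx.1)).contMDiffWithinAt
  · have h1 : ContMDiffAt 𝓘(ℝ, QSpace n) 𝓘(ℝ, QSpace n) ∞ (fun q : QSpace n => q + -c) v :=
      contMDiffAt_iff_contDiffAt.2 (by fun_prop)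
    have h2 : v + -c ∈ E.target := hv.2
    exact ((contMDiffAt_symm_of_mem_maximalAtlas hE h2).comp v h1).contMDiffWithinAt

section Atlas

variable {n : ℕ} {M : Type*} [TopologicalSpace M] [T2Space M]
  (e : OpenPartialHomeomorph M (QSpace n)) (p : M) (hp : p ∈ e.source)

/-- A chart of `M`, as a chart of the blow-up. -/
def outerChart [Nonempty (puncture M p)] (E : OpenPartialHomeomorph M (QSpace n)) :
    OpenPartialHomeomorph (BlowUp e p hp) (QSpace n) :=
  ((blowUpData e p hp).isOpenEmbedding_inl.span (puncture M p).isOpenEmbedding').trans E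

/-- A chart of `Bl₀(ℍⁿ)`, as a chart of the blow-up. -/
def innerChart [Nonempty (blowUpChartDomain e p)] (C : OpenPartialHomeomorph (Bl₀ n) (QSpace n)) :
    OpenPartialHomeomorph (BlowUp e p hp) (QSpace n) :=
  ((blowUpData e p hp).isOpenEmbedding_inr.span (blowUpChartDomain e p).isOpenEmbedding').trans C

variable {E E' : OpenPartialHomeomorph M (QSpace n)}
  {C C' : OpenPartialHomeomorph (Bl₀ n) (QSpace n)}
  {f : QSpace n → QSpace n} {S : Set (QSpace n)}

theorem mem_outerChart_source [Nonempty (puncture M p)] {t : BlowUp e p hp} :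
    t ∈ (outerChart e p hp E).source ↔ ∃ x, (blowUpData e p hp).inl x = t ∧ (x : M) ∈ E.source :=
  mem_span_trans_source _ _

theorem mem_innerChart_source [Nonempty (blowUpChartDomain e p)] {t : BlowUp e p hp} :
    t ∈ (innerChart e p hp C).source ↔ ∃ z, (blowUpData e p hp).inr z = t ∧ z.1 ∈ C.source :=
  mem_span_trans_source _ _

theorem outerChart_inl [Nonempty (puncture M p)] (x : puncture M p) :
    outerChart e p hp E ((blowUpData e p hp).inl x) = E x :=
  span_trans_apply _ _ _ _

theorem innerChart_inr [Nonempty (blowUpChartDomain e p)] (z : blowUpChartDomain e p) :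
    innerChart e p hp C ((blowUpData e p hp).inr z) = C z.1 :=
  span_trans_apply _ _ _ _

/-- This and the three analogues below reduce a transition function on the blow-up to a formula
relating the coordinates of the same point in `M` or in `Bl₀(ℍⁿ)`. An empty overlap is handled by
deriving a contradiction in the hypothesis `h`. -/
theorem outerChart_outerChart [Nonempty (puncture M p)] (hf : IsSliceRegularOn f S)
    (h : ∀ x ∈ E.source, x ∈ E'.source → E x ∈ S ∧ E' x = f (E x)) :
    IsSliceRegularOn (fun q => outerChart e p hp E' ((outerChart e p hp E).symm q))
      ((outerChart e p hp E).symm.trans (outerChart e p hp E')).source := by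
  refine isSliceRegularOn_transition hf fun t ht ht' => ?_
  obtain ⟨x, rfl, hx⟩ := (mem_outerChart_source e p hp).1 ht
  obtain ⟨x', hxx, hx'⟩ := (mem_outerChart_source e p hp).1 ht'
  obtain rfl := (blowUpData e p hp).inl_eq_inl.1 hxx
  rw [outerChart_inl, outerChart_inl]
  exact h _ hx hx'

theorem innerChart_innerChart [Nonempty (blowUpChartDomain e p)] (hf : IsSliceRegularOn f S)
    (h : ∀ x ∈ C.source, x ∈ C'.source → C x ∈ S ∧ C' x = f (C x)) :
    IsSliceRegularOn (fun q => innerChart e p hp C' ((innerChart e p hp C).symm q))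
      ((innerChart e p hp C).symm.trans (innerChart e p hp C')).source := by
  refine isSliceRegularOn_transition hf fun t ht ht' => ?_
  obtain ⟨x, rfl, hx⟩ := (mem_innerChart_source e p hp).1 ht
  obtain ⟨x', hxx, hx'⟩ := (mem_innerChart_source e p hp).1 ht'
  obtain rfl := (blowUpData e p hp).inr_eq_inr.1 hxx
  rw [innerChart_inr, innerChart_inr]
  exact h _ hx hx'

theorem chart_of_inl_eq_inr {x : puncture M p} {z : blowUpChartDomain e p}
    (h : (blowUpData e p hp).inl x = (blowUpData e p hp).inr z) :
    (x : M) ∈ e.source ∧ e x = e p + z.1.1.1 ∧ z.1.1.1 ≠ 0 := by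
  rw [blowUp_inl_eq_inr] at h
  refine ⟨h ▸ e.map_target z.2, by rw [h, e.right_inv z.2], fun h0 => x.2 ?_⟩
  rw [h0, add_zero, e.left_inv hp] at h
  exact h

theorem outerChart_innerChart [Nonempty (puncture M p)]
    [Nonempty (blowUpChartDomain e p)] (hf : IsSliceRegularOn f S)
    (h : ∀ x ∈ E.source, ∀ z ∈ C.source, x ∈ e.source → e x = e p + z.1.1 → z.1.1 ≠ 0 →
      E x ∈ S ∧ C z = f (E x)) :
    IsSliceRegularOn (fun q => innerChart e p hp C ((outerChart e p hp E).symm q))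
      ((outerChart e p hp E).symm.trans (innerChart e p hp C)).source := by
  refine isSliceRegularOn_transition hf fun t ht ht' => ?_
  obtain ⟨x, rfl, hx⟩ := (mem_outerChart_source e p hp).1 ht
  obtain ⟨z, hz, hzC⟩ := (mem_innerChart_source e p hp).1 ht'
  obtain ⟨h1, h2, h3⟩ := chart_of_inl_eq_inr e p hp hz.symm
  have := h _ hx _ hzC h1 h2 h3
  rwa [outerChart_inl, ← hz, innerChart_inr]

theorem innerChart_outerChart [Nonempty (puncture M p)]
    [Nonempty (blowUpChartDomain e p)] (hf : IsSliceRegularOn f S)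
    (h : ∀ x ∈ E.source, ∀ z ∈ C.source, x ∈ e.source → e x = e p + z.1.1 → z.1.1 ≠ 0 →
      C z ∈ S ∧ E x = f (C z)) :
    IsSliceRegularOn (fun q => outerChart e p hp E ((innerChart e p hp C).symm q))
      ((innerChart e p hp C).symm.trans (outerChart e p hp E)).source := by
  refine isSliceRegularOn_transition hf fun t ht ht' => ?_
  obtain ⟨z, rfl, hz⟩ := (mem_innerChart_source e p hp).1 ht
  obtain ⟨x, hx, hxE⟩ := (mem_outerChart_source e p hp).1 ht'
  obtain ⟨h1, h2, h3⟩ := chart_of_inl_eq_inr e p hp hx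
  have := h _ hxE _ hz h1 h2 h3
  rwa [innerChart_inr, ← hx, outerChart_inl]

variable [ChartedSpace (QSpace n) M] [IsManifold 𝓘(ℝ, QSpace n) ∞ M]

theorem outerChart_mem_maximalAtlas [Nonempty (puncture M p)]
    (he : e ∈ IsManifold.maximalAtlas 𝓘(ℝ, QSpace n) ∞ M)
    (hE : E ∈ IsManifold.maximalAtlas 𝓘(ℝ, QSpace n) ∞ M) :
    outerChart e p hp E ∈ IsManifold.maximalAtlas 𝓘(ℝ, QSpace n) ∞ (BlowUp e p hp) :=
  have := isManifold_blowUp e p hp he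
  span_trans_mem_maximalAtlas _ _ (GluingData.isLocalDiffeomorph_inl _)
    (isLocalDiffeomorph_val _) hE

theorem innerChart_mem_maximalAtlas [Nonempty (blowUpChartDomain e p)]
    (he : e ∈ IsManifold.maximalAtlas 𝓘(ℝ, QSpace n) ∞ M)
    (hC : C ∈ IsManifold.maximalAtlas 𝓘(ℝ, QSpace n) ∞ (Bl₀ n)) :
    innerChart e p hp C ∈ IsManifold.maximalAtlas 𝓘(ℝ, QSpace n) ∞ (BlowUp e p hp) :=
  have := isManifold_blowUp e p hp he
  span_trans_mem_maximalAtlas _ _ (GluingData.isLocalDiffeomorph_inr _)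
    (isLocalDiffeomorph_val _) hC

end Atlas

/-! ### The blow-up is quaternionic regular -/

namespace CoordDisc

variable {n : ℕ} {M : Type*} [TopologicalSpace M]

/-- Inverting the open embeddings of the two pieces requires them to be nonempty, which is where `1
≤ n` enters. Here a point at normalized distance `1/2` from the centre is taken. -/
theorem nonempty_puncture [T1Space M] (hn : 1 ≤ n) (d : CoordDisc (QSpace n) M) :
    Nonempty (puncture M d.center) := by
  have : Nonempty (Fin n) := ⟨⟨0, hn⟩⟩
  obtain ⟨w, hw⟩ := exists_ne (0 : QSpace n)
  have h0 : 0 < ‖w‖ := norm_pos_iff.2 hw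
  have h1 : ‖(2 * ‖w‖)⁻¹ • w‖ < 1 := by
    rw [norm_smul, Real.norm_of_nonneg (by positivity)]
    field_simp
    norm_num
  exact ⟨⟨d.param ((2 * ‖w‖)⁻¹ • w), d.param_ne_center h1 (smul_ne_zero (by positivity) hw)⟩⟩

theorem nonempty_blowUpChartDomain [T1Space M] (hn : 1 ≤ n) (d : CoordDisc (QSpace n) M) :
    Nonempty (blowUpChartDomain d.chart d.center) := by
  refine ⟨⟨(Bl₀.chart ⟨0, hn⟩).symm 0, ?_⟩⟩
  have : ((Bl₀.chart ⟨0, hn⟩).symm 0).1.1 = (0 : QSpace n) := PiLp.ext fun k => mul_zero _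
  change d.chart d.center + ((Bl₀.chart ⟨0, hn⟩).symm 0).1.1 ∈ d.chart.target
  rw [this, add_zero]
  exact d.chart.map_source d.center_mem

theorem norm_coord_eq (d : CoordDisc (QSpace n) M) {x : M} {q : QSpace n}
    (h : d.chart x = d.chart d.center + q) : ‖d.coord x‖ = d.radius⁻¹ * ‖q‖ := by
  rw [coord, h, add_sub_cancel_left, norm_smul, Real.norm_of_nonneg (inv_pos.2 d.radius_pos).le]

/-- The chart of the coordinate disc, centred at the origin. -/
def centredChart (d : CoordDisc (QSpace n) M) : OpenPartialHomeomorph M (QSpace n) :=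
  (d.chart.restr d.openDisc).trans
    (Homeomorph.addRight (-d.chart d.center)).toOpenPartialHomeomorph

theorem mem_centredChart_source (d : CoordDisc (QSpace n) M) {x : M} :
    x ∈ d.centredChart.source ↔ x ∈ d.openDisc := by
  simp only [centredChart, OpenPartialHomeomorph.trans_source,
    OpenPartialHomeomorph.restr_source' _ _ d.isOpen_openDisc]
  exact ⟨fun h => h.1.2, fun h => ⟨⟨h.1, h⟩, trivial⟩⟩

theorem centredChart_apply (d : CoordDisc (QSpace n) M) (x : M) :
    d.centredChart x = d.chart x + -d.chart d.center := rfl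

/-- The charts of `Bl₀(ℍⁿ)`, restricted to the part over the ball of half the radius. -/
def innerBall (d : CoordDisc (QSpace n) M) (i : Fin n) : OpenPartialHomeomorph (Bl₀ n) (QSpace n) :=
  (Bl₀.chart i).restr {z | ‖z.1.1‖ < d.radius / 2}

theorem isOpen_innerBall (d : CoordDisc (QSpace n) M) :
    IsOpen {z : Bl₀ n | ‖z.1.1‖ < d.radius / 2} :=
  isOpen_lt (by fun_prop) continuous_const

theorem mem_innerBall_source (d : CoordDisc (QSpace n) M) {i : Fin n} {z : Bl₀ n} :
    z ∈ (d.innerBall i).source ↔ z ∈ (Bl₀.chart i).source ∧ ‖z.1.1‖ < d.radius / 2 := by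
  rw [innerBall, OpenPartialHomeomorph.restr_source' _ _ d.isOpen_innerBall]
  rfl

theorem innerBall_apply (d : CoordDisc (QSpace n) M) (i : Fin n) (z : Bl₀ n) :
    d.innerBall i z = Bl₀.chart i z := rfl

theorem mem_restr_source [T2Space M] (d : CoordDisc (QSpace n) M)
    (E : OpenPartialHomeomorph M (QSpace n)) {s : ℝ} (hs : s ≤ 1) {x : M} :
    x ∈ (E.restr (d.closedDisc s)ᶜ).source ↔ x ∈ E.source ∧ x ∉ d.closedDisc s := by
  rw [OpenPartialHomeomorph.restr_source' _ _ (d.isClosed_closedDisc hs).isOpen_compl]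
  rfl

end CoordDisc

/-! ### Coordinate formulas on the blow-up of the origin -/

namespace Bl₀

variable {n : ℕ}

theorem chart_slopes {i : Fin n} {z : Bl₀ n} (hz : z ∈ (chart i).source) :
    z.1.1 = WithLp.toLp 2 (fun k => slopes i (chart i z) k * chart i z i) := by
  conv_lhs => rw [← (chart i).left_inv hz]
  rfl

theorem slopes_chart {i : Fin n} {z : Bl₀ n} (hz : z ∈ (chart i).source) (k : Fin n) :
    slopes i (chart i z) k = QLines.ratio i k z.1.2 := by
  by_cases hk : k = i
  · subst hk
    rw [slopes_self]; exact (QLines.ratio_self hz).symm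
  · simp only [slopes, Function.update_of_ne hk]
    exact chart_apply_of_ne hk z

theorem apply_ne_zero {i : Fin n} {z : Bl₀ n} (hz : z ∈ (chart i).source) (h0 : z.1.1 ≠ 0) :
    z.1.1 i ≠ 0 := by
  intro h
  refine h0 (PiLp.ext fun k => ?_)
  rw [(mem_submodule_iff hz z.1.1).1 z.2 k, h, mul_zero]
  rfl

theorem chart_eq_of_ne_zero {i : Fin n} {z : Bl₀ n} (hz : z ∈ (chart i).source)
    (h0 : z.1.1 ≠ 0) : chart i z = WithLp.toLp 2
      (Function.update (fun k => z.1.1 k * (z.1.1 i)⁻¹) i (z.1.1 i)) := by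
  refine PiLp.ext fun k => ?_
  by_cases hk : k = i
  · subst hk
    simp [chart_apply_self]
  · rw [chart_apply_of_ne hk]
    simp only [Function.update_of_ne hk]
    rw [(mem_submodule_iff hz z.1.1).1 z.2 k, mul_inv_cancel_right₀ (apply_ne_zero hz h0)]

theorem ratio_ne_zero {i j : Fin n} {a : QLines n} (hi : a ∈ QLines.affine i)
    (hj : a ∈ QLines.affine j) : QLines.ratio i j a ≠ 0 := by
  induction a using Projectivization.ind with
  | h a ha =>
    rw [QLines.ratio_mk]
    exact mul_ne_zero ((QLines.mk_mem_affine j a ha).1 hj)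
      (inv_ne_zero ((QLines.mk_mem_affine i a ha).1 hi))

theorem ratio_mul_inv {i j : Fin n} {a : QLines n} (hi : a ∈ QLines.affine i) (k : Fin n) :
    QLines.ratio j k a = QLines.ratio i k a * (QLines.ratio i j a)⁻¹ := by
  induction a using Projectivization.ind with
  | h a ha =>
    have := (QLines.mk_mem_affine i a ha).1 hi
    rw [QLines.ratio_mk, QLines.ratio_mk, QLines.ratio_mk, mul_inv_rev, inv_inv, mul_assoc,
      inv_mul_cancel_left₀ this]

theorem chart_transition {i j : Fin n} (hij : i ≠ j) {z : Bl₀ n} (hi : z ∈ (chart i).source)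
    (hj : z ∈ (chart j).source) : chart i z j ≠ 0 ∧ chart j z = WithLp.toLp 2
      (Function.update (fun k => slopes i (chart i z) k * (chart i z j)⁻¹) j
        (chart i z j * chart i z i)) := by
  have hz := chart_apply_of_ne hij.symm z
  refine ⟨hz ▸ ratio_ne_zero hi hj, PiLp.ext fun k => ?_⟩
  by_cases hk : k = j
  · subst hk
    simp only [chart_apply_self, Function.update_self, hz]
    exact (mem_submodule_iff hi z.1.1).1 z.2 k
  · simp only [chart_apply_of_ne hk, Function.update_of_ne hk, slopes_chart hi, hz]
    exact ratio_mul_inv hi k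

end Bl₀

section Atlas

variable {n : ℕ} {M : Type*} [TopologicalSpace M] [T2Space M]

/-- The atlas of the blow-up that consists of the charts of `A` off the closed disc, the chart of
the disc off the closed disc of half the radius, its translate on the punctured disc, and the
natural charts of `Bl₀(ℍⁿ)` over the ball of half the radius. -/
def blowUpAtlas (A : Set (OpenPartialHomeomorph M (QSpace n))) (d : CoordDisc (QSpace n) M)
    [Nonempty (puncture M d.center)] [Nonempty (blowUpChartDomain d.chart d.center)] :
    Set (OpenPartialHomeomorph (BlowUp d.chart d.center d.center_mem) (QSpace n)) :=
  ((fun E => outerChart d.chart d.center d.center_mem (E.restr (d.closedDisc 1)ᶜ)) '' A ∪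
    {outerChart d.chart d.center d.center_mem (d.chart.restr (d.closedDisc 2⁻¹)ᶜ)}) ∪
  ({outerChart d.chart d.center d.center_mem d.centredChart} ∪
    range fun i => innerChart d.chart d.center d.center_mem (d.innerBall i))

variable [ChartedSpace (QSpace n) M] {A : Set (OpenPartialHomeomorph M (QSpace n))}
  {d : CoordDisc (QSpace n) M} [Nonempty (puncture M d.center)]
  [Nonempty (blowUpChartDomain d.chart d.center)]

/-- The overlaps are of four kinds: two charts of `A`; the chart of the disc and its translate; the
translate and a natural chart of `Bl₀(ℍⁿ)`; two natural charts. The translate is needed because `q ↦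
(q - c)⁻¹` is not induced by a real holomorphic function when `c` is not real, so `φ` itself must
not meet the natural charts. -/
theorem blowUpAtlas_transition (hA : IsRegularAtlas A) (hd : d.chart ∈ A) :
    ∀ e ∈ blowUpAtlas A d, ∀ e' ∈ blowUpAtlas A d,
      IsSliceRegularOn (fun q => e' (e.symm q)) (e.symm.trans e').source := by
  have h2 : (2⁻¹ : ℝ) ≤ 1 := by norm_num
  have hid := isSliceRegularOn_id (n := n) univ
  have hr := d.radius_pos
  -- Both radii are left free because the chart of the disc is kept on a larger set, off the disc of
  -- radius `1/2`, than the other charts of `A`.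
  have hAA : ∀ E ∈ A, ∀ E' ∈ A, ∀ s ≤ 1, ∀ s' ≤ 1, IsSliceRegularOn
      (fun q => outerChart d.chart d.center d.center_mem (E'.restr (d.closedDisc s')ᶜ)
        ((outerChart d.chart d.center d.center_mem (E.restr (d.closedDisc s)ᶜ)).symm q))
      ((outerChart d.chart d.center d.center_mem (E.restr (d.closedDisc s)ᶜ)).symm.trans
        (outerChart d.chart d.center d.center_mem (E'.restr (d.closedDisc s')ᶜ))).source := by
    intro E hE E' hE' s hs s' hs'
    refine outerChart_outerChart _ _ _ (hA.transition E hE E' hE') fun x hx hx' => ?_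
    rw [d.mem_restr_source _ hs] at hx
    rw [d.mem_restr_source _ hs'] at hx'
    have h : E.symm (E x) = x := E.left_inv hx.1
    refine ⟨⟨E.map_source hx.1, ?_⟩, ?_⟩
    · change E.symm (E x) ∈ E'.source
      rw [h]
      exact hx'.1
    · change E' x = E' (E.symm (E x))
      rw [h]
  -- Points over the ball of radius `r/2` have normalized norm below `1/2`, so the natural charts
  -- are disjoint from every chart restricted to the complement of a closed disc of normalized
  -- radius `1/2` or `1`.
  have hfar : ∀ x z, d.chart x = d.chart d.center + z.1.1 → x ∈ d.chart.source →
      ∀ i, z ∈ (d.innerBall i).source → ∀ s, 2⁻¹ ≤ s → x ∈ d.closedDisc s :=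
    fun x z h hx i hz s hs => ⟨hx, by
      have h1 := (d.mem_innerBall_source.1 hz).2
      rw [d.norm_coord_eq h, inv_mul_le_iff₀ hr]
      nlinarith⟩
  rintro _ ((⟨E, hE, rfl⟩ | rfl) | (rfl | ⟨i, rfl⟩)) _ ((⟨E', hE', rfl⟩ | rfl) | (rfl | ⟨j, rfl⟩))
  · exact hAA E hE E' hE' _ le_rfl _ le_rfl
  · exact hAA E hE _ hd _ le_rfl _ h2
  · refine outerChart_outerChart _ _ _ hid fun x hx hx' => ?_
    rw [d.mem_restr_source _ le_rfl] at hx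
    rw [d.mem_centredChart_source] at hx'
    exact absurd ⟨hx'.1, hx'.2.le⟩ hx.2
  · refine outerChart_innerChart _ _ _ hid fun x hx z hz hxs h _ => ?_
    rw [d.mem_restr_source _ le_rfl] at hx
    exact absurd (hfar x z h hxs _ hz 1 h2) hx.2
  · exact hAA _ hd E' hE' _ h2 _ le_rfl
  · exact hAA _ hd _ hd _ h2 _ h2
  · exact outerChart_outerChart _ _ _ (isSliceRegularOn_add_const (-d.chart d.center) univ)
      fun x _ _ => ⟨mem_univ _, rfl⟩
  · refine outerChart_innerChart _ _ _ hid fun x hx z hz hxs h _ => ?_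
    rw [d.mem_restr_source _ h2] at hx
    exact absurd (hfar x z h hxs _ hz _ le_rfl) hx.2
  · refine outerChart_outerChart _ _ _ hid fun x hx hx' => ?_
    rw [d.mem_restr_source _ le_rfl] at hx'
    rw [d.mem_centredChart_source] at hx
    exact absurd ⟨hx.1, hx.2.le⟩ hx'.2
  · refine outerChart_outerChart _ _ _ (isSliceRegularOn_add_const (d.chart d.center) univ)
      fun x _ _ => ⟨mem_univ _, ?_⟩
    rw [d.centredChart_apply, neg_add_cancel_right]
    rfl
  · exact outerChart_outerChart _ _ _ hid fun x _ _ => ⟨mem_univ _, rfl⟩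
  · refine outerChart_innerChart _ _ _ (isSliceRegularOn_slopes j) fun x _ z hz hxs h h0 => ?_
    have hz' := (d.mem_innerBall_source.1 hz).1
    rw [d.centredChart_apply, h, add_neg_cancel_comm]
    exact ⟨Bl₀.apply_ne_zero hz' h0, Bl₀.chart_eq_of_ne_zero hz' h0⟩
  · refine innerChart_outerChart _ _ _ hid fun x hx z hz hxs h _ => ?_
    rw [d.mem_restr_source _ le_rfl] at hx
    exact absurd (hfar x z h hxs _ hz 1 h2) hx.2
  · refine innerChart_outerChart _ _ _ hid fun x hx z hz hxs h _ => ?_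
    rw [d.mem_restr_source _ h2] at hx
    exact absurd (hfar x z h hxs _ hz _ le_rfl) hx.2
  · refine innerChart_outerChart _ _ _ (isSliceRegularOn_slopes_mul_add i 0 univ)
      fun x _ z hz hxs h h0 => ⟨mem_univ _, ?_⟩
    rw [d.centredChart_apply, h, add_neg_cancel_comm, add_zero]
    exact Bl₀.chart_slopes (d.mem_innerBall_source.1 hz).1
  · by_cases hij : i = j
    · subst hij
      exact innerChart_innerChart _ _ _ hid fun z _ _ => ⟨mem_univ _, rfl⟩
    · exact innerChart_innerChart _ _ _ (isSliceRegularOn_slopes_transition hij) fun z hz hz' =>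
        Bl₀.chart_transition hij (d.mem_innerBall_source.1 hz).1 (d.mem_innerBall_source.1 hz').1

/-- Every point of the blow-up lies in a chart of the atlas in which the blow-down map is slice
regular. -/
theorem blowUpAtlas_cover (hA : IsRegularAtlas A) (hd : d.chart ∈ A)
    (t : BlowUp d.chart d.center d.center_mem) :
    ∃ e ∈ blowUpAtlas A d, t ∈ e.source ∧ ∃ e' ∈ A,
      blowDown d.chart d.center d.center_mem t ∈ e'.source ∧
      ∃ f : QSpace n → QSpace n, IsSliceRegularOn f univ ∧ ∀ s ∈ e.source,
        e' (blowDown d.chart d.center d.center_mem s) = f (e s) := by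
  have h2 : (2⁻¹ : ℝ) ≤ 1 := by norm_num
  have hid := isSliceRegularOn_id (n := n) univ
  set G := blowUpData d.chart d.center d.center_mem with hG
  have hinl : ∀ x : puncture M d.center, ∃ e ∈ blowUpAtlas A d, G.inl x ∈ e.source ∧ ∃ e' ∈ A,
      (x : M) ∈ e'.source ∧ ∃ f : QSpace n → QSpace n, IsSliceRegularOn f univ ∧ ∀ s ∈ e.source,
        e' (blowDown d.chart d.center d.center_mem s) = f (e s) := by
    intro x
    by_cases h1 : (x : M) ∈ d.closedDisc 1
    · by_cases h1' : (x : M) ∈ d.closedDisc 2⁻¹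
      · refine ⟨_, Or.inr (Or.inl rfl), (mem_outerChart_source _ _ _).2 ⟨x, rfl,
          d.mem_centredChart_source.2 ⟨h1.1, h1'.2.trans_lt (by norm_num)⟩⟩, d.chart, hd, h1.1,
          _, isSliceRegularOn_add_const (d.chart d.center) univ, fun s hs => ?_⟩
        obtain ⟨y, rfl, -⟩ := (mem_outerChart_source _ _ _).1 hs
        rw [outerChart_inl, d.centredChart_apply, neg_add_cancel_right]
        rfl
      · refine ⟨_, Or.inl (Or.inr rfl), (mem_outerChart_source _ _ _).2 ⟨x, rfl,
          (d.mem_restr_source _ h2).2 ⟨h1.1, h1'⟩⟩, d.chart, hd, h1.1, _, hid, fun s hs => ?_⟩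
        obtain ⟨y, rfl, -⟩ := (mem_outerChart_source _ _ _).1 hs
        rw [outerChart_inl]
        rfl
    · obtain ⟨E, hE, hx⟩ := hA.cover x
      refine ⟨_, Or.inl (Or.inl ⟨E, hE, rfl⟩), (mem_outerChart_source _ _ _).2 ⟨x, rfl,
        (d.mem_restr_source _ le_rfl).2 ⟨hx, h1⟩⟩, E, hE, hx, _, hid, fun s hs => ?_⟩
      obtain ⟨y, rfl, -⟩ := (mem_outerChart_source _ _ _).1 hs
      rw [outerChart_inl]
      rfl
  rcases G.exists_inl_or_inr t with ⟨x, rfl⟩ | ⟨z, rfl⟩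
  · exact hinl x
  by_cases h0 : z.1.1.1 = 0
  -- On the exceptional set the target chart must belong to `A`, so it is `φ` and not its translate.
  -- The blow-down map is then `b ↦ (b_k b_i)_k + φ(p)`, and the additive constant does no harm to
  -- the monomials.
  · obtain ⟨i, hi⟩ := Bl₀.exists_mem_chart z.1
    refine ⟨_, Or.inr (Or.inr ⟨i, rfl⟩), (mem_innerChart_source _ _ _).2 ⟨z, rfl,
      d.mem_innerBall_source.2 ⟨hi, ?_⟩⟩, d.chart, hd, d.chart.map_target z.2,
      _, isSliceRegularOn_slopes_mul_add i (d.chart d.center) univ, fun s hs => ?_⟩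
    · rw [h0, norm_zero]
      exact half_pos d.radius_pos
    · obtain ⟨y, rfl, hy⟩ := (mem_innerChart_source _ _ _).1 hs
      rw [innerChart_inr, d.innerBall_apply, ← Bl₀.chart_slopes (d.mem_innerBall_source.1 hy).1,
        add_comm]
      exact d.chart.right_inv y.2
  · have hx : d.chart.symm (d.chart d.center + z.1.1.1) ≠ d.center := fun h => h0 (by
      have := congrArg d.chart h
      rwa [d.chart.right_inv z.2, add_eq_left] at this)
    have hz : G.inl ⟨_, hx⟩ = G.inr z := (blowUp_inl_eq_inr _ _ _).2 rfl
    have := hinl ⟨_, hx⟩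
    rwa [hz] at this

variable [IsManifold 𝓘(ℝ, QSpace n) ∞ M]

theorem isRegularAtlas_blowUpAtlas (hA : IsRegularAtlas A) (hd : d.chart ∈ A) :
    IsRegularAtlas (blowUpAtlas A d) where
  subset_maximalAtlas := by
    have hc := hA.subset_maximalAtlas hd
    rintro _ ((⟨E, hE, rfl⟩ | rfl) | (rfl | ⟨i, rfl⟩))
    · exact outerChart_mem_maximalAtlas _ _ _ hc (restr_mem_maximalAtlas _
        (hA.subset_maximalAtlas hE) (d.isClosed_closedDisc le_rfl).isOpen_compl)
    · exact outerChart_mem_maximalAtlas _ _ _ hc (restr_mem_maximalAtlas _ hc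
        (d.isClosed_closedDisc (by norm_num)).isOpen_compl)
    · exact outerChart_mem_maximalAtlas _ _ _ hc (trans_translation_mem_maximalAtlas
        (restr_mem_maximalAtlas _ hc d.isOpen_openDisc) _)
    · exact innerChart_mem_maximalAtlas _ _ _ hc (restr_mem_maximalAtlas _
        (StructureGroupoid.subset_maximalAtlas _ (mem_range_self i)) d.isOpen_innerBall)
  cover t := by
    obtain ⟨e, he, ht, -⟩ := blowUpAtlas_cover hA hd t
    exact ⟨e, he, ht⟩
  transition := blowUpAtlas_transition hA hd

theorem isQuaternionicRegular_blowDown (hA : IsRegularAtlas A) (hd : d.chart ∈ A) :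
    IsQuaternionicRegular (blowUpAtlas A d) A (blowDown d.chart d.center d.center_mem) where
  contMDiff := contMDiff_blowDown _ _ _ (hA.subset_maximalAtlas hd)
  regular t := by
    obtain ⟨e, he, ht, e', he', ht', f, hf, h⟩ := blowUpAtlas_cover hA hd t
    refine ⟨e, he, e', he', ht, ht', hf.congr_mono (subset_univ _) fun q hq => ?_⟩
    rw [h _ (e.map_target hq.1), e.right_inv hq.1]

end Atlas

/-! ### Transport of regular atlases -/

section Transport

variable {n : ℕ} {X Y : Type*} [TopologicalSpace X] [ChartedSpace (QSpace n) X]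
  [TopologicalSpace Y] [ChartedSpace (QSpace n) Y] [IsManifold 𝓘(ℝ, QSpace n) ∞ X]
  (Φ : X ≃ₘ^∞⟮𝓘(ℝ, QSpace n), 𝓘(ℝ, QSpace n)⟯ Y)

/-- The pull-back of a set of charts by a diffeomorphism. -/
def pullbackAtlas (B : Set (OpenPartialHomeomorph Y (QSpace n))) :
    Set (OpenPartialHomeomorph X (QSpace n)) :=
  (fun e => Φ.toHomeomorph.transOpenPartialHomeomorph e) '' B

/-- The pulled-back charts have the same transition functions as the original ones, and in
corresponding charts the diffeomorphism and its inverse are the identity. -/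
theorem exists_isRegularAtlas_of_diffeomorph [IsManifold 𝓘(ℝ, QSpace n) ∞ Y]
    {B : Set (OpenPartialHomeomorph Y (QSpace n))} (hB : IsRegularAtlas B) :
    ∃ B' : Set (OpenPartialHomeomorph X (QSpace n)), IsRegularAtlas B' ∧
      IsQuaternionicRegular B' B Φ ∧ IsQuaternionicRegular B B' Φ.symm := by
  have hid := isSliceRegularOn_id (n := n) univ
  refine ⟨pullbackAtlas Φ B, ⟨?_, fun x => ?_, ?_⟩, ⟨Φ.contMDiff, fun x => ?_⟩,
    ⟨Φ.symm.contMDiff, fun y => ?_⟩⟩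
  · rintro _ ⟨e, he, rfl⟩
    have he' := hB.subset_maximalAtlas he
    refine OpenPartialHomeomorph.mem_maximalAtlas_of_contMDiffOn _ (fun x hx => ?_) fun v hv => ?_
    · exact ((contMDiffAt_of_mem_maximalAtlas he' hx).comp x
        Φ.contMDiff.contMDiffAt).contMDiffWithinAt
    · exact (Φ.symm.contMDiff.contMDiffAt.comp v
        (contMDiffAt_symm_of_mem_maximalAtlas he' hv)).contMDiffWithinAt
  · obtain ⟨e, he, hx⟩ := hB.cover (Φ x)
    exact ⟨_, mem_image_of_mem _ he, hx⟩
  · rintro _ ⟨e, he, rfl⟩ _ ⟨e', he', rfl⟩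
    refine isSliceRegularOn_transition (hB.transition e he e' he') fun t ht ht' => ?_
    have h : e.symm (e (Φ t)) = Φ t := e.left_inv ht
    refine ⟨⟨e.map_source ht, ?_⟩, ?_⟩
    · change e.symm (e (Φ t)) ∈ e'.source
      rw [h]
      exact ht'
    · change e' (Φ t) = e' (e.symm (e (Φ t)))
      rw [h]
  · obtain ⟨e, he, hx⟩ := hB.cover (Φ x)
    refine ⟨_, mem_image_of_mem _ he, e, he, hx, hx, hid.congr_mono (subset_univ _)
      fun q hq => ?_⟩
    change e (Φ (Φ.symm (e.symm q))) = q
    rw [Φ.apply_symm_apply]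
    exact e.right_inv hq.1
  · obtain ⟨e, he, hx⟩ := hB.cover y
    have hx' : Φ (Φ.symm y) ∈ e.source := by rwa [Φ.apply_symm_apply]
    refine ⟨e, he, _, mem_image_of_mem _ he, hx, hx', hid.congr_mono (subset_univ _)
      fun q hq => ?_⟩
    change e (Φ (Φ.symm (e.symm q))) = q
    rw [Φ.apply_symm_apply]
    exact e.right_inv hq.1

end Transport

/-! ### The radial profile -/

namespace RadialProfile

/-- A smooth function with value `0` on `(-∞, 4]` and value `1` on `[16, ∞)`. -/
def cutoff (σ : ℝ) : ℝ := Real.smoothTransition ((σ - 4) / 12)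

theorem cutoff_eq_zero {σ : ℝ} (h : σ ≤ 4) : cutoff σ = 0 :=
  Real.smoothTransition.zero_of_nonpos (by linarith)

theorem cutoff_eq_one {σ : ℝ} (h : 16 ≤ σ) : cutoff σ = 1 :=
  Real.smoothTransition.one_of_one_le (by linarith)

theorem cutoff_nonneg (σ : ℝ) : 0 ≤ cutoff σ := Real.smoothTransition.nonneg _

theorem cutoff_le_one (σ : ℝ) : cutoff σ ≤ 1 := Real.smoothTransition.le_one _

theorem contDiff_cutoff : ContDiff ℝ ∞ cutoff :=
  Real.smoothTransition.contDiff.comp (by fun_prop)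

theorem deriv_cutoff_nonneg (σ : ℝ) : 0 ≤ deriv cutoff σ :=
  Monotone.deriv_nonneg fun a b h => Real.smoothTransition.monotone (by linarith)

/-- The ratio of the square of the profile and of the variable. -/
def slope (σ : ℝ) : ℝ := (1 - cutoff σ) / 64 + cutoff σ * ((1 - (√σ)⁻¹) ^ 2 / σ)

/-- The square of the radial profile, as a function of the square of the radius. It interpolates
between `σ / 64` and `(1 - 1 / √σ)²`. -/
def profile (σ : ℝ) : ℝ := σ * slope σ

theorem two_le_sqrt {σ : ℝ} (h : 4 ≤ σ) : 2 ≤ √σ := by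
  rw [Real.le_sqrt' two_pos]
  linarith

theorem sqrt_inv_le {σ : ℝ} (h : 4 ≤ σ) : (√σ)⁻¹ ≤ 2⁻¹ :=
  inv_anti₀ (by norm_num) (two_le_sqrt h)

/-- Strict positivity makes the square root `factor` smooth everywhere, in particular at `σ = 0`,
which corresponds to the exceptional set. -/
theorem slope_pos (σ : ℝ) : 0 < slope σ := by
  rcases le_or_gt σ 4 with h | h
  · rw [slope, cutoff_eq_zero h]
    norm_num
  · have h1 := cutoff_nonneg σ
    have h2 := cutoff_le_one σ
    have h3 := sqrt_inv_le h.le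
    have h4 : 0 < (1 - (√σ)⁻¹) ^ 2 / σ := by
      have : 0 < 1 - (√σ)⁻¹ := by linarith
      positivity
    rcases h2.eq_or_lt with h5 | h5
    · rw [slope, h5]
      linarith
    · have : 0 ≤ cutoff σ * ((1 - (√σ)⁻¹) ^ 2 / σ) := by positivity
      rw [slope]
      linarith

/-- Below `4` the function is the constant `1/64`, so the singularities of `√σ` and `1/σ` at the
origin are never seen. -/
theorem contDiff_slope : ContDiff ℝ ∞ slope := by
  rw [contDiff_iff_contDiffAt]
  intro σ
  rcases lt_or_ge σ 4 with h | h
  · refine (contDiffAt_const (c := (1 / 64 : ℝ))).congr_of_eventuallyEq ?_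
    filter_upwards [Iio_mem_nhds h] with τ hτ
    simp [slope, cutoff_eq_zero (mem_Iio.1 hτ).le]
  · have h0 : σ ≠ 0 := by linarith
    have h1 : ContDiffAt ℝ ∞ (fun σ : ℝ => √σ) σ := Real.contDiffAt_sqrt h0
    have h2 : √σ ≠ 0 := by linarith [two_le_sqrt h]
    have h3 := contDiff_cutoff.contDiffAt (x := σ)
    exact ((contDiffAt_const.sub h3).div_const _).add
      (h3.mul (((contDiffAt_const.sub (h1.inv h2)).pow 2).div contDiffAt_id h0))

theorem contDiff_profile : ContDiff ℝ ∞ profile := contDiff_id.mul contDiff_slope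

theorem profile_eq {σ : ℝ} (h : 0 < σ) :
    profile σ = (1 - cutoff σ) * (σ / 64) + cutoff σ * (1 - (√σ)⁻¹) ^ 2 := by
  rw [profile, slope]
  field_simp

theorem profile_of_le {σ : ℝ} (h : σ ≤ 4) : profile σ = σ / 64 := by
  rw [profile, slope, cutoff_eq_zero h]
  ring

theorem profile_of_ge {σ : ℝ} (h : 16 ≤ σ) : profile σ = (1 - (√σ)⁻¹) ^ 2 := by
  rw [profile_eq (by linarith), cutoff_eq_one h]
  ring

theorem hasDerivAt_outer {σ : ℝ} (h : 4 ≤ σ) :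
    ∃ c > 0, HasDerivAt (fun σ : ℝ => (1 - (√σ)⁻¹) ^ 2) c σ := by
  have h1 := two_le_sqrt h
  have h2 := sqrt_inv_le h
  have h3 : HasDerivAt (fun σ : ℝ => √σ) (1 / (2 * √σ)) σ := Real.hasDerivAt_sqrt (by linarith)
  have h4 := (((h3.fun_inv (by linarith)).const_sub 1).pow 2)
  refine ⟨_, ?_, h4⟩
  have h5 : 0 < 1 - (√σ)⁻¹ := by linarith
  have h6 : 0 < 1 / (2 * √σ) / √σ ^ 2 := by positivity
  rw [neg_div, neg_neg]
  positivity

/-- Between `4` and `16` the derivative is a convex combination of two positive derivatives plus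
`cutoff'` times the difference of the outer and the inner function. That difference is nonnegative
there, and the cutoff increases. -/
theorem deriv_profile_pos (σ : ℝ) : 0 < deriv profile σ := by
  rcases lt_or_ge σ 4 with h | h
  · have : deriv profile σ = 1 / 64 := by
      have h1 : HasDerivAt (fun σ : ℝ => σ / 64) (1 / 64) σ := (hasDerivAt_id σ).div_const 64
      refine (h1.congr_of_eventuallyEq ?_).deriv
      filter_upwards [Iio_mem_nhds h] with τ hτ using profile_of_le (mem_Iio.1 hτ).le
    rw [this]
    norm_num
  obtain ⟨c, hc, hP⟩ := hasDerivAt_outer h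
  rcases lt_or_ge 16 σ with h' | h'
  · have : deriv profile σ = c := by
      refine (hP.congr_of_eventuallyEq ?_).deriv
      filter_upwards [Ioi_mem_nhds h'] with τ hτ using profile_of_ge (mem_Ioi.1 hτ).le
    rwa [this]
  have hχ : HasDerivAt cutoff (deriv cutoff σ) σ :=
    (contDiff_cutoff.differentiable (by simp) σ).hasDerivAt
  have h1 : HasDerivAt (fun σ : ℝ => (1 - cutoff σ) * (σ / 64) + cutoff σ * (1 - (√σ)⁻¹) ^ 2)
      (-deriv cutoff σ * (σ / 64) + (1 - cutoff σ) * (1 / 64) +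
        (deriv cutoff σ * (1 - (√σ)⁻¹) ^ 2 + cutoff σ * c)) σ :=
    ((hχ.const_sub 1).mul ((hasDerivAt_id σ).div_const 64)).add (hχ.mul hP)
  have h2 : profile =ᶠ[nhds σ]
      fun σ : ℝ => (1 - cutoff σ) * (σ / 64) + cutoff σ * (1 - (√σ)⁻¹) ^ 2 := by
    filter_upwards [Ioi_mem_nhds (show (0 : ℝ) < σ by linarith)] with τ hτ using
      profile_eq (mem_Ioi.1 hτ)
  rw [(h1.congr_of_eventuallyEq h2).deriv]
  -- With `s = √σ` in `[2, 4]` this is `s/8 ≤ 1 - 1/s`, that is, `s² - 8s + 8 ≤ 0`, which holds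
  -- between the roots `4 ± 2√2`. This dictates the constant `64`.
  have h3 : σ / 64 ≤ (1 - (√σ)⁻¹) ^ 2 := by
    have h4 := two_le_sqrt h
    have h5 : √σ ≤ 4 := by
      rw [Real.sqrt_le_left (by norm_num)]
      linarith
    have h6 : √σ / 8 ≤ 1 - (√σ)⁻¹ := by
      have h7 : 0 < √σ := by linarith
      rw [div_le_iff₀ (by norm_num), ← sub_nonneg]
      have : (1 - (√σ)⁻¹) * 8 - √σ = (8 * √σ - 8 - √σ ^ 2) / √σ := by field_simp
      rw [this]
      apply div_nonneg _ h7.le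
      nlinarith
    calc σ / 64 = (√σ / 8) ^ 2 := by rw [div_pow, Real.sq_sqrt (by linarith)]; norm_num
      _ ≤ _ := by gcongr
  have h4 := deriv_cutoff_nonneg σ
  have h5 := cutoff_nonneg σ
  have h6 := cutoff_le_one σ
  have h7 : 0 ≤ deriv cutoff σ * ((1 - (√σ)⁻¹) ^ 2 - σ / 64) :=
    mul_nonneg h4 (sub_nonneg.2 h3)
  have h8 : 0 < (1 - cutoff σ) * (1 / 64) + cutoff σ * c := by
    rcases h6.eq_or_lt with h9 | h9
    · rw [h9]; linarith
    · have := mul_nonneg h5 hc.le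
      linarith
  linarith

/-- In the interpolating range `σ / 64` is at most `1/4`, and the outer function stays below `1`.
Consequently the fibre vectors stay in the open ball of radius `r`. -/
theorem profile_lt_one (σ : ℝ) : profile σ < 1 := by
  rcases le_or_gt σ 4 with h | h
  · rw [profile_of_le h]
    linarith
  have h1 : (1 - (√σ)⁻¹) ^ 2 < 1 := by
    have h2 := sqrt_inv_le h.le
    have h3 : 0 < (√σ)⁻¹ := inv_pos.2 (by linarith [two_le_sqrt h.le])
    nlinarith
  rcases le_or_gt 16 σ with h' | h'
  · rwa [profile_of_ge h']
  · rw [profile_eq (by linarith)]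
    have h5 := cutoff_nonneg σ
    have h6 := cutoff_le_one σ
    rcases h6.eq_or_lt with h9 | h9
    · rw [h9]; linarith
    · nlinarith

theorem exists_profile_eq {ν : ℝ} (h0 : 0 ≤ ν) (h1 : ν < 1) : ∃ σ ≥ 0, profile σ = ν := by
  have h2 : 0 < 2 / (1 - ν) := div_pos two_pos (by linarith)
  -- This `s` satisfies `s ≥ 4` and `2/s ≤ 1 - ν`, so `(1 - 1/s)² ≥ 1 - 2/s ≥ ν` and the
  -- intermediate value theorem applies on `[0, s²]`.
  set s := 4 + 2 / (1 - ν) with hs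
  have h3 : ν ≤ profile (s ^ 2) := by
    rw [profile_of_ge (by nlinarith), Real.sqrt_sq (by linarith)]
    have h4 : s⁻¹ * 2 ≤ 1 - ν := by
      rw [inv_mul_le_iff₀ (by linarith), hs, add_mul, div_mul_cancel₀ _ (by linarith)]
      linarith
    nlinarith [sq_nonneg s⁻¹]
  have h4 : profile 0 = 0 := by simp [profile]
  obtain ⟨σ, hσ, h⟩ := intermediate_value_Icc (sq_nonneg s)
    contDiff_profile.continuous.continuousOn ⟨h4.trans_le h0, h3⟩
  exact ⟨σ, hσ.1, h⟩

/-- The profile is increasing on all of `ℝ`, being linear on the negative axis. So its inverse is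
defined and smooth on a full neighbourhood of `0`, as smoothness at the exceptional set requires. -/
theorem isOpenEmbedding_profile : IsOpenEmbedding profile := by
  refine .of_continuous_injective_isOpenMap contDiff_profile.continuous
    (strictMono_of_deriv_pos deriv_profile_pos).injective ?_
  exact isOpenMap_of_hasStrictDerivAt (f' := deriv profile)
    (fun σ => (contDiff_profile.contDiffAt.hasStrictDerivAt (by simp)))
    fun σ => (deriv_profile_pos σ).ne'

/-- The inverse of `profile`. -/
def profileInv : ℝ → ℝ := isOpenEmbedding_profile.toOpenPartialHomeomorph.symm

theorem profileInv_profile (σ : ℝ) : profileInv (profile σ) = σ :=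
  isOpenEmbedding_profile.toOpenPartialHomeomorph_left_inv

theorem contDiffAt_profileInv (σ : ℝ) : ContDiffAt ℝ ∞ profileInv (profile σ) := by
  have h := profileInv_profile σ
  refine OpenPartialHomeomorph.contDiffAt_symm_deriv _ (deriv_profile_pos σ).ne' ?_ ?_ ?_
  · simp
  · change HasDerivAt profile _ (profileInv (profile σ))
    rw [h]
    exact (contDiff_profile.differentiable (by simp) σ).hasDerivAt
  · exact contDiff_profile.contDiffAt

/-- The factor by which the fibre coordinate is multiplied. -/
def factor (σ : ℝ) : ℝ := √(slope σ)

/-- The factor for the inverse map. -/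
def factorInv (ν : ℝ) : ℝ := (factor (profileInv ν))⁻¹

theorem factor_pos (σ : ℝ) : 0 < factor σ := Real.sqrt_pos.2 (slope_pos σ)

theorem contDiff_factor : ContDiff ℝ ∞ factor := contDiff_slope.sqrt fun σ => (slope_pos σ).ne'

theorem profile_eq_mul_factor (σ : ℝ) : σ * factor σ ^ 2 = profile σ := by
  rw [factor, Real.sq_sqrt (slope_pos σ).le, profile]

theorem factorInv_profile (σ : ℝ) : factorInv (profile σ) = (factor σ)⁻¹ := by
  rw [factorInv, profileInv_profile]

/-- This is the range where the fibre map has to reproduce the gluing of the connected sum, with `s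
= 1/|a|`. -/
theorem factor_sq {s : ℝ} (h : 4 ≤ s) : factor (s ^ 2) = (1 - s⁻¹) / s := by
  have h1 : (16 : ℝ) ≤ s ^ 2 := by nlinarith
  have h2 : s⁻¹ ≤ 4⁻¹ := inv_anti₀ (by norm_num) h
  rw [factor, slope, cutoff_eq_one h1, Real.sqrt_sq (by linarith), sub_self, zero_div, zero_add,
    one_mul, ← div_pow, Real.sqrt_sq (div_nonneg (by linarith) (by linarith))]

theorem contDiffAt_factorInv {ν : ℝ} (h0 : 0 ≤ ν) (h1 : ν < 1) : ContDiffAt ℝ ∞ factorInv ν := by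
  obtain ⟨σ, -, rfl⟩ := exists_profile_eq h0 h1
  refine ContDiffAt.inv ?_ (factor_pos _).ne'
  exact contDiff_factor.contDiffAt.comp _ (contDiffAt_profileInv σ)

/-- Write `ν = profile σ`. Then `factorInv ν = 1 / factor σ` and `ν · factorInv ν² = σ`, so the two
scalings cancel. -/
theorem factor_mul_factorInv {ν : ℝ} (h0 : 0 ≤ ν) (h1 : ν < 1) :
    factor (ν * factorInv ν ^ 2) * factorInv ν = 1 := by
  obtain ⟨σ, -, rfl⟩ := exists_profile_eq h0 h1
  have h := factor_pos σ
  have h2 : σ * factor σ ^ 2 * (factor σ)⁻¹ ^ 2 = σ := by field_simp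
  rw [factorInv_profile, ← profile_eq_mul_factor, h2]
  exact mul_inv_cancel₀ h.ne'

end RadialProfile

/-! ### The punctured projective space and the tautological line bundle -/

open RadialProfile

section Tautological

variable {n : ℕ}

/-- The vector `(q₀, a₁, …, aₙ)`. -/
def consVec (q : ℍ[ℝ]) (a : QSpace n) : QSpace (n + 1) :=
  WithLp.toLp 2 (Fin.cons q fun k => a k)

theorem consVec_zero (q : ℍ[ℝ]) (a : QSpace n) : consVec q a 0 = q := rfl

theorem consVec_succ (q : ℍ[ℝ]) (a : QSpace n) (k : Fin n) : consVec q a k.succ = a k := rfl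

/-- The last `n` coordinates. -/
def tailVec (v : QSpace (n + 1)) : QSpace n := WithLp.toLp 2 fun k => v k.succ

theorem consVec_tailVec (v : QSpace (n + 1)) : consVec (v 0) (tailVec v) = v :=
  PiLp.ext fun k => Fin.cases rfl (fun _ => rfl) k

theorem tailVec_consVec (q : ℍ[ℝ]) (a : QSpace n) : tailVec (consVec q a) = a := rfl

theorem rsmul_consVec (q t : ℍ[ℝ]) (a : QSpace n) :
    rsmul (consVec q a) t = consVec (q * t) (rsmul a t) :=
  PiLp.ext fun k => Fin.cases rfl (fun _ => rfl) k

theorem consVec_ne_zero (q : ℍ[ℝ]) {a : QSpace n} (ha : a ≠ 0) : consVec q a ≠ 0 := fun h => ha (by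
  rw [← tailVec_consVec q a, h]; rfl)

theorem norm_sq_smul_star (x : ℝ) (q : ℍ[ℝ]) : ‖x • star q‖ ^ 2 = x ^ 2 * ‖q‖ ^ 2 := by
  rw [norm_smul, mul_pow, Real.norm_eq_abs, sq_abs, norm_star]

/-- The point `[q₀, a₁, …, aₙ]` of `ℍℙⁿ`, for `a ≠ 0`. -/
def HP.consPoint (q : ℍ[ℝ]) {a : QSpace n} (ha : a ≠ 0) : HP n :=
  Projectivization.mk _ (consVec q a) (consVec_ne_zero q ha)

theorem HP.consPoint_rsmul (q : ℍ[ℝ]) {a : QSpace n} (ha : a ≠ 0) {t : ℍ[ℝ]} (ht : t ≠ 0) :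
    HP.consPoint (q * t) (rsmul_ne_zero ha ht) = HP.consPoint q ha :=
  (QLines.mk_eq_mk_iff _ _).2 ⟨t, ht, (rsmul_consVec q t a).symm⟩

theorem HP.eq_consPoint_rep (y : HP n) (h : tailVec y.rep ≠ 0) :
    y = HP.consPoint (y.rep 0) h := by
  conv_lhs => rw [← y.mk_rep]
  exact (QLines.mk_eq_mk_iff _ _).2 ⟨1, one_ne_zero, PiLp.ext fun k => by
    rw [consVec_tailVec, rsmul_apply, mul_one]⟩

theorem HP.consPoint_ne_center (q : ℍ[ℝ]) {a : QSpace n} (ha : a ≠ 0) :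
    HP.consPoint q ha ≠ (HP.standardDisc n).center := by
  intro h
  obtain ⟨t, -, h⟩ := (QLines.mk_eq_mk_iff _ _).1 h
  refine ha (PiLp.ext fun k => ?_)
  rw [← consVec_succ q a k, h, rsmul_apply, ← Fin.succAbove_zero, HP.homog_succAbove]
  exact zero_mul t

theorem HP.tailVec_rep_ne_zero {y : HP n} (hy : y ≠ (HP.standardDisc n).center) :
    tailVec y.rep ≠ 0 := by
  intro h
  refine hy ?_
  rw [← y.mk_rep]
  have h0 : y.rep 0 ≠ 0 := fun h0 => y.rep_nonzero (by
    rw [← consVec_tailVec y.rep, h, h0]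
    exact PiLp.ext fun k => Fin.cases rfl (fun _ => rfl) k)
  refine (QLines.mk_eq_mk_iff _ _).2 ⟨_, h0, PiLp.ext fun k => ?_⟩
  rw [rsmul_apply]
  refine Fin.cases ?_ (fun k => ?_) k
  · rw [HP.homog_self, one_mul]
  · have h1 : y.rep k.succ = tailVec y.rep k := rfl
    rw [h1, h, ← Fin.succAbove_zero, HP.homog_succAbove]
    exact (zero_mul _).symm

/-- The point `(aλ, [a])` of the blow-up. -/
def Bl₀.ofLine {a : QSpace n} (ha : a ≠ 0) (t : ℍ[ℝ]) : Bl₀ n :=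
  ⟨(rsmul a t, Projectivization.mk _ a ha), by
    rw [Projectivization.submodule_mk, Submodule.mem_span_singleton]
    exact ⟨MulOpposite.op t, rfl⟩⟩

theorem Bl₀.ofLine_rsmul {a : QSpace n} (ha : a ≠ 0) {s : ℍ[ℝ]} (hs : s ≠ 0) (t : ℍ[ℝ]) :
    Bl₀.ofLine (rsmul_ne_zero ha hs) t = Bl₀.ofLine ha (s * t) :=
  Subtype.ext (Prod.ext (rsmul_rsmul a s t) ((QLines.mk_eq_mk_iff _ _).2 ⟨s, hs, rfl⟩))

theorem Bl₀.exists_eq_ofLine (z : Bl₀ n) :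
    ∃ (a : QSpace n) (ha : a ≠ 0) (t : ℍ[ℝ]), z = Bl₀.ofLine ha t := by
  obtain ⟨⟨q, a⟩, h⟩ := z
  induction a using Projectivization.ind with
  | h a ha =>
    have h' := h
    rw [Projectivization.submodule_mk, Submodule.mem_span_singleton] at h'
    obtain ⟨t, rfl⟩ := h'
    exact ⟨a, ha, t.unop, rfl⟩

theorem Bl₀.chart_symm_eq (i : Fin n) (b : QSpace n) :
    (Bl₀.chart i).symm b = Bl₀.ofLine (Bl₀.slopes_ne_zero i b) (b i) := rfl

/-! ### Collapsing the fibres -/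

/-- The fibre coordinate in the blow-up of the point `[q, a]`. -/
def fibreCoord (r : ℝ) (q : ℍ[ℝ]) (a : QSpace n) : ℍ[ℝ] :=
  (r * factor (‖q‖ ^ 2 / ‖a‖ ^ 2) / ‖a‖ ^ 2) • star q

/-- The first homogeneous coordinate of the point that corresponds to `(at, [a])`. -/
def fibreCoordInv (r : ℝ) (t : ℍ[ℝ]) (a : QSpace n) : ℍ[ℝ] :=
  (factorInv (‖a‖ ^ 2 * ‖t‖ ^ 2 / r ^ 2) * ‖a‖ ^ 2 / r) • star t

theorem norm_sq_pos {a : QSpace n} (ha : a ≠ 0) : 0 < ‖a‖ ^ 2 := by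
  have := norm_pos_iff.2 ha
  positivity

/-- Conjugation turns `q t` into `t̄ q̄`, and `t t̄ = |t|²` cancels the change of `|a|²`. This makes
`(at, [a])` depend only on the point `[q, a]`. -/
theorem fibreCoord_rsmul (r : ℝ) (q : ℍ[ℝ]) {a : QSpace n} (ha : a ≠ 0) {t : ℍ[ℝ]} (ht : t ≠ 0) :
    t * fibreCoord r (q * t) (rsmul a t) = fibreCoord r q a := by
  have h1 := norm_sq_pos ha
  have h2 : 0 < ‖t‖ ^ 2 := by positivity
  have h3 : t * star t = ((‖t‖ ^ 2 : ℝ) : ℍ[ℝ]) := by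
    rw [Quaternion.self_mul_star, Quaternion.normSq_eq_norm_mul_self, sq]
  rw [fibreCoord, fibreCoord, norm_sq_rsmul, norm_mul, mul_pow, mul_div_mul_right _ _ h2.ne',
    star_mul, mul_smul_comm, ← mul_assoc, h3, Quaternion.coe_mul_eq_smul, smul_smul]
  congr 1
  field_simp

/-- The left side is the normalized squared length of the vector `at`; hence the radius in the
blow-up is governed by the profile alone. -/
theorem norm_sq_fibreCoord {r : ℝ} (hr : 0 < r) (q : ℍ[ℝ]) {a : QSpace n} (ha : a ≠ 0) :
    ‖a‖ ^ 2 * ‖fibreCoord r q a‖ ^ 2 / r ^ 2 = profile (‖q‖ ^ 2 / ‖a‖ ^ 2) := by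
  have h1 := norm_sq_pos ha
  rw [← profile_eq_mul_factor, fibreCoord, norm_sq_smul_star]
  field_simp

theorem fibreCoordInv_fibreCoord {r : ℝ} (hr : 0 < r) (q : ℍ[ℝ]) {a : QSpace n} (ha : a ≠ 0) :
    fibreCoordInv r (fibreCoord r q a) a = q := by
  have h1 := norm_sq_pos ha
  have h2 := factor_pos (‖q‖ ^ 2 / ‖a‖ ^ 2)
  rw [fibreCoordInv, norm_sq_fibreCoord hr q ha, factorInv_profile, fibreCoord,
    Quaternion.star_smul, star_star, smul_smul]
  convert one_smul ℝ q using 2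
  field_simp

theorem fibreCoord_fibreCoordInv {r : ℝ} (hr : 0 < r) (t : ℍ[ℝ]) {a : QSpace n} (ha : a ≠ 0)
    (h : ‖a‖ ^ 2 * ‖t‖ ^ 2 / r ^ 2 < 1) : fibreCoord r (fibreCoordInv r t a) a = t := by
  have h1 := norm_sq_pos ha
  have h2 := factor_mul_factorInv (ν := ‖a‖ ^ 2 * ‖t‖ ^ 2 / r ^ 2) (by positivity) h
  have h3 : ‖fibreCoordInv r t a‖ ^ 2 / ‖a‖ ^ 2 = ‖a‖ ^ 2 * ‖t‖ ^ 2 / r ^ 2 *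
      factorInv (‖a‖ ^ 2 * ‖t‖ ^ 2 / r ^ 2) ^ 2 := by
    rw [fibreCoordInv, norm_sq_smul_star]
    field_simp
  rw [fibreCoord, h3, fibreCoordInv, Quaternion.star_smul, star_star, smul_smul]
  convert one_smul ℝ t using 2
  rw [← h2]
  field_simp

/-- The map `[q, a] ↦ (at, [a])` from the punctured projective space to the blow-up. -/
def HP.toBl₀ [Nonempty (Bl₀ n)] (r : ℝ) (y : HP n) : Bl₀ n :=
  open Classical in
  if h : tailVec y.rep ≠ 0 then Bl₀.ofLine h (fibreCoord r (y.rep 0) (tailVec y.rep))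
  else Classical.arbitrary _

/-- The definition uses a chosen representative. Homogeneity of the fibre coordinate replaces it by
any other. -/
theorem HP.toBl₀_consPoint [Nonempty (Bl₀ n)] (r : ℝ) (q : ℍ[ℝ]) {a : QSpace n} (ha : a ≠ 0) :
    HP.toBl₀ r (HP.consPoint q ha) = Bl₀.ofLine ha (fibreCoord r q a) := by
  obtain ⟨t, ht, h⟩ := (QLines.mk_eq_mk_iff (HP.consPoint q ha).rep_nonzero
    (consVec_ne_zero q ha)).1 (HP.consPoint q ha).mk_rep
  rw [rsmul_consVec] at h
  have h1 : tailVec (HP.consPoint q ha).rep = rsmul a t := by rw [h, tailVec_consVec]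
  have h2 : (HP.consPoint q ha).rep 0 = q * t := by rw [h, consVec_zero]
  have h3 : tailVec (HP.consPoint q ha).rep ≠ 0 := h1 ▸ rsmul_ne_zero ha ht
  rw [HP.toBl₀, dif_pos h3]
  simp only [h1, h2]
  rw [Bl₀.ofLine_rsmul ha ht, fibreCoord_rsmul r q ha ht]

/-- The map from the blow-up to the projective space that is inverse to `HP.toBl₀` over a ball. -/
def Bl₀.toHP (r : ℝ) (z : Bl₀ n) : HP n :=
  HP.consPoint ((factorInv (‖z.1.1‖ ^ 2 / r ^ 2) / r) • ∑ k, star (z.1.1 k) * z.1.2.rep k)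
    z.1.2.rep_nonzero

/-- For the vector `at` and the chosen representative `as` of its line, the sum in `Bl₀.toHP` is the
Hermitian product `|a|² t̄ s`. It produces the conjugate of the fibre coordinate without solving for
`t`, and the factor `s` disappears on rescaling. -/
theorem Bl₀.toHP_ofLine (r : ℝ) {a : QSpace n} (ha : a ≠ 0) (t : ℍ[ℝ]) :
    (Bl₀.ofLine ha t).toHP r = HP.consPoint (fibreCoordInv r t a) ha := by
  obtain ⟨s, hs, h⟩ := (QLines.mk_eq_mk_iff (Bl₀.ofLine ha t).1.2.rep_nonzero ha).1
    (Bl₀.ofLine ha t).1.2.mk_rep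
  have h1 : ∑ k, star ((Bl₀.ofLine ha t).1.1 k) * (Bl₀.ofLine ha t).1.2.rep k =
      ‖a‖ ^ 2 • (star t * s) := by
    rw [h, PiLp.norm_sq_eq_of_L2, Finset.sum_smul]
    refine Finset.sum_congr rfl fun k _ => ?_
    change star (a k * t) * (a k * s) = _
    rw [star_mul, mul_assoc, ← mul_assoc (star (a k)), Quaternion.star_mul_self,
      Quaternion.normSq_eq_norm_mul_self, Quaternion.coe_mul_eq_smul, mul_smul_comm, sq]
  have h2 : ‖(Bl₀.ofLine ha t).1.1‖ ^ 2 = ‖a‖ ^ 2 * ‖t‖ ^ 2 := norm_sq_rsmul a t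
  rw [Bl₀.toHP, h1, h2, smul_smul, ← smul_mul_assoc]
  simp only [h]
  rw [HP.consPoint_rsmul _ ha hs, fibreCoordInv, div_mul_eq_mul_div]

theorem Bl₀.toHP_ne_center (r : ℝ) (z : Bl₀ n) : z.toHP r ≠ (HP.standardDisc n).center :=
  HP.consPoint_ne_center _ _

theorem HP.toHP_toBl₀ [Nonempty (Bl₀ n)] {r : ℝ} (hr : 0 < r) {y : HP n}
    (hy : y ≠ (HP.standardDisc n).center) : (HP.toBl₀ r y).toHP r = y := by
  have h := HP.tailVec_rep_ne_zero hy
  conv_lhs => rw [HP.eq_consPoint_rep y h, HP.toBl₀_consPoint, Bl₀.toHP_ofLine,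
    fibreCoordInv_fibreCoord hr _ h]
  exact (HP.eq_consPoint_rep y h).symm

theorem HP.norm_toBl₀_lt [Nonempty (Bl₀ n)] {r : ℝ} (hr : 0 < r) {y : HP n}
    (hy : y ≠ (HP.standardDisc n).center) : ‖(HP.toBl₀ r y).1.1‖ < r := by
  have h := HP.tailVec_rep_ne_zero hy
  rw [HP.eq_consPoint_rep y h, HP.toBl₀_consPoint]
  have h1 := norm_sq_fibreCoord hr (y.rep 0) h
  have h2 := profile_lt_one (‖y.rep 0‖ ^ 2 / ‖tailVec y.rep‖ ^ 2)
  rw [← h1, div_lt_one (by positivity), ← norm_sq_rsmul] at h2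
  exact lt_of_pow_lt_pow_left₀ 2 hr.le h2

theorem Bl₀.toBl₀_toHP [Nonempty (Bl₀ n)] {r : ℝ} (hr : 0 < r) {z : Bl₀ n}
    (hz : ‖z.1.1‖ < r) : HP.toBl₀ r (z.toHP r) = z := by
  obtain ⟨a, ha, t, rfl⟩ := z.exists_eq_ofLine
  rw [Bl₀.toHP_ofLine, HP.toBl₀_consPoint, fibreCoord_fibreCoordInv hr t ha]
  rw [← norm_sq_rsmul, div_lt_one (by positivity)]
  exact pow_lt_pow_left₀ hz (norm_nonneg _) two_ne_zero

theorem contDiffAt_norm_sq {F : Type*} [NormedAddCommGroup F] [NormedSpace ℝ F] {m : ℕ}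
    {f : F → QSpace m} {x : F} (hf : ContDiffAt ℝ ∞ f x) :
    ContDiffAt ℝ ∞ (fun y => ‖f y‖ ^ 2) x :=
  hf.norm_sq ℝ

/-- In the chart where `a_j = 1` the slopes are unchanged, and the only nontrivial coordinate is the
fibre coordinate, a smooth function of `q` and `a` because `|a|² ≥ 1`. -/
theorem contMDiffAt_toBl₀ [Nonempty (Bl₀ n)] (r : ℝ) {y : HP n}
    (hy : y ≠ (HP.standardDisc n).center) :
    ContMDiffAt 𝓘(ℝ, QSpace n) 𝓘(ℝ, QSpace n) ∞ (HP.toBl₀ r) y := by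
  obtain ⟨j, hj⟩ : ∃ j : Fin n, y ∈ QLines.affine j.succ := by
    by_contra! h
    refine HP.tailVec_rep_ne_zero hy (PiLp.ext fun k => ?_)
    have := h k
    rw [← y.mk_rep, QLines.mk_mem_affine, not_not] at this
    exact this
  have ha : ∀ b : QSpace n, tailVec (HP.homog j.succ b) j = 1 := fun b => HP.homog_self j.succ b
  have ha0 : ∀ b : QSpace n, tailVec (HP.homog j.succ b) ≠ 0 := fun b h => by
    have := ha b
    rw [h] at this
    exact zero_ne_one this
  refine contMDiffAt_of_charts (e := HP.affineChart j.succ) (e' := Bl₀.chart j)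
    (StructureGroupoid.subset_maximalAtlas _ (mem_range_self _))
    (StructureGroupoid.subset_maximalAtlas _ (mem_range_self _))
    (g := fun b => WithLp.toLp 2 (Function.update (fun k => tailVec (HP.homog j.succ b) k) j
      (fibreCoord r (HP.homog j.succ b 0) (tailVec (HP.homog j.succ b))))) hj ?_ ?_ (mem_univ _)
  · intro y' hy'
    have h1 : y' = HP.consPoint (HP.homog j.succ (HP.affineChart j.succ y') 0)
        (ha0 (HP.affineChart j.succ y')) := by
      conv_lhs => rw [← (HP.affineChart j.succ).left_inv hy']
      simp only [HP.consPoint, consVec_tailVec]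
      rfl
    conv_lhs => rw [h1]
    rw [HP.toBl₀_consPoint, Bl₀.chart_symm_eq]
    set b := HP.affineChart j.succ y'
    have h2 : Bl₀.slopes j (WithLp.toLp 2 (Function.update
        (fun k => tailVec (HP.homog j.succ b) k) j (fibreCoord r (HP.homog j.succ b 0)
          (tailVec (HP.homog j.succ b))))) = tailVec (HP.homog j.succ b) := by
      refine PiLp.ext fun k => ?_
      by_cases hk : k = j
      · subst hk; rw [Bl₀.slopes_self, ha]
      · simp [Bl₀.slopes, hk]
    simp only [h2, Function.update_self]
  · have h1 := fun k => (contDiff_piLp 2).1 (HP.contDiff_homog (n := n) j.succ) k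
    have h2 : ContDiff ℝ ∞ fun b : QSpace n => tailVec (HP.homog j.succ b) :=
      (contDiff_piLp 2).2 fun k => h1 k.succ
    refine (contDiffAt_piLp 2).2 fun k => ?_
    by_cases hk : k = j
    · subst hk
      simp only [Function.update_self, fibreCoord]
      set b := HP.affineChart k.succ y
      have h3 := contDiffAt_norm_sq (h2.contDiffAt (x := b))
      have h4 : ContDiffAt ℝ ∞ (fun b : QSpace n => ‖HP.homog k.succ b 0‖ ^ 2) b :=
        (h1 0).contDiffAt.norm_sq ℝ
      have h5 := (norm_sq_pos (ha0 b)).ne'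
      exact ((contDiffAt_const.mul (contDiff_factor.contDiffAt.comp b (h4.div h3 h5))).div
        h3 h5).smul (contDiff_qstar.contDiffAt.comp b (h1 0).contDiffAt)
    · simp only [Function.update_of_ne hk]
      exact (h1 k.succ).contDiffAt

/-- With `a_j = 1` again, the slopes are unchanged and the new coordinate is `fibreCoordInv`. Over
the open ball its argument `|a|²|t|²/r²` lies in `[0, 1)`, where `factorInv` is smooth. -/
theorem contMDiffAt_toHP {r : ℝ} (hr : 0 < r) {z : Bl₀ n} (hz : ‖z.1.1‖ < r) :
    ContMDiffAt 𝓘(ℝ, QSpace n) 𝓘(ℝ, QSpace n) ∞ (Bl₀.toHP r) z := by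
  obtain ⟨j, hj⟩ := z.exists_mem_chart
  have hz' : ∀ z ∈ (Bl₀.chart j).source,
      z = Bl₀.ofLine (Bl₀.slopes_ne_zero j (Bl₀.chart j z)) (Bl₀.chart j z j) := fun z hz => by
    conv_lhs => rw [← (Bl₀.chart j).left_inv hz, Bl₀.chart_symm_eq]
  refine contMDiffAt_of_charts (e := Bl₀.chart j) (e' := HP.affineChart j.succ)
    (StructureGroupoid.subset_maximalAtlas _ (mem_range_self _))
    (StructureGroupoid.subset_maximalAtlas _ (mem_range_self _))
    (g := fun b => WithLp.toLp 2 fun k => consVec (fibreCoordInv r (b j) (Bl₀.slopes j b))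
      (Bl₀.slopes j b) (j.succ.succAbove k)) hj ?_ ?_ (mem_univ _)
  · intro z' hz'
    conv_lhs => rw [← (Bl₀.chart j).left_inv hz', Bl₀.chart_symm_eq, Bl₀.toHP_ofLine]
    set b := Bl₀.chart j z'
    have h1 : HP.homog j.succ (WithLp.toLp 2 fun k => consVec (fibreCoordInv r (b j)
        (Bl₀.slopes j b)) (Bl₀.slopes j b) (j.succ.succAbove k)) =
        consVec (fibreCoordInv r (b j) (Bl₀.slopes j b)) (Bl₀.slopes j b) := by
      refine PiLp.ext fun k => ?_
      refine Fin.succAboveCases j.succ ?_ (fun k => ?_) k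
      · rw [HP.homog_self, consVec_succ, Bl₀.slopes_self]
      · rw [HP.homog_succAbove]
    change _ = Projectivization.mk _ (HP.homog j.succ _) _
    simp only [h1]
    rfl
  · set b := Bl₀.chart j z with hb
    have h1 := (Bl₀.contDiff_slopes j).contDiffAt (x := b)
    have h2 := contDiffAt_norm_sq h1
    have h3 : ContDiffAt ℝ ∞ (fun b : QSpace n => ‖b j‖ ^ 2) b :=
      (contDiff_qapply j).contDiffAt.norm_sq ℝ
    have h4 : ‖Bl₀.slopes j b‖ ^ 2 * ‖b j‖ ^ 2 / r ^ 2 < 1 := by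
      rw [← norm_sq_rsmul, div_lt_one (by positivity)]
      rw [hz' z hj] at hz
      exact pow_lt_pow_left₀ hz (norm_nonneg _) two_ne_zero
    have h5 : ContDiffAt ℝ ∞ (fun b : QSpace n => fibreCoordInv r (b j) (Bl₀.slopes j b)) b := by
      have h6 : ContDiffAt ℝ ∞ (fun b : QSpace n => ‖Bl₀.slopes j b‖ ^ 2 * ‖b j‖ ^ 2 / r ^ 2) b :=
        (h2.mul h3).div_const _
      have h7 := ContDiffAt.comp b (contDiffAt_factorInv (by positivity) h4) h6
      exact ((h7.mul h2).div_const r).smul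
        (contDiff_qstar.contDiffAt.comp b (contDiff_qapply j).contDiffAt)
    have h6 : ∀ m : Fin (n + 1), ContDiffAt ℝ ∞ (fun b : QSpace n =>
        consVec (fibreCoordInv r (b j) (Bl₀.slopes j b)) (Bl₀.slopes j b) m) b :=
      Fin.cases h5 fun i => ((contDiff_piLp 2).1 (Bl₀.contDiff_slopes j) i).contDiffAt
    exact (contDiffAt_piLp 2).2 fun k => h6 _

theorem HP.param_standardDisc {w : QSpace n} (hw : w ≠ 0) :
    (HP.standardDisc n).param w = HP.consPoint 1 hw := by
  have h1 : (HP.standardDisc n).chart (HP.standardDisc n).center = 0 :=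
    (HP.affineChart 0).right_inv (mem_univ (0 : QSpace n))
  have h2 : HP.homog 0 w = consVec 1 w := by
    refine PiLp.ext fun k => ?_
    refine Fin.cases ?_ (fun k => ?_) k
    · rw [HP.homog_self, consVec_zero]
    · rw [← Fin.succAbove_zero, HP.homog_succAbove, Fin.succAbove_zero, consVec_succ]
  rw [CoordDisc.param, h1]
  change (HP.affineChart 0).symm (0 + (1 : ℝ) • w) = _
  rw [zero_add, one_smul]
  change Projectivization.mk _ (HP.homog 0 w) _ = _
  simp only [h2]
  rfl

/-- Here `σ = 1/|a|² ≥ 16`, so the cutoff is `1`. The vector `at` is then `a` rescaled to length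
`r(1 - |a|)`, as the gluing demands. -/
theorem fibreCoord_one {r : ℝ} {a : QSpace n} (ha : a ≠ 0) (h : ‖a‖ ≤ 1 / 4) :
    fibreCoord r 1 a = ((r * (1 - ‖a‖) / ‖a‖ : ℝ) : ℍ[ℝ]) := by
  have h0 := norm_pos_iff.2 ha
  have h1 : 4 ≤ ‖a‖⁻¹ := by
    rw [le_inv_comm₀ (by norm_num) h0]
    linarith
  have h2 : ‖(1 : ℍ[ℝ])‖ ^ 2 / ‖a‖ ^ 2 = ‖a‖⁻¹ ^ 2 := by rw [norm_one, one_pow, one_div, inv_pow]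
  rw [fibreCoord, h2, factor_sq h1, star_one, ← Quaternion.coe_mul_eq_smul, mul_one]
  congr 1
  field_simp

theorem rsmul_coe (a : QSpace n) (x : ℝ) : rsmul a (x : ℍ[ℝ]) = x • a :=
  PiLp.ext fun k => by
    rw [rsmul_apply, Quaternion.mul_coe_eq_smul]
    rfl

end Tautological

/-! ### The connected sum and the blow-up are diffeomorphic -/

section Diffeomorphism

variable {n : ℕ} {M : Type*} [TopologicalSpace M]

theorem CoordDisc.mem_blowUpChartDomain (d : CoordDisc (QSpace n) M) {z : Bl₀ n}
    (hz : ‖z.1.1‖ < d.radius) : z ∈ blowUpChartDomain d.chart d.center := by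
  apply d.closedBall_subset
  rw [mem_closedBall_iff_norm, add_sub_cancel_left]
  exact hz.le

/-- The embedding of the punctured projective space in the part of the blow-up over a ball. -/
def CoordDisc.collapse [Nonempty (Bl₀ n)] (d : CoordDisc (QSpace n) M)
    (y : puncture (HP n) (HP.standardDisc n).center) : blowUpChartDomain d.chart d.center :=
  ⟨HP.toBl₀ d.radius y, d.mem_blowUpChartDomain (HP.norm_toBl₀_lt d.radius_pos y.2)⟩

variable [Nonempty (Bl₀ n)] (d : CoordDisc (QSpace n) M)

theorem CoordDisc.collapse_injective : Function.Injective d.collapse := fun y y' h => by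
  have h1 : HP.toBl₀ d.radius y.1 = HP.toBl₀ d.radius y'.1 := congrArg Subtype.val h
  rw [Subtype.ext_iff, ← HP.toHP_toBl₀ d.radius_pos y.2, h1, HP.toHP_toBl₀ d.radius_pos y'.2]

theorem CoordDisc.exists_collapse_eq {z : blowUpChartDomain d.chart d.center}
    (hz : ‖z.1.1.1‖ < d.radius) : ∃ y, d.collapse y = z :=
  ⟨⟨z.1.toHP d.radius, Bl₀.toHP_ne_center _ _⟩, Subtype.ext (Bl₀.toBl₀_toHP d.radius_pos hz)⟩

theorem CoordDisc.isLocalDiffeomorph_collapse :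
    IsLocalDiffeomorph 𝓘(ℝ, QSpace n) 𝓘(ℝ, QSpace n) ∞ d.collapse := fun y =>
  ⟨{ toFun := d.collapse
     invFun := fun z => ⟨z.1.toHP d.radius, Bl₀.toHP_ne_center _ _⟩
     source := univ
     target := {z | ‖z.1.1.1‖ < d.radius}
     map_source' := fun y _ => HP.norm_toBl₀_lt d.radius_pos y.2
     map_target' := fun _ _ => mem_univ _
     left_inv' := fun y _ => Subtype.ext (HP.toHP_toBl₀ d.radius_pos y.2)
     right_inv' := fun _ hz => Subtype.ext (Bl₀.toBl₀_toHP d.radius_pos hz)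
     open_source := isOpen_univ
     open_target := isOpen_lt (by fun_prop) continuous_const
     contMDiffOn_toFun := fun y _ => ContMDiffAt.contMDiffWithinAt <|
       (ContMDiffAt.subtypeVal_comp_iff _ _ _).1
         (contMDiffAt_subtype_iff.2 (contMDiffAt_toBl₀ d.radius y.2))
     contMDiffOn_invFun := fun _ hz => ContMDiffAt.contMDiffWithinAt <|
       (ContMDiffAt.subtypeVal_comp_iff _ _ _).1
         (contMDiffAt_subtype_iff.2 (contMDiffAt_toHP d.radius_pos hz)) },
    mem_univ _, fun _ _ => rfl⟩

variable [T2Space M]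

/-- The collar `3/4 < ‖d.coord x‖ < 1` is flipped to points `[1, a]` with `‖a‖ < 1/4`, and there the
fibre map gives back the vector `φ(x) - φ(p)`. -/
theorem CoordDisc.collapse_flip {x : puncture M d.center} (hx : (x : M) ∈ d.openDisc)
    (hx' : (x : M) ∉ d.closedDisc (3 / 4)) {y : puncture (HP n) (HP.standardDisc n).center}
    (hy : (HP.standardDisc n).param (radialFlip (d.coord x)) = y) :
    (blowUpData d.chart d.center d.center_mem).inl x =
      (blowUpData d.chart d.center d.center_mem).inr (d.collapse y) := by
  have h0 := d.coord_ne_zero hx.1 x.2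
  have hpos := norm_pos_iff.2 h0
  have h1 : 3 / 4 < ‖d.coord x‖ := not_le.1 fun h => hx' ⟨hx.1, h⟩
  have h2 := norm_radialFlip h0 hx.2
  have h3 : 0 < 1 - ‖d.coord x‖ := sub_pos.2 hx.2
  have h4 : radialFlip (d.coord x) ≠ 0 := norm_pos_iff.1 (h2 ▸ h3)
  have h5 : (d.collapse y).1.1.1 = d.radius • d.coord x := by
    change (HP.toBl₀ d.radius y.1).1.1 = _
    rw [← hy, HP.param_standardDisc h4, HP.toBl₀_consPoint]
    change rsmul _ _ = _
    rw [fibreCoord_one h4 (by linarith), rsmul_coe, h2, radialFlip, smul_smul]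
    congr 1
    field_simp
    ring
  rw [blowUp_inl_eq_inr, h5]
  exact (d.param_coord hx.1).symm

/-- For the converse, the image of the collapse lies over the open ball of radius `r`, so `x` is in
the collar. The flip of `x` and `y` then have the same image, and the collapse is injective. -/
theorem CoordDisc.inl_eq_inr_collapse_iff {x : puncture M d.center}
    (hx : (x : M) ∉ d.closedDisc (3 / 4)) {y : puncture (HP n) (HP.standardDisc n).center} :
    (d.connectedSumData (HP.standardDisc n)).inl x =
        (d.connectedSumData (HP.standardDisc n)).inr y ↔
      (blowUpData d.chart d.center d.center_mem).inl x =
        (blowUpData d.chart d.center d.center_mem).inr (d.collapse y) := by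
  constructor
  · intro h
    obtain ⟨h1, h2⟩ := (connectedSum_inl_eq_inr d _).1 h
    exact d.collapse_flip h1 hx h2
  · intro h
    obtain ⟨h1, h2, -⟩ := chart_of_inl_eq_inr _ _ _ h
    have h3 : (x : M) ∈ d.openDisc := by
      refine ⟨h1, ?_⟩
      rw [d.norm_coord_eq h2, inv_mul_lt_one₀ d.radius_pos]
      exact HP.norm_toBl₀_lt d.radius_pos y.2
    have h4 := d.collapse_flip h3 hx
      (y := ⟨_, (d.flip_mem (HP.standardDisc n) h3 x.2).2.1⟩) rfl
    have h5 := d.collapse_injective ((GluingData.inr_eq_inr _).1 (h4.symm.trans h))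
    exact (connectedSum_inl_eq_inr d _).2 ⟨h3, congrArg Subtype.val h5⟩

variable [ChartedSpace (QSpace n) M] [IsManifold 𝓘(ℝ, QSpace n) ∞ M]

/-- Points of `M` in the closed disc of normalized radius `3/4` need no separate map: in the
connected sum they are also points of the projective space, and in the blow-up they lie over the
open ball, which is the image of the collapse. -/
theorem CoordDisc.nonempty_diffeomorph_connectedSum_blowUp
    [IsManifold 𝓘(ℝ, QSpace n) ∞ (ConnectedSum d (HP.standardDisc n))]
    [IsManifold 𝓘(ℝ, QSpace n) ∞ (BlowUp d.chart d.center d.center_mem)] :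
    Nonempty (ConnectedSum d (HP.standardDisc n) ≃ₘ^∞⟮𝓘(ℝ, QSpace n), 𝓘(ℝ, QSpace n)⟯
      BlowUp d.chart d.center d.center_mem) := by
  set S := d.connectedSumData (HP.standardDisc n) with hS
  set T := blowUpData d.chart d.center d.center_mem with hT
  let W : Opens (puncture M d.center) := ⟨{x | (x : M) ∉ d.closedDisc (3 / 4)},
    (d.isClosed_closedDisc (by norm_num)).isOpen_compl.preimage continuous_subtype_val⟩
  have hW := isLocalDiffeomorph_val (E := QSpace n) W
  refine exists_diffeomorph_of_isLocalDiffeomorph (a₁ := fun x : W => S.inl x) (a₂ := S.inr)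
    (b₁ := fun x : W => T.inl x) (b₂ := fun y => T.inr (d.collapse y))
    (fun x => (hW x).comp _ _ (S.isLocalDiffeomorph_inl x.1)) S.isLocalDiffeomorph_inr
    (fun x => (hW x).comp _ _ (T.isLocalDiffeomorph_inl x.1))
    (fun y => (d.isLocalDiffeomorph_collapse y).comp _ _ (T.isLocalDiffeomorph_inr _))
    (fun s => ?_) (fun t => ?_) ?_
  · rcases S.exists_inl_or_inr s with ⟨x, rfl⟩ | ⟨y, rfl⟩
    · by_cases hx : (x : M) ∈ d.closedDisc (3 / 4)
      · have hx' : (x : M) ∈ d.openDisc := ⟨hx.1, hx.2.trans_lt (by norm_num)⟩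
        exact ⟨.inr ⟨_, (d.flip_mem (HP.standardDisc n) hx' x.2).2.1⟩,
          ((d.connectedSum_inl_eq_inr _).2 ⟨hx', rfl⟩).symm⟩
      · exact ⟨.inl ⟨x, hx⟩, rfl⟩
    · exact ⟨.inr y, rfl⟩
  · have key : ∀ z : blowUpChartDomain d.chart d.center, ‖z.1.1.1‖ < d.radius →
        ∃ w, Sum.elim (fun x : W => T.inl x) (fun y => T.inr (d.collapse y)) w = T.inr z := by
      intro z hz
      obtain ⟨y, rfl⟩ := d.exists_collapse_eq hz
      exact ⟨.inr y, rfl⟩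
    rcases T.exists_inl_or_inr t with ⟨x, rfl⟩ | ⟨z, rfl⟩
    · by_cases hx : (x : M) ∈ d.closedDisc (3 / 4)
      · obtain ⟨z, hz⟩ : ∃ z, T.inl x = T.inr z := ⟨_, T.inl_eq_inr.2 ⟨hx.1, rfl⟩⟩
        rw [hz]
        refine key z ?_
        have h1 := d.norm_coord_eq (chart_of_inl_eq_inr _ _ _ hz).2.1
        have h2 := hx.2.trans_lt (show (3 / 4 : ℝ) < 1 by norm_num)
        rwa [h1, inv_mul_lt_one₀ d.radius_pos] at h2
      · exact ⟨.inl ⟨x, hx⟩, rfl⟩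
    · by_cases hz : ‖z.1.1.1‖ < d.radius
      · exact key z hz
      · have h0 : z.1.1.1 ≠ 0 := fun h => hz (by rw [h, norm_zero]; exact d.radius_pos)
        have h1 : d.chart.symm (d.chart d.center + z.1.1.1) ≠ d.center := fun h => h0 (by
          have h2 := d.chart.right_inv z.2
          rw [h] at h2
          exact add_eq_left.1 h2.symm)
        obtain ⟨x, hx⟩ : ∃ x : puncture M d.center, T.inl x = T.inr z :=
          ⟨⟨_, h1⟩, (blowUp_inl_eq_inr _ _ _).2 rfl⟩
        refine ⟨.inl ⟨x, fun h => hz ?_⟩, hx⟩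
        have h1 := d.norm_coord_eq (chart_of_inl_eq_inr _ _ _ hx).2.1
        have h2 := h.2.trans_lt (show (3 / 4 : ℝ) < 1 by norm_num)
        rwa [h1, inv_mul_lt_one₀ d.radius_pos] at h2
  · rintro (x | y) (x' | y')
    · exact S.inl_eq_inl.trans T.inl_eq_inl.symm
    · exact d.inl_eq_inr_collapse_iff x.2
    · exact eq_comm.trans ((d.inl_eq_inr_collapse_iff x'.2).trans eq_comm)
    · exact S.inr_eq_inr.trans (d.collapse_injective.eq_iff.symm.trans T.inr_eq_inr.symm)

end Diffeomorphism

end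

/-! ### The theorem -/

theorem theorem1p1 {n : ℕ} (hn : 1 ≤ n) {M : Type*} [TopologicalSpace M] [T2Space M]
    [SecondCountableTopology M] [ChartedSpace (QSpace n) M] [IsManifold 𝓘(ℝ, QSpace n) ∞ M]
    (A : Set (OpenPartialHomeomorph M (QSpace n))) (hA : IsRegularAtlas A)
    (d : CoordDisc (QSpace n) M) (hd : d.chart ∈ A) :
    (T2Space (ConnectedSum d (HP.standardDisc n)) ∧
      SecondCountableTopology (ConnectedSum d (HP.standardDisc n)) ∧
      IsManifold 𝓘(ℝ, QSpace n) ∞ (ConnectedSum d (HP.standardDisc n))) ∧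
    (T2Space (BlowUp d.chart d.center d.center_mem) ∧
      SecondCountableTopology (BlowUp d.chart d.center d.center_mem) ∧
      IsManifold 𝓘(ℝ, QSpace n) ∞ (BlowUp d.chart d.center d.center_mem)) ∧
    ∃ (A₁ : Set (OpenPartialHomeomorph (ConnectedSum d (HP.standardDisc n)) (QSpace n)))
      (A₂ : Set (OpenPartialHomeomorph (BlowUp d.chart d.center d.center_mem) (QSpace n))),
      IsRegularAtlas A₁ ∧ IsRegularAtlas A₂ ∧
      IsQuaternionicRegular A₂ A (blowDown d.chart d.center d.center_mem) ∧
      ∃ Φ : ConnectedSum d (HP.standardDisc n) ≃ₘ^∞⟮𝓘(ℝ, QSpace n), 𝓘(ℝ, QSpace n)⟯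
          BlowUp d.chart d.center d.center_mem,
        IsQuaternionicRegular A₁ A₂ Φ ∧ IsQuaternionicRegular A₂ A₁ Φ.symm := by
  have he := hA.subset_maximalAtlas hd
  have h1 : (HP.standardDisc n).chart ∈ IsManifold.maximalAtlas 𝓘(ℝ, QSpace n) ∞ (HP n) :=
    StructureGroupoid.subset_maximalAtlas _ (mem_range_self 0)
  have hS := CoordDisc.isManifold_connectedSum d he (HP.standardDisc n) h1
  have hT := isManifold_blowUp d.chart d.center d.center_mem he
  have := CoordDisc.nonempty_puncture hn d
  have hne := CoordDisc.nonempty_blowUpChartDomain hn d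
  have : Nonempty (Bl₀ n) := hne.map Subtype.val
  obtain ⟨Φ⟩ := d.nonempty_diffeomorph_connectedSum_blowUp
  have hA₂ := isRegularAtlas_blowUpAtlas hA hd
  obtain ⟨A₁, hA₁, hΦ, hΦ'⟩ := exists_isRegularAtlas_of_diffeomorph Φ hA₂
  exact ⟨⟨GluingData.t2Space _ (CoordDisc.isClosed_connectedSum_graph d _),
      GluingData.secondCountableTopology _, hS⟩,
    ⟨GluingData.t2Space _ (isClosed_blowUp_graph d.chart d.center d.center_mem),
      GluingData.secondCountableTopology _, hT⟩,
    A₁, _, hA₁, hA₂, isQuaternionicRegular_blowDown hA hd, Φ, hΦ, hΦ'⟩
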